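/- **Setting.** Let $V$ be a finite-dimensional real vector space with a Lorentzian form $\ell$ of signature $(+,-,\dots,-)$, and let $C$ be one of the two closed convex round cones whose union is $\{v\in V:\ \ell(v,v)\ge 0\}$. A flat complete Lorentzian manifold is a quotient $M=V/\Gamma$, where $\Gamma$ is a group of affine transformations $\gamma(v)=\lambda(\gamma)v+\tau(\gamma)$ of $V$ which acts freely and properly (as a discrete group) and whose linear parts $\lambda(\gamma)$ preserve $\ell$ and $C$; put $G=\lambda(\Gamma)$, and let $\kappa:V\to M$ be the quotient mapping. A piecewise smooth path in $M$ is timelike if its velocity always lies in the field of cones induced by $C$ on $M$ (the boundary of the cone and zero are allowed). $M$ is causal if it has no nonconstant closed piecewise smooth timelike path. The future and the past of $p=\kappa(v)$ are $F_p=\kappa(v+C)$ and $P_p=\kappa(v-C)$. $M$ is strictly causal if it is causal and each $p\in M$ has a neighbourhood $U_p$ such that $U_p\cap F_p$ and $U_p\cap P_p$ are closed in $U_p$. **Theorem.** (I) Every strictly causal flat complete Lorentzian manifold $M=V/\Delta$ is finitely covered by a strictly causal manifold $V/\Gamma$ with $\Gamma\subseteq\Delta$ abelian (the natural projection $V/\Gamma\to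 V/\Delta$ is a covering with finite fibres), for which there are a point $\tilde o\in V$ and linear subspaces $V_0,V_1\subseteq V$ with $V=V_0\oplus V_1$ such that 1. the decomposition is $\ell$-orthogonal and $G$-invariant, $\ell$ is Lorentzian on $V_0$ and negative definite on $V_1$; 2. the affine subspace $U=\tilde o+V_0$ is $\Gamma$-invariant, and $\Gamma$ acts unipotently on it (the linear part of the restriction to $U$ of each $\gamma\in\Gamma$ is unipotent); 3. the restriction of the action of $\Gamma$ to $U$ is faithful, and $U/\Gamma$, with the form $\ell|_{V_0}$ and the cone $C\cap V_0$, is a strictly causal flat complete Lorentzian manifold; 4. the action of $\Gamma$ in $V_1$ is linear: there is a homomorphism $\alpha:\Gamma\to \mathrm O(\ell|_{V_1})$ with $\gamma(u+y)=\gamma(u)+\alpha(\gamma)y$ for all $\gamma\in\Gamma$, $u\in U$, $y\in V_1$. (II) The homomorphism $\alpha$ can be arbitrary: let $\Gamma$ be any abelian group of affine transformations of $V$ which satisfies 1–4 with some $\tilde o,V_0,V_1,\alpha$, and let $\beta:\Gamma\to \mathrm O(\ell|_{V_1})$ be any homomorphism. Then there is a faithful action $\rho$ of $\Gamma$ on $V$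 by affine transformations with $$\rho(\gamma)(u+y)=\gamma(u)+\beta(\gamma)y,\qquad \gamma\in\Gamma,\ u\in U,\ y\in V_1,$$ the quotient $V/\rho(\Gamma)$ is a strictly causal flat complete Lorentzian manifold, and $\rho(\Gamma)$ satisfies 1–4 with the same $\tilde o,V_0,V_1$ and with $\beta$ in place of $\alpha$. -/

import Mathlib

open scoped Topology ContDiff

namespace FlatLorentz

section Forms

variable {E : Type*} [AddCommGroup E] [Module ℝ E]

/-- `ℓ` is a Lorentzian form, of signature `(+,-,…,-)`: it is symmetric, and there is a vector `u`
with `ℓ(u,u) > 0` on whose orthogonal complement `ℓ` is negative definite. -/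
def IsLorentzian (ℓ : LinearMap.BilinForm ℝ E) : Prop :=
  (∀ v w, ℓ v w = ℓ w v) ∧ ∃ u, 0 < ℓ u u ∧ ∀ v, ℓ u v = 0 → v ≠ 0 → ℓ v v < 0

/-- `C` is one of the two closed convex round cones whose union is `{v | ℓ(v,v) ≥ 0}`
(for a Lorentzian form `ℓ`): the one that contains the vector `u`, where `ℓ(u,u) > 0`. -/
def IsTimeCone (ℓ : LinearMap.BilinForm ℝ E) (C : Set E) : Prop :=
  ∃ u, 0 < ℓ u u ∧ C = {v | 0 ≤ ℓ v v ∧ 0 ≤ ℓ u v}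

/-- The group `O(B)` of the linear automorphisms that preserve the bilinear form `B`. -/
def orthogonalGroup (B : LinearMap.BilinForm ℝ E) : Subgroup (E ≃ₗ[ℝ] E) where
  carrier := {g | ∀ x y, B (g x) (g y) = B x y}
  one_mem' := fun _ _ => rfl
  mul_mem' := fun {g h} hg hh x y => (hg (h x) (h y)).trans (hh x y)
  inv_mem' := fun {g} hg x y => by
    have h := hg (g⁻¹ x) (g⁻¹ y)
    have e : ∀ z, g (g⁻¹ z) = z := fun z => g.apply_symm_apply z
    rw [e, e] at h
    exact h.symm

/-- The tautological action of the affine group of `E` on `E`. -/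
instance affineAction : MulAction (E ≃ᵃ[ℝ] E) E where
  smul γ v := γ v
  one_smul _ := rfl
  mul_smul _ _ _ := rfl

/-- The quotient space `E/Γ`. -/
abbrev QuotientSpace (Γ : Subgroup (E ≃ᵃ[ℝ] E)) : Type _ := MulAction.orbitRel.Quotient Γ E

/-- The quotient mapping `κ : E → E/Γ`. -/
def proj (Γ : Subgroup (E ≃ᵃ[ℝ] E)) (v : E) : QuotientSpace Γ := Quotient.mk _ v

/-- The future `F_p = κ(v + C)`, where `κ(v) = p`. -/
def future (C : Set E) (Γ : Subgroup (E ≃ᵃ[ℝ] E)) (p : QuotientSpace Γ) : Set (QuotientSpace Γ) :=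
  {q | ∃ v, proj Γ v = p ∧ ∃ c ∈ C, q = proj Γ (v + c)}

/-- The past `P_p = κ(v - C)`, where `κ(v) = p`. -/
def past (C : Set E) (Γ : Subgroup (E ≃ᵃ[ℝ] E)) (p : QuotientSpace Γ) : Set (QuotientSpace Γ) :=
  {q | ∃ v, proj Γ v = p ∧ ∃ c ∈ C, q = proj Γ (v - c)}

end Forms

section Spacetimes

variable {E : Type*} [NormedAddCommGroup E] [NormedSpace ℝ E]

/-- `E/Γ` is a flat complete Lorentzian manifold: `Γ` acts freely and properly on `E` by affine
transformations whose linear parts keep `ℓ` and `C`. -/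
structure IsFlatSpacetime (ℓ : LinearMap.BilinForm ℝ E) (C : Set E)
    (Γ : Subgroup (E ≃ᵃ[ℝ] E)) : Prop where
  form : ∀ γ ∈ Γ, ∀ v w, ℓ (γ.linear v) (γ.linear w) = ℓ v w
  cone : ∀ γ ∈ Γ, γ.linear '' C = C
  free : ∀ γ ∈ Γ, ∀ v, γ v = v → γ = 1
  proper : ProperlyDiscontinuousSMul Γ E

/-- On `[a,b]`, the path `η` in `E/Γ` is smooth and timelike. The smooth structure and the cone
field of `E/Γ` are those that make `κ : E → E/Γ` a local diffeomorphism sending the constant cone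
field `C` to the cone field of `E/Γ`, so both conditions are expressed through
local smooth lifts `c` of `η` to `E`. -/
def IsTimelikeArc (C : Set E) (Γ : Subgroup (E ≃ᵃ[ℝ] E)) (η : ℝ → QuotientSpace Γ)
    (a b : ℝ) : Prop :=
  ∀ t ∈ Set.Icc a b, ∃ c : ℝ → E, ContDiff ℝ ∞ c ∧
    ∀ᶠ s in 𝓝[Set.Icc a b] t, proj Γ (c s) = η s ∧ deriv c s ∈ C

/-- The (continuous) path `η` in `E/Γ` is piecewise smooth and timelike. -/
def IsTimelikePath (C : Set E) (Γ : Subgroup (E ≃ᵃ[ℝ] E)) {p q : QuotientSpace Γ}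
    (η : Path p q) : Prop :=
  ∃ (n : ℕ) (t : ℕ → ℝ), StrictMono t ∧ t 0 = 0 ∧ t n = 1 ∧
    ∀ i < n, IsTimelikeArc C Γ η.extend (t i) (t (i + 1))

/-- `E/Γ` is causal: there is no closed piecewise smooth timelike path, except for the
constant ones. -/
def IsCausal (C : Set E) (Γ : Subgroup (E ≃ᵃ[ℝ] E)) : Prop :=
  ∀ (p : QuotientSpace Γ) (η : Path p p), IsTimelikePath C Γ η → ∀ s, η s = p

/-- `E/Γ` is a strictly causal flat complete Lorentzian manifold: it is causal and each point `p`
has a neighbourhood `U` such that `U ∩ F_p` and `U ∩ P_p` are closed in `U`. -/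
structure IsStrictlyCausal (ℓ : LinearMap.BilinForm ℝ E) (C : Set E)
    (Γ : Subgroup (E ≃ᵃ[ℝ] E)) : Prop extends IsFlatSpacetime ℓ C Γ where
  causal : IsCausal C Γ
  locallyClosed : ∀ p : QuotientSpace Γ, ∃ U ∈ 𝓝 p,
    IsClosed ((↑) ⁻¹' future C Γ p : Set U) ∧ IsClosed ((↑) ⁻¹' past C Γ p : Set U)

/-- `E/Γ` is a finite covering of `E/Δ`, through the natural projection. -/
def IsFiniteCover (Γ Δ : Subgroup (E ≃ᵃ[ℝ] E)) : Prop :=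
  Γ ≤ Δ ∧ ∃ π : QuotientSpace Γ → QuotientSpace Δ,
    (∀ v, π (proj Γ v) = proj Δ v) ∧ IsCoveringMap π ∧ ∀ q, (π ⁻¹' {q}).Finite

/-- The group `Γ` acts on `E` by the affine transformations `ρ γ`, and this action splits along
`o + V₀` and `V₁` into the affine action `ρ₀` (where `U = o + V₀` is identified with `V₀` through
`x ↦ o + x`) and the linear action `α`. -/
structure IsSplitting (ℓ : LinearMap.BilinForm ℝ E) (C : Set E) (o : E) (V₀ V₁ : Submodule ℝ E)
    {Γ : Type*} [Group Γ] (ρ : Γ →* (E ≃ᵃ[ℝ] E)) (ρ₀ : Γ →* (V₀ ≃ᵃ[ℝ] V₀))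
    (α : Γ →* orthogonalGroup (ℓ.restrict V₁)) : Prop where
  /-- `E = V₀ ⊕ V₁` -/
  isCompl : IsCompl V₀ V₁
  orthogonal : ∀ x ∈ V₀, ∀ y ∈ V₁, ℓ x y = 0
  /-- `V₀` is invariant under the linear parts. -/
  invariant₀ : ∀ γ, ∀ x ∈ V₀, (ρ γ).linear x ∈ V₀
  /-- `V₁` is invariant under the linear parts. -/
  invariant₁ : ∀ γ, ∀ y ∈ V₁, (ρ γ).linear y ∈ V₁
  lorentzian₀ : IsLorentzian (ℓ.restrict V₀)
  negDef₁ : ∀ y ∈ V₁, y ≠ 0 → ℓ y y < 0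
  /-- `o + V₀` is invariant, and the restriction of the action to it is `ρ₀`. -/
  base : ∀ γ (x : V₀), ρ γ (o + x) = o + ρ₀ γ x
  /-- The restriction to `o + V₀` is unipotent. -/
  unipotent : ∀ γ, IsNilpotent (((ρ₀ γ).linear : V₀ →ₗ[ℝ] V₀) - LinearMap.id : Module.End ℝ V₀)
  /-- The restriction to `o + V₀` is injective on `Γ`. -/
  faithful : Function.Injective ρ₀
  /-- `(o + V₀)/Γ` is strictly causal. -/
  strictlyCausal : IsStrictlyCausal (ℓ.restrict V₀) ((↑) ⁻¹' C : Set V₀) ρ₀.range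
  /-- The action in `V₁` is linear and is defined by `α`. -/
  fibre : ∀ γ (x : V₀) (y : V₁), ρ γ (o + x + y) = o + ρ₀ γ x + (α γ : V₁ ≃ₗ[ℝ] V₁) y

end Spacetimes

end FlatLorentz

open FlatLorentz

/-! A segment from `v` to `γ v` with causal direction would close up in the quotient, so causality
makes every displacement `γ v - v` with `γ ≠ 1` spacelike. Scaling `v` to infinity, the linear parts
satisfy `ℓ (g v - v) (g v - v) ≤ 0`. A group of such Lorentz maps fixes a causal vector `ξ ≠ 0`
(`exists_fixed_mem_timeCone`): if orbits are bounded, maximise `ℓ x x` over the closed convex hull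
of an orbit; otherwise `ξ` spans the image of a limit of `g / ‖g‖`.

On `ξ^⊥`, modulo isotropic vectors, the group acts by Euclidean rotations. A Bieberbach argument
follows: in a norm on `V × ℝ` weighted along the flag of `ξ`, commutators of elements with small
rotation contract to the identity, hence become trivial by discreteness (`exists_iterComm_eq_one`).
Since rotations have no small subgroups, already the first commutator rotates trivially, and such
elements preserve each other's generalized `1`-eigenspaces in `V × ℝ`. An invariant nondegenerate
flat of least dimension lies in all these eigenspaces, so the group generated by the elements with
small rotation is unipotent on it; by compactness this group has finite index
(`exists_finiteIndex_unipotent`). A commutator in it moves some point by an isotropic multiple of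
`ξ`, so it is trivial and the group is abelian.

Strict causality has to be carried between `V`, the flat `o + V₀` and new actions on `V`. Local
closedness of futures and pasts yields `NoReturn`, which passes to subgroups and invariant flats.
For unipotent groups it implies `LocallyFiniteCones`, through a bound of `‖γ v - v‖` by a multiple
of `1 - ℓ (γ v - v) (γ v - v)`. For translations the bound holds because their span is negative
definite; otherwise the component of the displacement along `ξ` grows at most quadratically with its
Euclidean part.

Finally, `V₁` is negative definite, so projecting to `o + V₀` can only increase `ℓ`. Local
finiteness on the flat therefore lifts to `V`, whatever isometric action is put on `V₁`
(`isStrictlyCausal_of_fibre`). This gives both the strict causality of the cover in (I) and the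
freedom of `β` in (II). -/

namespace FlatLorentz

/-! ### Lorentzian forms and their time cones. -/

section LorentzAlgebra

variable {E : Type*} [AddCommGroup E] [Module ℝ E] {ℓ : LinearMap.BilinForm ℝ E} {C : Set E}

/-- The orthogonal complement of any timelike vector is negative definite. -/
theorem IsLorentzian.neg_of_orthogonal (h : IsLorentzian ℓ) {u v : E} (hu : 0 < ℓ u u)
    (huv : ℓ u v = 0) (hv : v ≠ 0) : ℓ v v < 0 := by
  obtain ⟨hs, u₀, hu₀, hneg⟩ := h
  by_contra! hvv
  have hvu : ℓ v u = 0 := by rw [hs, huv]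
  -- This combination is orthogonal to `u₀`, yet `ℓ x x ≥ 0`. So `x = 0`, which kills both
  -- coefficients and puts the timelike vector `u` into the negative definite complement of `u₀`.
  set x : E := ℓ u₀ v • u - ℓ u₀ u • v with hx
  have h0 : ℓ u₀ x = 0 := by
    simp only [hx, map_sub, map_smul, smul_eq_mul]; ring
  have hxx : ℓ x x = (ℓ u₀ v) ^ 2 * ℓ u u + (ℓ u₀ u) ^ 2 * ℓ v v := by
    simp only [hx, map_sub, map_smul, LinearMap.sub_apply, LinearMap.smul_apply, smul_eq_mul,
      huv, hvu]
    ring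
  have hx0 : x = 0 := by
    by_contra hne
    have := hneg x h0 hne
    nlinarith [sq_nonneg (ℓ u₀ v), sq_nonneg (ℓ u₀ u), mul_nonneg (sq_nonneg (ℓ u₀ v)) hu.le,
      mul_nonneg (sq_nonneg (ℓ u₀ u)) hvv]
  have h1 : ℓ u₀ v = 0 := by
    have : ℓ u x = 0 := by rw [hx0, map_zero]
    simp only [hx, map_sub, map_smul, smul_eq_mul, huv, mul_zero, sub_zero] at this
    exact (mul_eq_zero.mp this).resolve_right hu.ne'
  have h2 : ℓ u₀ u = 0 := by
    rw [h1, zero_smul, zero_sub, hx0] at hx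
    exact (smul_eq_zero.mp (neg_eq_zero.mp hx.symm)).resolve_right hv
  have hune : u ≠ 0 := by rintro rfl; simp at hu
  exact absurd (hneg u h2 hune) (not_lt.mpr hu.le)

theorem IsLorentzian.eq_zero_of_forall (h : IsLorentzian ℓ) {v : E} (hv : ∀ w, ℓ v w = 0) :
    v = 0 := by
  by_contra hne
  obtain ⟨hs, u, hu, hneg⟩ := h
  have := hneg v (by rw [hs, hv]) hne
  rw [hv] at this
  exact lt_irrefl _ this

theorem IsLorentzian.nonpos_of_orthogonal (h : IsLorentzian ℓ) {ξ v : E} (hξ : 0 ≤ ℓ ξ ξ)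
    (hne : ξ ≠ 0) (hv : ℓ ξ v = 0) : ℓ v v ≤ 0 := by
  by_contra! hvv
  exact absurd (h.neg_of_orthogonal hvv (by rw [h.1, hv]) hne) (not_lt.mpr hξ)

/-- Isotropic vectors orthogonal to a nonzero causal vector are proportional to it. -/
theorem IsLorentzian.exists_eq_smul (h : IsLorentzian ℓ) {ξ v : E} (hξ : 0 ≤ ℓ ξ ξ)
    (hne : ξ ≠ 0) (hv : ℓ ξ v = 0) (hvv : ℓ v v = 0) : ∃ c : ℝ, v = c • ξ := by
  by_cases hv0 : v = 0
  · exact ⟨0, by simp [hv0]⟩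
  rcases hξ.lt_or_eq with hpos | hnull
  · exact absurd (h.neg_of_orthogonal hpos hv hv0) (by rw [hvv]; exact lt_irrefl _)
  obtain ⟨hs, u, hu, hneg⟩ := h
  have ha : ℓ u ξ ≠ 0 := fun h0 => absurd (hneg ξ h0 hne) (not_lt.mpr hξ)
  -- The coefficient makes `v - c • ξ` orthogonal to the timelike `u`; being isotropic as well, this
  -- vector must vanish.
  refine ⟨ℓ u v / ℓ u ξ, ?_⟩
  by_contra hx
  have hx' : v - (ℓ u v / ℓ u ξ) • ξ ≠ 0 := sub_ne_zero.mpr hx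
  have h0 : ℓ u (v - (ℓ u v / ℓ u ξ) • ξ) = 0 := by
    simp only [map_sub, map_smul, smul_eq_mul]; field_simp; ring
  have := hneg _ h0 hx'
  simp only [map_sub, map_smul, LinearMap.sub_apply, LinearMap.smul_apply, smul_eq_mul, hvv,
    hs v ξ, hv, ← hnull] at this
  simp at this

theorem IsTimeCone.nonneg (hC : IsTimeCone ℓ C) {v : E} (hv : v ∈ C) : 0 ≤ ℓ v v := by
  obtain ⟨u, -, rfl⟩ := hC
  exact hv.1

theorem IsTimeCone.zero_mem (hC : IsTimeCone ℓ C) : (0 : E) ∈ C := by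
  obtain ⟨u, -, rfl⟩ := hC
  simp

theorem IsTimeCone.smul_mem (hC : IsTimeCone ℓ C) {v : E} (hv : v ∈ C) {t : ℝ} (ht : 0 ≤ t) :
    t • v ∈ C := by
  obtain ⟨u, -, rfl⟩ := hC
  obtain ⟨h1, h2⟩ := hv
  refine ⟨?_, ?_⟩
  · simp only [map_smul, LinearMap.smul_apply, smul_eq_mul]; positivity
  · simp only [map_smul, smul_eq_mul]; positivity

theorem IsTimeCone.mem_or_neg_mem (hC : IsTimeCone ℓ C) {v : E} (hv : 0 ≤ ℓ v v) :
    v ∈ C ∨ -v ∈ C := by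
  obtain ⟨u, -, rfl⟩ := hC
  rcases le_total 0 (ℓ u v) with h | h
  · exact Or.inl ⟨hv, h⟩
  · exact Or.inr ⟨by simpa using hv, by simpa using h⟩

theorem IsTimeCone.eq_zero (hC : IsTimeCone ℓ C) (h : IsLorentzian ℓ) {v : E} (hv : v ∈ C)
    (hv' : -v ∈ C) : v = 0 := by
  obtain ⟨u, hu, rfl⟩ := hC
  by_contra hne
  have h2 := hv'.2
  rw [map_neg] at h2
  exact absurd (h.neg_of_orthogonal hu (le_antisymm (by linarith) hv.2) hne)
    (not_lt.mpr hv.1)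

/-- Reversed Cauchy–Schwarz: `ℓ u w • v - ℓ u v • w` is orthogonal to `u`, so its square is
nonpositive. In the expansion the two pure squares are nonnegative, so the mixed term forces the
sign of `ℓ v w`. -/
theorem IsTimeCone.pairing_nonneg (hC : IsTimeCone ℓ C) (h : IsLorentzian ℓ) {v w : E}
    (hv : v ∈ C) (hw : w ∈ C) : 0 ≤ ℓ v w := by
  obtain ⟨u, hu, rfl⟩ := hC
  obtain ⟨hv1, hv2⟩ := hv
  obtain ⟨hw1, hw2⟩ := hw
  by_cases hv0 : v = 0
  · simp [hv0]
  by_cases hw0 : w = 0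
  · simp [hw0]
  have ha : 0 < ℓ u v := lt_of_le_of_ne hv2 fun h0 =>
    absurd (h.neg_of_orthogonal hu h0.symm hv0) (not_lt.mpr hv1)
  have hb : 0 < ℓ u w := lt_of_le_of_ne hw2 fun h0 =>
    absurd (h.neg_of_orthogonal hu h0.symm hw0) (not_lt.mpr hw1)
  have hx : ℓ u (ℓ u w • v - ℓ u v • w) = 0 := by
    simp only [map_sub, map_smul, smul_eq_mul]; ring
  have hx2 := h.nonpos_of_orthogonal hu.le (by rintro rfl; simp at hu) hx
  simp only [map_sub, map_smul, LinearMap.sub_apply, LinearMap.smul_apply, smul_eq_mul,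
    h.1 w v] at hx2
  have hab := mul_pos ha hb
  by_contra! hneg
  nlinarith [mul_nonneg (sq_nonneg (ℓ u w)) hv1, mul_nonneg (sq_nonneg (ℓ u v)) hw1,
    mul_neg_of_pos_of_neg hab hneg]

theorem IsTimeCone.add_mem (hC : IsTimeCone ℓ C) (h : IsLorentzian ℓ) {v w : E}
    (hv : v ∈ C) (hw : w ∈ C) : v + w ∈ C := by
  have hp := hC.pairing_nonneg h hv hw
  obtain ⟨u, hu, rfl⟩ := hC
  refine ⟨?_, ?_⟩
  · simp only [map_add, LinearMap.add_apply, h.1 w v]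
    linarith [hv.1, hw.1]
  · rw [map_add]; linarith [hv.2, hw.2]

theorem IsTimeCone.convex (hC : IsTimeCone ℓ C) (h : IsLorentzian ℓ) : Convex ℝ C :=
  fun _ hx _ hy _ _ ha hb _ => hC.add_mem h (hC.smul_mem hx ha) (hC.smul_mem hy hb)

theorem IsTimeCone.neg (hC : IsTimeCone ℓ C) : IsTimeCone ℓ (-C) := by
  obtain ⟨u, hu, rfl⟩ := hC
  refine ⟨-u, by simpa using hu, ?_⟩
  ext v
  simp

/-- A timelike line eventually lies in the union of the two cones. -/
theorem exists_nonneg_smul_add (hs : ∀ v w, ℓ v w = ℓ w v) {r : E} (hr : 0 < ℓ r r) (τ : E) :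
    ∃ s : ℝ, 0 < s ∧ 0 < ℓ (s • r + τ) (s • r + τ) := by
  set s : ℝ := 1 + (2 * |ℓ r τ| + |ℓ τ τ|) / ℓ r r with hsdef
  have hq : 0 ≤ (2 * |ℓ r τ| + |ℓ τ τ|) / ℓ r r := by positivity
  refine ⟨s, by linarith, ?_⟩
  have hsr : s * ℓ r r = ℓ r r + (2 * |ℓ r τ| + |ℓ τ τ|) := by
    rw [hsdef, add_mul, one_mul, div_mul_cancel₀ _ hr.ne']
  have e : ℓ (s • r + τ) (s • r + τ) = s * (s * ℓ r r + 2 * ℓ r τ) + ℓ τ τ := by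
    simp only [map_add, map_smul, LinearMap.add_apply, LinearMap.smul_apply, smul_eq_mul,
      hs τ r]
    ring
  rw [e, hsr]
  have h1 := neg_abs_le (ℓ r τ)
  have h2 := neg_abs_le (ℓ τ τ)
  have h3 := abs_nonneg (ℓ τ τ)
  have hs1 : 1 ≤ s := by linarith
  nlinarith

/-- An isotropic eigenvector with `c ≠ 1` would give `g - 1` timelike values: on `ξ + s • w` with `ℓ
ξ w ≠ 0`, the square of `g - 1` has a nonzero term linear in `s` and no constant term. -/
theorem eq_one_of_map_eq_smul (hℓ : IsLorentzian ℓ) {g : E ≃ₗ[ℝ] E} (hg : g ∈ orthogonalGroup ℓ)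
    (hcaus : ∀ v, ℓ (g v - v) (g v - v) ≤ 0) {ξ : E} (hne : ξ ≠ 0) (hnull : ℓ ξ ξ = 0)
    {c : ℝ} (hc : g ξ = c • ξ) : c = 1 := by
  have hc0 : c ≠ 0 := by
    rintro rfl
    rw [zero_smul] at hc
    exact hne (g.map_eq_zero_iff.mp hc)
  obtain ⟨w, hw⟩ : ∃ w, ℓ ξ w ≠ 0 := by
    by_contra! hall
    exact hne (hℓ.eq_zero_of_forall hall)
  have key : ∀ s : ℝ, 2 * s * ((c - 1) * ℓ ξ (g w - w))
      + s ^ 2 * ℓ (g w - w) (g w - w) ≤ 0 := by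
    intro s
    have := hcaus (ξ + s • w)
    have e : g (ξ + s • w) - (ξ + s • w) = (c - 1) • ξ + s • (g w - w) := by
      rw [map_add, map_smul, hc]; module
    rw [e] at this
    simp only [map_add, map_smul, LinearMap.add_apply, LinearMap.smul_apply, smul_eq_mul,
      hℓ.1 (g w - w) ξ, hnull] at this
    linarith
  have hξw : c * ℓ ξ (g w) = ℓ ξ w := by
    have := hg ξ w
    rw [hc, map_smul, LinearMap.smul_apply, smul_eq_mul] at this
    exact this
  have hd : ℓ ξ (g w - w) = ((1 - c) / c) * ℓ ξ w := by
    rw [map_sub, ← hξw]; field_simp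
  by_contra hc1
  have hc1' : c - 1 ≠ 0 := sub_ne_zero.mpr hc1
  set B := (c - 1) * ℓ ξ (g w - w) with hB
  have hBne : B ≠ 0 := by
    rw [hB, hd]
    refine mul_ne_zero hc1' (mul_ne_zero (div_ne_zero ?_ hc0) hw)
    intro h; exact hc1' (by linarith)
  set A := ℓ (g w - w) (g w - w) with hA
  -- A value of `s` with the sign of `B` and small enough for the linear term `2 s B` to dominate
  -- `s² A`.
  have h1 := key (B / (1 + |A|))
  have hpos : 0 < 1 + |A| := by positivity
  have hAA := neg_abs_le A
  have hBB : 0 < B ^ 2 := by positivity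
  have e : 2 * (B / (1 + |A|)) * B + (B / (1 + |A|)) ^ 2 * A
      = B ^ 2 * (2 * (1 + |A|) + A) / (1 + |A|) ^ 2 := by
    field_simp
  rw [e] at h1
  have : 0 < B ^ 2 * (2 * (1 + |A|) + A) / (1 + |A|) ^ 2 := by
    apply div_pos _ (by positivity)
    apply mul_pos hBB
    have := abs_nonneg A
    linarith
  linarith

theorem eq_zero_of_forall_add_mul_nonneg {a b : ℝ} (h : ∀ s : ℝ, 0 ≤ a + s * b) : b = 0 := by
  by_contra hb
  have := h (-(a + 1) / b)
  rw [div_mul_cancel₀ _ hb] at this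
  linarith

end LorentzAlgebra

/-! ### A common fixed causal vector. -/

section FixedVector

variable {E : Type*} [NormedAddCommGroup E] [NormedSpace ℝ E] [FiniteDimensional ℝ E]
  {ℓ : LinearMap.BilinForm ℝ E} {C : Set E}

theorem continuous_bilin (ℓ : LinearMap.BilinForm ℝ E) {X : Type*} [TopologicalSpace X]
    {f g : X → E} (hf : Continuous f) (hg : Continuous g) :
    Continuous fun x => ℓ (f x) (g x) := by
  have h1 : Continuous fun p : E × E => ℓ p.1 p.2 := by
    let L : E →L[ℝ] E →L[ℝ] ℝ :=
      LinearMap.toContinuousLinearMap (LinearMap.toContinuousLinearMap.toLinearMap ∘ₗ ℓ)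
    exact L.continuous₂
  exact h1.comp (hf.prodMk hg)

theorem IsTimeCone.isClosed (hC : IsTimeCone ℓ C) : IsClosed C := by
  obtain ⟨u, -, rfl⟩ := hC
  exact (isClosed_le continuous_const (continuous_bilin ℓ continuous_id continuous_id)).inter
    (isClosed_le continuous_const (continuous_bilin ℓ continuous_const continuous_id))

/-- The closed convex hull of the orbit of `u` is compact, invariant and contained in `C`. A maximum
point of `ℓ x x` on it is unique along its orbit, since the midpoint of two distinct maxima would
have a larger square; hence it is fixed. -/
theorem exists_fixed_of_bounded (hℓ : IsLorentzian ℓ) (hC : IsTimeCone ℓ C)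
    {G : Subgroup (E ≃ₗ[ℝ] E)} (hG : G ≤ orthogonalGroup ℓ) (hGC : ∀ g ∈ G, ∀ v ∈ C, g v ∈ C)
    {u : E} (hu : 0 < ℓ u u) (huC : u ∈ C) {K : ℝ} (hK : ∀ g ∈ G, ‖g u‖ ≤ K) :
    ∃ ξ ∈ C, ξ ≠ 0 ∧ ∀ g ∈ G, g ξ = ξ := by
  set O : Set E := {v | ∃ g ∈ G, v = g u} with hO
  set H : Set E := closedConvexHull ℝ O with hH
  have hOb : Bornology.IsBounded O := by
    rw [isBounded_iff_forall_norm_le]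
    exact ⟨K, by rintro _ ⟨g, hg, rfl⟩; exact hK g hg⟩
  have hcomp : IsCompact H := by
    rw [hH, closedConvexHull_eq_closure_convexHull]
    exact Metric.isCompact_of_isClosed_isBounded isClosed_closure
      (Metric.isBounded_closure_iff.mpr (isBounded_convexHull.mpr hOb))
  have hOH : O ⊆ H := subset_closedConvexHull
  have huO : u ∈ O := ⟨1, G.one_mem, rfl⟩
  have hHC : H ⊆ C := closedConvexHull_min
    (by rintro _ ⟨g, hg, rfl⟩; exact hGC g hg u huC) (hC.convex hℓ) hC.isClosed
  obtain ⟨x, hxH, hmax⟩ := hcomp.exists_isMaxOn ⟨u, hOH huO⟩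
    (continuous_bilin ℓ continuous_id continuous_id).continuousOn
  have hmax' : ∀ y ∈ H, ℓ y y ≤ ℓ x x := fun y hy => hmax hy
  have hxpos : 0 < ℓ x x := hu.trans_le (hmax' u (hOH huO))
  refine ⟨x, hHC hxH, by rintro rfl; simp at hxpos, fun g hg => ?_⟩
  have hgH : g x ∈ H := by
    have hcl : IsClosed (g ⁻¹' H) :=
      isClosed_closedConvexHull.preimage (LinearMap.continuous_of_finiteDimensional g.toLinearMap)
    have hcv : Convex ℝ (g ⁻¹' H) := convex_closedConvexHull.linear_preimage g.toLinearMap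
    refine closedConvexHull_min (?_ : O ⊆ g ⁻¹' H) hcv hcl hxH
    rintro _ ⟨k, hk, rfl⟩
    exact hOH ⟨g * k, G.mul_mem hg hk, rfl⟩
  set y := g x with hy
  have hyy : ℓ y y = ℓ x x := hG hg x x
  -- Maximality at the midpoint gives `ℓ x y ≤ ℓ x x`. But `x - y` is orthogonal to the timelike `x
  -- + y`, which gives the opposite strict inequality unless `x = y`.
  have hmid : (1 / 2 : ℝ) • x + (1 / 2 : ℝ) • y ∈ H :=
    convex_closedConvexHull hxH hgH (by norm_num) (by norm_num) (by norm_num)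
  have hm := hmax' _ hmid
  simp only [map_add, map_smul, LinearMap.add_apply, LinearMap.smul_apply, smul_eq_mul,
    hℓ.1 y x, hyy] at hm
  by_contra hne
  have hd : x - y ≠ 0 := sub_ne_zero.mpr (Ne.symm hne)
  have hp := hC.pairing_nonneg hℓ (hHC hxH) (hHC hgH)
  have := hℓ.neg_of_orthogonal (u := x + y) (v := x - y)
    (by simp only [map_add, LinearMap.add_apply, hℓ.1 y x, hyy]; linarith)
    (by simp only [map_add, map_sub, LinearMap.add_apply, hℓ.1 y x, hyy]; ring) hd
  simp only [map_sub, LinearMap.sub_apply, hℓ.1 y x, hyy] at this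
  linarith

/-- A limit `T` of `g / ‖g‖` has totally isotropic image, hence rank one, spanned by some `ξ`. The
causality condition reads `ℓ v v ≤ ℓ (g v) v`; in the limit it becomes `0 ≤ ℓ (h (T v)) v` for all
`h ∈ G`. This positivity makes the kernel of `T` orthogonal to every `h ξ`. As `T ξ = 0`, the
isotropic vectors `h ξ` and `ξ` are orthogonal, hence proportional, and the factor is `1`. -/
theorem exists_fixed_of_unbounded (hℓ : IsLorentzian ℓ) (hC : IsTimeCone ℓ C)
    {G : Subgroup (E ≃ₗ[ℝ] E)} (hG : G ≤ orthogonalGroup ℓ)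
    (hcaus : ∀ g ∈ G, ∀ v, ℓ (g v - v) (g v - v) ≤ 0)
    {u : E} (hK : ∀ K : ℝ, ∃ g ∈ G, K < ‖g u‖) :
    ∃ ξ ∈ C, ξ ≠ 0 ∧ ∀ g ∈ G, g ξ = ξ := by
  have hge : ∀ g ∈ G, ∀ v, ℓ v v ≤ ℓ (g v) v := by
    intro g hg v
    have h1 := hcaus g hg v
    simp only [map_sub, LinearMap.sub_apply, hG hg v v, hℓ.1 v (g v)] at h1
    linarith
  choose g hgG hgK using fun n : ℕ => hK n
  set A : ℕ → E →L[ℝ] E := fun n => LinearMap.toContinuousLinearMap (g n).toLinearMap with hA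
  have hAapp : ∀ n v, A n v = g n v := fun n v => rfl
  have hAtop : Filter.Tendsto (fun n => ‖A n‖) Filter.atTop Filter.atTop := by
    have h1 : Filter.Tendsto (fun n : ℕ => (n : ℝ) / (1 + ‖u‖)) Filter.atTop Filter.atTop :=
      tendsto_natCast_atTop_atTop.atTop_div_const (by positivity)
    refine Filter.tendsto_atTop_mono (fun n => ?_) h1
    rw [div_le_iff₀ (by positivity)]
    have h2 := (A n).le_opNorm u
    rw [hAapp] at h2
    nlinarith [hgK n, norm_nonneg (A n)]
  have hApos : ∀ n, 0 < ‖A n‖ := by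
    intro n
    rw [norm_pos_iff]
    intro h0
    have := hgK n
    rw [← hAapp, h0, zero_apply, norm_zero] at this
    exact absurd this (not_lt.mpr n.cast_nonneg)
  have hsph : ∀ n, ‖A n‖⁻¹ • A n ∈ Metric.sphere (0 : E →L[ℝ] E) 1 := by
    intro n
    rw [mem_sphere_zero_iff_norm, norm_smul, norm_inv, norm_norm,
      inv_mul_cancel₀ (hApos n).ne']
  have : ProperSpace (E →L[ℝ] E) := FiniteDimensional.proper ℝ _
  obtain ⟨T, hT1, φ, hφ, hlim⟩ := (isCompact_sphere (0 : E →L[ℝ] E) 1).tendsto_subseq hsph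
  have hinv : Filter.Tendsto (fun n => ‖A (φ n)‖⁻¹) Filter.atTop (𝓝 0) :=
    (hAtop.comp hφ.tendsto_atTop).inv_tendsto_atTop
  have hTv : ∀ v, Filter.Tendsto (fun n => ‖A (φ n)‖⁻¹ • g (φ n) v) Filter.atTop (𝓝 (T v)) := by
    intro v
    exact ((ContinuousLinearMap.apply ℝ E v).continuous.tendsto T).comp hlim
  have hiso : ∀ v w, ℓ (T v) (T w) = 0 := by
    intro v w
    have h1 := ((continuous_bilin ℓ continuous_fst continuous_snd).tendsto (T v, T w)).comp
      ((hTv v).prodMk_nhds (hTv w))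
    have h2 : Filter.Tendsto (fun n => ‖A (φ n)‖⁻¹ * (‖A (φ n)‖⁻¹ * ℓ v w)) Filter.atTop
        (𝓝 (0 * (0 * ℓ v w))) := hinv.mul (hinv.mul_const _)
    rw [zero_mul] at h2
    refine tendsto_nhds_unique h1 (h2.congr fun n => ?_)
    simp only [Function.comp, map_smul, LinearMap.smul_apply, smul_eq_mul, hG (hgG _) v w]
  have hpos : ∀ h ∈ G, ∀ v, 0 ≤ ℓ (h (T v)) v := by
    intro h hh v
    have hcont : Continuous fun x : E => ℓ (h x) v :=
      continuous_bilin ℓ (LinearMap.continuous_of_finiteDimensional h.toLinearMap) continuous_const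
    have h1 := (hcont.tendsto (T v)).comp (hTv v)
    have h2 : Filter.Tendsto (fun n => ‖A (φ n)‖⁻¹ * ℓ v v) Filter.atTop (𝓝 (0 * ℓ v v)) :=
      hinv.mul_const _
    rw [zero_mul] at h2
    refine le_of_tendsto_of_tendsto' h2 h1 fun n => ?_
    have h3 := hge (h * g (φ n)) (G.mul_mem hh (hgG _)) v
    simp only [Function.comp, map_smul, LinearMap.smul_apply, smul_eq_mul]
    exact mul_le_mul_of_nonneg_left h3 (inv_nonneg.mpr (norm_nonneg _))
  obtain ⟨v₀, hv₀⟩ : ∃ v₀, T v₀ ≠ 0 := by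
    by_contra! hall
    have : T = 0 := ContinuousLinearMap.ext hall
    rw [this] at hT1
    simp at hT1
  set ξ := T v₀ with hξ
  have hξξ : ℓ ξ ξ = 0 := hiso v₀ v₀
  -- On the line `v₀ + s • v` the value of `T` is constantly `ξ`, so positivity says that an affine
  -- function of `s` is nonnegative everywhere.
  have hker : ∀ h ∈ G, ∀ v, T v = 0 → ℓ (h ξ) v = 0 := by
    intro h hh v hv
    refine eq_zero_of_forall_add_mul_nonneg (a := ℓ (h ξ) v₀) fun s => ?_
    have h1 := hpos h hh (v₀ + s • v)
    have h2 : T (v₀ + s • v) = ξ := by rw [map_add, map_smul, hv, smul_zero, add_zero]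
    rwa [h2, map_add, map_smul, smul_eq_mul] at h1
  have hker1 : ∀ v, T v = 0 → ℓ ξ v = 0 := fun v hv => hker 1 G.one_mem v hv
  have hTpar : ∀ v, ∃ c : ℝ, T v = c • ξ := fun v =>
    hℓ.exists_eq_smul hξξ.ge hv₀ (hiso _ _) (hiso _ _)
  have hξv₀ : ℓ ξ v₀ ≠ 0 := by
    intro h0
    refine hv₀ (hℓ.eq_zero_of_forall fun v => ?_)
    obtain ⟨a, ha⟩ := hTpar v
    have h1 := hker1 (v - a • v₀) (by rw [map_sub, map_smul, ha, ← hξ, sub_self])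
    rw [map_sub, map_smul, h0, smul_zero, sub_zero] at h1
    exact h1
  have hTξ : T ξ = 0 := by
    obtain ⟨c, hc⟩ := hTpar ξ
    have h1 := hker1 (ξ - c • v₀) (by rw [map_sub, map_smul, hc, ← hξ, sub_self])
    rw [map_sub, map_smul, hξξ, zero_sub, neg_eq_zero, smul_eq_mul] at h1
    rw [hc, (mul_eq_zero.mp h1).resolve_right hξv₀, zero_smul]
  have hfix : ∀ h ∈ G, h ξ = ξ := by
    intro h hh
    have h1 : ℓ ξ (h ξ) = 0 := by rw [hℓ.1]; exact hker h hh ξ hTξ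
    obtain ⟨c, hc⟩ := hℓ.exists_eq_smul hξξ.ge hv₀ h1 (by rw [hG hh ξ ξ, hξξ])
    have h2 := eq_one_of_map_eq_smul hℓ (hG hh) (hcaus h hh) hv₀ hξξ hc
    rw [hc, h2, one_smul]
  rcases hC.mem_or_neg_mem hξξ.ge with h | h
  · exact ⟨ξ, h, hv₀, hfix⟩
  · exact ⟨-ξ, h, neg_ne_zero.mpr hv₀, fun g hg => by rw [map_neg, hfix g hg]⟩

/-- A group of Lorentz transformations `g` such that `g - 1` has no timelike values fixes a
nonzero vector of the time cone. -/
theorem exists_fixed_mem_timeCone (hℓ : IsLorentzian ℓ) (hC : IsTimeCone ℓ C)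
    {G : Subgroup (E ≃ₗ[ℝ] E)} (hG : G ≤ orthogonalGroup ℓ) (hGC : ∀ g ∈ G, ∀ v ∈ C, g v ∈ C)
    (hcaus : ∀ g ∈ G, ∀ v, ℓ (g v - v) (g v - v) ≤ 0) :
    ∃ ξ ∈ C, ξ ≠ 0 ∧ ∀ g ∈ G, g ξ = ξ := by
  obtain ⟨u, hu, huC⟩ : ∃ u, 0 < ℓ u u ∧ u ∈ C := by
    obtain ⟨u, hu, rfl⟩ := hC
    exact ⟨u, hu, hu.le, hu.le⟩
  by_cases hK : ∃ K : ℝ, ∀ g ∈ G, ‖g u‖ ≤ K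
  · obtain ⟨K, hK⟩ := hK
    exact exists_fixed_of_bounded hℓ hC hG hGC hu huC hK
  · push Not at hK
    exact exists_fixed_of_unbounded hℓ hC hG hcaus hK

end FixedVector
end FlatLorentz

namespace FlatLorentz

open scoped commutatorElement

/-! ### Small rotations and iterated commutators. -/

section SmallSubgroups

/-- A normed ring has no nontrivial powers staying close to `1`. -/
theorem eq_one_of_norm_pow_sub_one_le {R : Type*} [NormedRing R] [NormedAlgebra ℝ R] {c : R}
    {δ : ℝ} (hδ : δ < 1) (h : ∀ n : ℕ, ‖c ^ n - 1‖ ≤ δ) : c = 1 := by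
  have hstep : ∀ n : ℕ, (2 - δ) * ‖c ^ n - 1‖ ≤ ‖c ^ (n * 2) - 1‖ := by
    intro n
    -- Squaring thus multiplies the distance to `1` by at least `2 - δ > 1`, so powers of `c ≠ 1`
    -- cannot stay close to `1`.
    have e : c ^ (n * 2) - 1 = (2 : ℝ) • (c ^ n - 1) + (c ^ n - 1) * (c ^ n - 1) := by
      rw [pow_mul, two_smul]; noncomm_ring
    have h1 : ‖(2 : ℝ) • (c ^ n - 1)‖ ≤
        ‖c ^ (n * 2) - 1‖ + ‖(c ^ n - 1) * (c ^ n - 1)‖ := by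
      rw [e]
      have := norm_add_le ((2 : ℝ) • (c ^ n - 1) + (c ^ n - 1) * (c ^ n - 1))
        (-((c ^ n - 1) * (c ^ n - 1)))
      rwa [add_neg_cancel_right, norm_neg] at this
    rw [norm_smul, Real.norm_ofNat] at h1
    have h2 := norm_mul_le (c ^ n - 1) (c ^ n - 1)
    have h3 := mul_le_mul_of_nonneg_right (h n) (norm_nonneg (c ^ n - 1))
    linarith
  have hiter : ∀ k : ℕ, (2 - δ) ^ k * ‖c - 1‖ ≤ ‖c ^ (2 ^ k) - 1‖ := by
    intro k
    induction k with
    | zero => simp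
    | succ k ih =>
      calc (2 - δ) ^ (k + 1) * ‖c - 1‖ = (2 - δ) * ((2 - δ) ^ k * ‖c - 1‖) := by ring
        _ ≤ (2 - δ) * ‖c ^ (2 ^ k) - 1‖ := mul_le_mul_of_nonneg_left ih (by linarith)
        _ ≤ _ := by rw [pow_succ]; exact hstep _
  by_contra hne
  have hpos : 0 < ‖c - 1‖ := norm_pos_iff.mpr (sub_ne_zero.mpr hne)
  obtain ⟨k, hk⟩ := pow_unbounded_of_one_lt (δ / ‖c - 1‖) (show 1 < 2 - δ by linarith)
  rw [div_lt_iff₀ hpos] at hk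
  exact absurd (hk.trans_le (hiter k)) (not_lt.mpr (h _))

variable {Γ : Type*} [Group Γ] {R : Type*} [NormedRing R] [NormedAlgebra ℝ R]

/-- If `c = [g, h]` commutes with `g` in the image, then conjugating `h` by `g ^ n` gives `c ^ n *
h`. Conjugation does not push `h` further than `δ` from `1`, so all powers of `c` stay within `2 * δ
< 1` of `1`. -/
theorem map_commutator_eq_one_of_small (rot : Γ →* R) (hrot : ∀ γ, ‖rot γ‖ ≤ 1) {g h : Γ}
    {δ : ℝ} (hδ : δ < 1 / 2) (hh : ‖rot h - 1‖ ≤ δ) (hc : rot ⁅g, ⁅g, h⁆⁆ = 1) :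
    rot ⁅g, h⁆ = 1 := by
  have hinv : ∀ x : Γ, rot x * rot x⁻¹ = 1 := fun x => by rw [← map_mul, mul_inv_cancel, map_one]
  have hcomm : rot g * rot ⁅g, h⁆ = rot ⁅g, h⁆ * rot g := by
    have e : g * ⁅g, h⁆ = ⁅g, ⁅g, h⁆⁆ * (⁅g, h⁆ * g) := by
      simp only [commutatorElement_def]; group
    rw [← map_mul, e, map_mul, hc, one_mul, map_mul]
  have hpow : ∀ n : ℕ, rot (g ^ n * h * (g ^ n)⁻¹) = rot ⁅g, h⁆ ^ n * rot h := by
    intro n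
    induction n with
    | zero => simp
    | succ n ih =>
      have e : g ^ (n + 1) * h * (g ^ (n + 1))⁻¹ = g * (g ^ n * h * (g ^ n)⁻¹) * g⁻¹ := by
        rw [pow_succ']; group
      have e2 : rot ⁅g, h⁆ * rot h = rot g * rot h * rot g⁻¹ := by
        rw [← map_mul, ← map_mul, ← map_mul]; simp [commutatorElement_def]
      have hcp : rot g * rot ⁅g, h⁆ ^ n = rot ⁅g, h⁆ ^ n * rot g :=
        (Commute.pow_right (show Commute (rot g) (rot ⁅g, h⁆) from hcomm) n).eq
      rw [e, map_mul, map_mul, ih, ← mul_assoc, hcp, pow_succ, mul_assoc, mul_assoc, mul_assoc,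
        ← mul_assoc (rot g), ← e2]
  refine eq_one_of_norm_pow_sub_one_le (δ := 2 * δ) (by linarith) fun n => ?_
  have e : rot ⁅g, h⁆ ^ n - 1 =
      (rot (g ^ n) * (rot h - 1) * rot (g ^ n)⁻¹ - (rot h - 1)) * rot h⁻¹ := by
    have h1 : rot (g ^ n) * (rot h - 1) * rot (g ^ n)⁻¹ = rot ⁅g, h⁆ ^ n * rot h - 1 := by
      rw [← hpow, mul_sub, sub_mul, mul_one, hinv, map_mul, map_mul]
    rw [h1, sub_sub_sub_cancel_right, sub_mul, mul_assoc, hinv, mul_one]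
  have h1 : ‖rot (g ^ n) * (rot h - 1) * rot (g ^ n)⁻¹‖ ≤ δ := by
    calc _ ≤ ‖rot (g ^ n)‖ * ‖rot h - 1‖ * ‖rot (g ^ n)⁻¹‖ := norm_mul₃_le
      _ ≤ 1 * δ * 1 := by
        have := (norm_nonneg _).trans hh
        gcongr <;> exact hrot _
      _ = δ := by ring
  rw [e]
  calc _ ≤ ‖rot (g ^ n) * (rot h - 1) * rot (g ^ n)⁻¹ - (rot h - 1)‖ * ‖rot h⁻¹‖ :=
        norm_mul_le _ _
    _ ≤ ‖rot (g ^ n) * (rot h - 1) * rot (g ^ n)⁻¹ - (rot h - 1)‖ * 1 := by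
        gcongr; exact hrot _
    _ ≤ _ := by
        rw [mul_one]
        refine (norm_sub_le _ _).trans ?_
        linarith

/-- The iterated commutator `[g, [g, … [g, h]]]`. -/
def iterComm (g h : Γ) : ℕ → Γ
  | 0 => h
  | k + 1 => ⁅g, iterComm g h k⁆

/-- The difference of a commutator from `1` is the additive commutator of `g - 1` and `x - 1` times
contractions, so its norm is at most `2 * δ ^ 2 ≤ δ`. -/
theorem norm_map_iterComm_sub_one_le {R : Type*} [NormedRing R] (rot : Γ →* R)
    (hrot : ∀ γ, ‖rot γ‖ ≤ 1) {g h : Γ}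
    {δ : ℝ} (hδ : δ ≤ 1 / 2) (hg : ‖rot g - 1‖ ≤ δ) (hh : ‖rot h - 1‖ ≤ δ) (k : ℕ) :
    ‖rot (iterComm g h k) - 1‖ ≤ δ := by
  have hinv : ∀ x : Γ, rot x * rot x⁻¹ = 1 := fun x => by rw [← map_mul, mul_inv_cancel, map_one]
  induction k with
  | zero => exact hh
  | succ k ih =>
    set x := iterComm g h k
    have e : rot (iterComm g h (k + 1)) - 1 =
        ((rot g - 1) * (rot x - 1) - (rot x - 1) * (rot g - 1)) * rot g⁻¹ * rot x⁻¹ := by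
      have e1 : ((rot g - 1) * (rot x - 1) - (rot x - 1) * (rot g - 1)) =
          rot g * rot x - rot x * rot g := by noncomm_ring
      change rot ⁅g, x⁆ - 1 = _
      rw [e1, sub_mul, sub_mul, commutatorElement_def]
      simp only [map_mul]
      rw [mul_assoc (rot x), hinv, mul_one, hinv]
    rw [e]
    have h1 : ‖(rot g - 1) * (rot x - 1) - (rot x - 1) * (rot g - 1)‖ ≤ δ := by
      refine (norm_sub_le _ _).trans ?_
      have a1 := norm_mul_le (rot g - 1) (rot x - 1)
      have a2 := norm_mul_le (rot x - 1) (rot g - 1)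
      nlinarith [norm_nonneg (rot g - 1), norm_nonneg (rot x - 1)]
    calc _ ≤ ‖(rot g - 1) * (rot x - 1) - (rot x - 1) * (rot g - 1)‖ * ‖rot g⁻¹‖ * ‖rot x⁻¹‖ :=
          norm_mul₃_le
      _ ≤ δ * 1 * 1 := by
        have := (norm_nonneg _).trans ih
        gcongr <;> exact hrot _
      _ = δ := by ring

/-- If an iterated commutator of two small elements is trivial, then so is the image of the
first commutator, and of all the others. -/
theorem map_iterComm_succ_eq_one (rot : Γ →* R) (hrot : ∀ γ, ‖rot γ‖ ≤ 1) {g h : Γ}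
    {δ : ℝ} (hδ : δ < 1 / 2) (hg : ‖rot g - 1‖ ≤ δ) (hh : ‖rot h - 1‖ ≤ δ) {n : ℕ}
    (hn : iterComm g h n = 1) (k : ℕ) : rot (iterComm g h (k + 1)) = 1 := by
  have hstep : ∀ k, rot (iterComm g h (k + 2)) = 1 → rot (iterComm g h (k + 1)) = 1 :=
    fun k hk => map_commutator_eq_one_of_small rot hrot hδ
      (norm_map_iterComm_sub_one_le rot hrot hδ.le hg hh k) hk
  have hdown : ∀ m, rot (iterComm g h (m + 1)) = 1 → rot (iterComm g h 1) = 1 := by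
    intro m
    induction m with
    | zero => exact id
    | succ m ih => exact fun h => ih (hstep m h)
  have hup : ∀ m, rot (iterComm g h m) = 1 → rot (iterComm g h (m + 1)) = 1 := by
    intro m hm
    change rot ⁅g, iterComm g h m⁆ = 1
    have hm' : rot (iterComm g h m)⁻¹ = 1 := by
      have := map_mul rot (iterComm g h m) (iterComm g h m)⁻¹
      rwa [mul_inv_cancel, map_one, hm, one_mul, eq_comm] at this
    rw [commutatorElement_def, map_mul, map_mul, map_mul, hm, hm', mul_one, mul_one, ← map_mul,
      mul_inv_cancel, map_one]
  -- One step up before the descent, because `hdown` starts from a positive index while `n` may be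
  -- `0`.
  have h1 : rot (iterComm g h 1) = 1 := hdown n (hup n (by rw [hn, map_one]))
  induction k with
  | zero => exact h1
  | succ k ih => exact hup _ ih

end SmallSubgroups

/-! ### Contraction of commutators in a seminorm. -/

section Contraction

variable {Γ : Type*} [Group Γ] {Z : Type*} [AddCommGroup Z] [Module ℝ Z]

/-- With `y = g⁻¹ h⁻¹ z`, the displacement of `z` by `[g, h]` is `(g - 1)(h - 1) y - (h - 1)(g - 1)
y`, of size at most `θ / 4 * N y`. Inverting the two small elements costs `(8 / 7) ^ 2`, and `1 / 4
* 64 / 49 < 1 / 2`. -/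
theorem commutator_contraction (ρ : Γ →* Module.End ℝ Z) {N : Z → ℝ}
    (hadd : ∀ x y, N (x + y) ≤ N x + N y) (hneg : ∀ x, N (-x) = N x) {g h : Γ} {θ : ℝ}
    (hθ : θ ≤ 1 / 8) (hθ0 : 0 ≤ θ)
    (hg : ∀ z, N (ρ g z - z) ≤ 1 / 8 * N z) (hh : ∀ z, N (ρ h z - z) ≤ θ * N z) (z : Z) :
    N (ρ ⁅g, h⁆ z - z) ≤ θ / 2 * N z := by
  have hnn : ∀ x, 0 ≤ N x := by
    intro x
    have h0 := hadd 0 0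
    rw [add_zero] at h0
    have h1 := hadd x (-x)
    rw [add_neg_cancel, hneg] at h1
    linarith
  have hsub : ∀ x y, N (x - y) ≤ N x + N y := fun x y => by
    rw [sub_eq_add_neg, ← hneg y]; exact hadd _ _
  have hinv : ∀ (x : Γ) (y : Z), ρ x (ρ x⁻¹ y) = y := fun x y => by
    rw [← Module.End.mul_apply, ← map_mul, mul_inv_cancel, map_one, Module.End.one_apply]
  have hbd : ∀ x : Γ, (∀ z, N (ρ x z - z) ≤ 1 / 8 * N z) → ∀ y, N (ρ x⁻¹ y) ≤ 8 / 7 * N y := by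
    intro x hx y
    have h1 := hx (ρ x⁻¹ y)
    rw [hinv] at h1
    have h2 := hsub y (y - ρ x⁻¹ y)
    rw [sub_sub_cancel] at h2
    linarith
  have hh8 : ∀ z, N (ρ h z - z) ≤ 1 / 8 * N z := fun z =>
    (hh z).trans (mul_le_mul_of_nonneg_right hθ (hnn z))
  set y := ρ g⁻¹ (ρ h⁻¹ z) with hy
  have hyz : ρ h (ρ g y) = z := by rw [hy, hinv, hinv]
  have e : ρ ⁅g, h⁆ z - z = (ρ g (ρ h y - y) - (ρ h y - y)) - (ρ h (ρ g y - y) - (ρ g y - y)) := by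
    have e1 : ρ ⁅g, h⁆ z = ρ g (ρ h y) := by
      rw [commutatorElement_def, map_mul, map_mul, map_mul]; rfl
    rw [e1]
    nth_rewrite 1 [← hyz]
    rw [map_sub, map_sub]
    abel
  have hNy : N y ≤ 64 / 49 * N z := by
    have h1 := hbd g hg (ρ h⁻¹ z)
    have h2 := hbd h hh8 z
    linarith
  rw [e]
  have a1 := hg (ρ h y - y)
  have a2 := hh (ρ g y - y)
  have a3 := hg y
  have a4 := hh y
  have a5 := hsub (ρ g (ρ h y - y) - (ρ h y - y)) (ρ h (ρ g y - y) - (ρ g y - y))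
  have a6 := mul_le_mul_of_nonneg_left a3 hθ0
  have a7 := mul_le_mul_of_nonneg_left hNy hθ0
  have a8 := mul_nonneg hθ0 (hnn z)
  linarith

theorem iterComm_contraction (ρ : Γ →* Module.End ℝ Z) {N : Z → ℝ}
    (hadd : ∀ x y, N (x + y) ≤ N x + N y) (hneg : ∀ x, N (-x) = N x) {g h : Γ}
    (hg : ∀ z, N (ρ g z - z) ≤ 1 / 8 * N z) (hh : ∀ z, N (ρ h z - z) ≤ 1 / 8 * N z) (k : ℕ) :
    ∀ z, N (ρ (iterComm g h k) z - z) ≤ 1 / 8 * (1 / 2) ^ k * N z := by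
  induction k with
  | zero => intro z; rw [pow_zero, mul_one]; exact hh z
  | succ k ih =>
    intro z
    have hp : (1 / 2 : ℝ) ^ k ≤ 1 := pow_le_one₀ (by norm_num) (by norm_num)
    have := commutator_contraction ρ hadd hneg (by linarith) (by positivity) hg ih z
    calc _ ≤ _ := this
      _ = _ := by ring

end Contraction
end FlatLorentz

namespace FlatLorentz
open scoped commutatorElement

/-! ### The Euclidean model of `ξ^⊥` and the rotational parts. -/

section Screen

/-- A positive semidefinite form on a finite-dimensional space is the pullback of a Euclidean
scalar product under a surjective map. -/
theorem exists_euclidean_of_posSemidef {F : Type*} [AddCommGroup F] [Module ℝ F]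
    [FiniteDimensional ℝ F] (B : LinearMap.BilinForm ℝ F) (hs : ∀ v w, B v w = B w v)
    (hp : ∀ v, 0 ≤ B v v) :
    ∃ (m : ℕ) (π : F →ₗ[ℝ] EuclideanSpace ℝ (Fin m)), Function.Surjective π ∧
      ∀ v, ‖π v‖ ^ 2 = B v v := by
  let core : PreInnerProductSpace.Core ℝ F :=
    { inner := fun v w => B v w
      conj_inner_symm := fun v w => by simp [hs w v]
      re_inner_nonneg := fun v => by simpa using hp v
      add_left := fun x y z => by simp
      smul_left := fun x y r => by simp }
  let : SeminormedAddCommGroup F := InnerProductSpace.Core.toSeminormedAddCommGroup (c := core)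
  let : InnerProductSpace ℝ F := InnerProductSpace.ofCore core
  have hfin : FiniteDimensional ℝ (SeparationQuotient F) :=
    Module.Finite.of_surjective (SeparationQuotient.mkCLM ℝ F).toLinearMap
      SeparationQuotient.surjective_mk
  let e := (stdOrthonormalBasis ℝ (SeparationQuotient F)).repr
  refine ⟨_, e.toLinearEquiv.toLinearMap ∘ₗ (SeparationQuotient.mkCLM ℝ F).toLinearMap,
    e.surjective.comp SeparationQuotient.surjective_mk, fun v => ?_⟩
  have h1 : ‖e (SeparationQuotient.mk v)‖ = ‖v‖ := by
    rw [e.norm_map, SeparationQuotient.norm_mk]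
  change ‖e (SeparationQuotient.mk v)‖ ^ 2 = _
  rw [h1, ← real_inner_self_eq_norm_sq]
  rfl

variable {E : Type*} [AddCommGroup E] [Module ℝ E] {ℓ : LinearMap.BilinForm ℝ E}

/-- For a causal vector `ξ ≠ 0`, a Euclidean model `π` of the space `ξ^⊥` with the semidefinite
form `-ℓ`, and a section `σ`. -/
structure IsScreen (ℓ : LinearMap.BilinForm ℝ E) (ξ : E) {m : ℕ}
    (π : E →ₗ[ℝ] EuclideanSpace ℝ (Fin m)) (σ : EuclideanSpace ℝ (Fin m) →ₗ[ℝ] E) : Prop where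
  norm_sq : ∀ v, ℓ ξ v = 0 → ‖π v‖ ^ 2 = -ℓ v v
  orth : ∀ w, ℓ ξ (σ w) = 0
  section_ : ∀ w, π (σ w) = w

/-- The form `-ℓ` is semidefinite on the complement of a causal vector. The model map is extended
arbitrarily outside `ξ^⊥`, where `IsScreen` asserts nothing about it. -/
theorem exists_isScreen [FiniteDimensional ℝ E]
    (hℓ : IsLorentzian ℓ) {ξ : E} (hξ : 0 ≤ ℓ ξ ξ) (hne : ξ ≠ 0) :
    ∃ (m : ℕ) (π : E →ₗ[ℝ] EuclideanSpace ℝ (Fin m)) (σ : EuclideanSpace ℝ (Fin m) →ₗ[ℝ] E),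
      IsScreen ℓ ξ π σ := by
  obtain ⟨m, π₀, hsurj, hπ₀⟩ := exists_euclidean_of_posSemidef
    (-(ℓ.restrict (LinearMap.ker (ℓ ξ)))) (fun v w => by simp [hℓ.1 v.1 w.1])
    (fun v => by simpa using hℓ.nonpos_of_orthogonal hξ hne v.2)
  obtain ⟨π, hπ⟩ := LinearMap.exists_extend π₀
  obtain ⟨σ₀, hσ₀⟩ := π₀.exists_rightInverse_of_surjective (LinearMap.range_eq_top.mpr hsurj)
  have hπ' : ∀ v : LinearMap.ker (ℓ ξ), π v = π₀ v := fun v => LinearMap.congr_fun hπ v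
  refine ⟨m, π, (LinearMap.ker (ℓ ξ)).subtype ∘ₗ σ₀, fun v hv => ?_, fun w => (σ₀ w).2,
    fun w => ?_⟩
  · rw [hπ' ⟨v, hv⟩, hπ₀]; rfl
  · exact (hπ' (σ₀ w)).trans (LinearMap.congr_fun hσ₀ w)

variable {ξ : E} {m : ℕ} {π : E →ₗ[ℝ] EuclideanSpace ℝ (Fin m)}
  {σ : EuclideanSpace ℝ (Fin m) →ₗ[ℝ] E}

theorem IsScreen.apply_eq_zero_iff (hS : IsScreen ℓ ξ π σ) {v : E} (hv : ℓ ξ v = 0) :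
    π v = 0 ↔ ℓ v v = 0 := by
  rw [← norm_eq_zero, ← sq_eq_zero_iff, hS.norm_sq v hv, neg_eq_zero]

theorem orthogonalGroup_apply_orth {g : E ≃ₗ[ℝ] E} (hg : g ∈ orthogonalGroup ℓ) (hgξ : g ξ = ξ)
    (v : E) : ℓ ξ (g v) = ℓ ξ v := by
  have := hg ξ v
  rwa [hgξ] at this

/-- The kernel of `π` in `ξ^⊥` consists of isotropic vectors, hence of multiples of the fixed vector
`ξ`. -/
theorem IsScreen.map_eq (hS : IsScreen ℓ ξ π σ) (hℓ : IsLorentzian ℓ) (hξ : 0 ≤ ℓ ξ ξ)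
    (hne : ξ ≠ 0) {g : E ≃ₗ[ℝ] E} (hgξ : g ξ = ξ) {v : E} (hv : ℓ ξ v = 0) (hπ : π v = 0) :
    g v = v := by
  obtain ⟨c, rfl⟩ := hℓ.exists_eq_smul hξ hne hv ((hS.apply_eq_zero_iff hv).mp hπ)
  rw [map_smul, hgξ]

theorem IsScreen.sub_orth (hS : IsScreen ℓ ξ π σ) {v : E} (hv : ℓ ξ v = 0) :
    ℓ ξ (v - σ (π v)) = 0 := by rw [map_sub, hv, hS.orth, sub_zero]

theorem IsScreen.sub_apply (hS : IsScreen ℓ ξ π σ) (v : E) :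
    π (v - σ (π v)) = 0 := by rw [map_sub, hS.section_, sub_self]

theorem IsScreen.apply_map (hS : IsScreen ℓ ξ π σ) (hℓ : IsLorentzian ℓ) (hξ : 0 ≤ ℓ ξ ξ)
    (hne : ξ ≠ 0) {g : E ≃ₗ[ℝ] E} (hgξ : g ξ = ξ) {v : E} (hv : ℓ ξ v = 0) :
    π (g (σ (π v))) = π (g v) := by
  have h1 := hS.map_eq hℓ hξ hne hgξ (hS.sub_orth hv) (hS.sub_apply v)
  have h2 : g v = g (σ (π v)) + (v - σ (π v)) := by
    rw [← h1, map_sub]; abel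
  rw [h2, map_add, hS.sub_apply, add_zero]

theorem IsScreen.norm_apply_map (hS : IsScreen ℓ ξ π σ) {g : E ≃ₗ[ℝ] E}
    (hg : g ∈ orthogonalGroup ℓ) (hgξ : g ξ = ξ) {v : E} (hv : ℓ ξ v = 0) :
    ‖π (g v)‖ = ‖π v‖ := by
  have h1 : ‖π (g v)‖ ^ 2 = ‖π v‖ ^ 2 := by
    rw [hS.norm_sq _ hv, hS.norm_sq _ (by rw [orthogonalGroup_apply_orth hg hgξ, hv]), hg v v]
  exact (sq_eq_sq₀ (norm_nonneg _) (norm_nonneg _)).mp h1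

/-- The rotational parts of a group of Lorentz transformations fixing the causal vector `ξ`. -/
theorem IsScreen.exists_rotation (hS : IsScreen ℓ ξ π σ) (hℓ : IsLorentzian ℓ) (hξ : 0 ≤ ℓ ξ ξ)
    (hne : ξ ≠ 0) {Γ : Type*} [Group Γ] (lin : Γ →* (E ≃ₗ[ℝ] E))
    (hO : ∀ γ, lin γ ∈ orthogonalGroup ℓ) (hfix : ∀ γ, lin γ ξ = ξ) :
    ∃ rot : Γ →* (EuclideanSpace ℝ (Fin m) →L[ℝ] EuclideanSpace ℝ (Fin m)),
      (∀ γ, ‖rot γ‖ ≤ 1) ∧ ∀ γ v, ℓ ξ v = 0 → rot γ (π v) = π (lin γ v) := by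
  let r : Γ → EuclideanSpace ℝ (Fin m) →L[ℝ] EuclideanSpace ℝ (Fin m) := fun γ =>
    LinearMap.toContinuousLinearMap (π ∘ₗ (lin γ).toLinearMap ∘ₗ σ)
  have hr : ∀ γ v, ℓ ξ v = 0 → r γ (π v) = π (lin γ v) := fun γ v hv =>
    hS.apply_map hℓ hξ hne (hfix γ) hv
  refine ⟨{ toFun := r, map_one' := ?_, map_mul' := ?_ }, fun γ => ?_, hr⟩
  · ext1 w
    change π (lin 1 (σ w)) = w
    rw [map_one]
    exact hS.section_ w
  · intro γ δ
    ext1 w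
    have h1 : r δ w = π (lin δ (σ w)) := rfl
    change _ = r γ (r δ w)
    rw [h1, hr γ _ (by rw [orthogonalGroup_apply_orth (hO δ) (hfix δ), hS.orth])]
    change π (lin (γ * δ) (σ w)) = _
    rw [map_mul]; rfl
  · refine ContinuousLinearMap.opNorm_le_bound _ zero_le_one fun w => ?_
    rw [one_mul]
    change ‖π (lin γ (σ w))‖ ≤ _
    rw [hS.norm_apply_map (hO γ) (hfix γ) (hS.orth w), hS.section_]

end Screen
end FlatLorentz

namespace FlatLorentz
open scoped commutatorElement

theorem iterComm_mem {G : Type*} [Group G] {Γ : Subgroup G} {g h : G} (hg : g ∈ Γ) (hh : h ∈ Γ)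
    (k : ℕ) : iterComm g h k ∈ Γ := by
  induction k with
  | zero => exact hh
  | succ k ih =>
    rw [iterComm, commutatorElement_def]
    exact Γ.mul_mem (Γ.mul_mem (Γ.mul_mem hg ih) (Γ.inv_mem hg)) (Γ.inv_mem ih)

/-! ### Affine maps as linear maps of `V × ℝ`. -/

section Affine

variable {V : Type*} [AddCommGroup V] [Module ℝ V]

/-- The linear representation in `V × ℝ` of the affine group of `V`. -/
def affineHat : (V ≃ᵃ[ℝ] V) →* Module.End ℝ (V × ℝ) where
  toFun γ :=
    { toFun := fun z => (γ.linear z.1 + z.2 • γ 0, z.2)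
      map_add' := fun x y => by
        ext
        · simp only [Prod.fst_add, Prod.snd_add, map_add]; module
        · rfl
      map_smul' := fun c x => by
        ext
        · simp only [Prod.smul_fst, Prod.smul_snd, map_smul, RingHom.id_apply, smul_eq_mul]; module
        · rfl }
  map_one' := by
    ext z <;> simp [AffineEquiv.one_def]
  map_mul' γ δ := by
    have h : γ (δ 0) = γ.linear (δ 0) + γ 0 := by
      have := γ.map_vadd 0 (δ 0)
      simpa using this
    refine LinearMap.ext fun z => Prod.ext ?_ rfl
    change (γ * δ).linear z.1 + z.2 • γ (δ 0) = γ.linear (δ.linear z.1 + z.2 • δ 0) + z.2 • γ 0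
    rw [h, map_add, map_smul, smul_add, add_assoc]
    rfl

theorem affineHat_apply (γ : V ≃ᵃ[ℝ] V) (z : V × ℝ) :
    affineHat γ z = (γ.linear z.1 + z.2 • γ 0, z.2) := rfl

theorem affine_apply (γ : V ≃ᵃ[ℝ] V) (v w : V) : γ (v + w) = γ v + γ.linear w := by
  have := γ.map_vadd v w
  rw [vadd_eq_add, vadd_eq_add] at this
  rw [add_comm v w, this, add_comm]

theorem affineHat_apply_one (γ : V ≃ᵃ[ℝ] V) (v : V) : affineHat γ (v, 1) = (γ v, 1) := by
  have := affine_apply γ 0 v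
  rw [zero_add] at this
  rw [affineHat_apply, this, one_smul, add_comm]

theorem affineHat_apply_zero (γ : V ≃ᵃ[ℝ] V) (v : V) :
    affineHat γ (v, 0) = (γ.linear v, 0) := by
  rw [affineHat_apply, zero_smul, add_zero]

theorem affineHat_apply_sub (γ : V ≃ᵃ[ℝ] V) (z : V × ℝ) :
    affineHat γ z - z = (γ.linear z.1 - z.1 + z.2 • γ 0, 0) := by
  rw [affineHat_apply]
  ext
  · simp only [Prod.fst_sub]; abel
  · simp

end Affine

/-! ### The weighted flag norm and the vanishing of iterated commutators. -/

section WeightedNorm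

variable {V : Type*} [NormedAddCommGroup V] [NormedSpace ℝ V]
  {ℓ : LinearMap.BilinForm ℝ V} {ξ : V} {m : ℕ} {π : V →ₗ[ℝ] EuclideanSpace ℝ (Fin m)}
  {σ : EuclideanSpace ℝ (Fin m) →ₗ[ℝ] V}

/-- The norm on `V × ℝ` adapted to the flag `0 ⊂ ker π ⊂ ξ^⊥ ⊂ V ⊂ V × ℝ`, with weights `M ^ i`;
`f` is a vector with `ℓ ξ f = 1`. -/
noncomputable def flagNorm (ℓ : LinearMap.BilinForm ℝ V) (ξ f : V)
    (π : V →ₗ[ℝ] EuclideanSpace ℝ (Fin m)) (M : ℝ) (z : V × ℝ) : ℝ :=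
  ‖z.1 - ℓ ξ z.1 • f‖ + M * ‖π (z.1 - ℓ ξ z.1 • f)‖ + M ^ 2 * |ℓ ξ z.1| + M ^ 3 * |z.2|

theorem flagNorm_add_le (f : V) {M : ℝ} (hM : 0 ≤ M) (x y : V × ℝ) :
    flagNorm ℓ ξ f π M (x + y) ≤ flagNorm ℓ ξ f π M x + flagNorm ℓ ξ f π M y := by
  have e : (x + y).1 - ℓ ξ (x + y).1 • f = (x.1 - ℓ ξ x.1 • f) + (y.1 - ℓ ξ y.1 • f) := by
    simp only [Prod.fst_add, map_add]; module
  simp only [flagNorm]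
  rw [e, map_add, Prod.fst_add, map_add, Prod.snd_add]
  have h1 := norm_add_le (x.1 - ℓ ξ x.1 • f) (y.1 - ℓ ξ y.1 • f)
  have h2 := mul_le_mul_of_nonneg_left
    (norm_add_le (π (x.1 - ℓ ξ x.1 • f)) (π (y.1 - ℓ ξ y.1 • f))) hM
  have h3 := mul_le_mul_of_nonneg_left (abs_add_le (ℓ ξ x.1) (ℓ ξ y.1)) (pow_nonneg hM 2)
  have h4 := mul_le_mul_of_nonneg_left (abs_add_le x.2 y.2) (pow_nonneg hM 3)
  linarith

theorem flagNorm_neg (f : V) (M : ℝ) (x : V × ℝ) :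
    flagNorm ℓ ξ f π M (-x) = flagNorm ℓ ξ f π M x := by
  have e : (-x).1 - ℓ ξ (-x).1 • f = -(x.1 - ℓ ξ x.1 • f) := by
    simp only [Prod.fst_neg, map_neg]; module
  simp only [flagNorm]
  rw [e, map_neg, norm_neg, norm_neg, Prod.fst_neg, map_neg, abs_neg, Prod.snd_neg, abs_neg]

theorem norm_le_flagNorm (f : V) {M : ℝ} (hM : 1 ≤ M) (z : V × ℝ) :
    ‖z.1‖ ≤ (1 + ‖f‖) * flagNorm ℓ ξ f π M z := by
  have h1 : ‖z.1‖ ≤ ‖z.1 - ℓ ξ z.1 • f‖ + |ℓ ξ z.1| * ‖f‖ := by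
    have := norm_add_le (z.1 - ℓ ξ z.1 • f) (ℓ ξ z.1 • f)
    rwa [sub_add_cancel, norm_smul, Real.norm_eq_abs] at this
  have h2 : 1 ≤ M ^ 2 := one_le_pow₀ hM
  have h3 : |ℓ ξ z.1| ≤ M ^ 2 * |ℓ ξ z.1| := le_mul_of_one_le_left (abs_nonneg _) h2
  have h4 : 0 ≤ M * ‖π (z.1 - ℓ ξ z.1 • f)‖ := by positivity
  have h5 : 0 ≤ M ^ 3 * |z.2| := by positivity
  have h6 := norm_nonneg (z.1 - ℓ ξ z.1 • f)
  have h7 := norm_nonneg f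
  have h8 := abs_nonneg (ℓ ξ z.1)
  simp only [flagNorm]
  nlinarith [mul_nonneg h6 h7, mul_nonneg h4 h7, mul_nonneg h5 h7,
    mul_le_mul_of_nonneg_right h3 h7]

/-- Here `p`, `s`, `t` are the sizes of the components with weights `M`, `M ^ 2`, `M ^ 3`. Every
term but `1 / 16 * p` moves a component to a lower weight and so gains a factor `1 / M`; the bound
`hM₀` absorbs all of these. -/
theorem weighted_sum_le {M L a a' b b' b'' p s t : ℝ} (hL : 0 ≤ L) (ha : 0 ≤ a) (ha' : 0 ≤ a')
    (hb : 0 ≤ b) (hb' : 0 ≤ b') (hb'' : 0 ≤ b'') (hp : 0 ≤ p) (hs : 0 ≤ s) (ht : 0 ≤ t)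
    (hM : 1 ≤ M) (hM₀ : 16 * L + 16 * (a + a') + 24 * (b + b' + b'') ≤ M) :
    L * p + s * a + t * b + M * (1 / 16 * p + s * a' + t * b') + M ^ 2 * (t * b'') ≤
      1 / 8 * (M * p + M ^ 2 * s + M ^ 3 * t) := by
  have hM0 : 0 ≤ M := by linarith
  have hMM : M ≤ M ^ 2 := by
    have := mul_le_mul_of_nonneg_left hM hM0
    linarith [sq M]
  have c1 : L * p ≤ M / 16 * p := mul_le_mul_of_nonneg_right (by linarith) hp
  have c2 : s * (a + M * a') ≤ s * (1 / 8 * M ^ 2) := by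
    refine mul_le_mul_of_nonneg_left ?_ hs
    have h1 : a ≤ M * a := le_mul_of_one_le_left ha hM
    have h2 : M * (16 * (a + a')) ≤ M * M := mul_le_mul_of_nonneg_left (by linarith) hM0
    linarith [sq M, sq_nonneg M]
  have c3 : t * (b + M * b' + M ^ 2 * b'') ≤ t * (1 / 8 * M ^ 3) := by
    refine mul_le_mul_of_nonneg_left ?_ ht
    have h1 : b ≤ M ^ 2 * b := le_mul_of_one_le_left hb (by linarith)
    have h2 : M * b' ≤ M ^ 2 * b' := mul_le_mul_of_nonneg_right hMM hb'
    have h3 : M ^ 2 * (24 * (b + b' + b'')) ≤ M ^ 2 * M :=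
      mul_le_mul_of_nonneg_left (by linarith) (by positivity)
    have h4 : 0 ≤ M ^ 2 * M := by positivity
    have h5 : M ^ 3 = M ^ 2 * M := by ring
    rw [h5]
    linarith
  linarith

/-- The map `γ - 1` on `V × ℝ` strictly lowers the flag, except for its rotational block, which is
small by hypothesis. On `ξ^⊥` it factors through `π`, so the bottom step contributes nothing; a
large weight `M` makes the remaining blocks negligible. -/
theorem exists_flagNorm_contraction [FiniteDimensional ℝ V]
    (hS : IsScreen ℓ ξ π σ) (hℓ : IsLorentzian ℓ)
    (hξ : 0 ≤ ℓ ξ ξ) (hne : ξ ≠ 0) {f : V} (hf : ℓ ξ f = 1) (γ : V ≃ᵃ[ℝ] V)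
    (hO : γ.linear ∈ orthogonalGroup ℓ) (hfix : γ.linear ξ = ξ)
    (hsmall : ∀ v, ℓ ξ v = 0 → ‖π (γ.linear v - v)‖ ≤ 1 / 16 * ‖π v‖) :
    ∃ M₀ : ℝ, ∀ M, M₀ ≤ M → 1 ≤ M → ∀ z,
      flagNorm ℓ ξ f π M (affineHat γ z - z) ≤ 1 / 8 * flagNorm ℓ ξ f π M z := by
  have hξg : ∀ v, ℓ ξ (γ.linear v - v) = 0 := fun v => by
    rw [map_sub, orthogonalGroup_apply_orth hO hfix, sub_self]
  let L : EuclideanSpace ℝ (Fin m) →L[ℝ] V :=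
    LinearMap.toContinuousLinearMap ((γ.linear.toLinearMap - LinearMap.id) ∘ₗ σ)
  have hL : ∀ w, L w = γ.linear (σ w) - σ w := fun w => rfl
  have hK₁ : ∀ w, ℓ ξ w = 0 → ‖γ.linear w - w‖ ≤ ‖L‖ * ‖π w‖ := by
    intro w hw
    have h1 := hS.map_eq hℓ hξ hne hfix (hS.sub_orth hw) (hS.sub_apply w)
    rw [map_sub] at h1
    have h2 : γ.linear w - w = L (π w) := by
      rw [hL, sub_eq_sub_iff_sub_eq_sub]; exact h1
    rw [h2]
    exact L.le_opNorm _
  set a := γ.linear f - f with ha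
  set b := γ 0 - ℓ ξ (γ 0) • f with hb
  set K₂ := ‖a‖ + ‖π a‖ with hK₂
  set K₃ := ‖b‖ + ‖π b‖ + |ℓ ξ (γ 0)| with hK₃
  refine ⟨16 * ‖L‖ + 16 * K₂ + 24 * K₃, fun M hM₀ hM z => ?_⟩
  have hL0 := norm_nonneg L
  have ha0 := norm_nonneg a
  have ha1 := norm_nonneg (π a)
  have hb0 := norm_nonneg b
  have hb1 := norm_nonneg (π b)
  have hb2 := abs_nonneg (ℓ ξ (γ 0))
  obtain ⟨v, t⟩ := z
  set s := ℓ ξ v with hs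
  set w := v - s • f with hw
  have hw0 : ℓ ξ w = 0 := by
    rw [hw, map_sub, map_smul, hf, smul_eq_mul, mul_one, ← hs, sub_self]
  have hv : γ.linear v - v = (γ.linear w - w) + s • a := by
    rw [hw, ha, map_sub, map_smul]; module
  rw [affineHat_apply_sub]
  have e1 : ℓ ξ (γ.linear v - v + t • γ 0) = t * ℓ ξ (γ 0) := by
    rw [map_add, hξg, zero_add, map_smul, smul_eq_mul]
  have e2 : γ.linear v - v + t • γ 0 - (t * ℓ ξ (γ 0)) • f = (γ.linear w - w) + s • a + t • b := by
    rw [hv, hb]; module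
  simp only [flagNorm]
  rw [e1, e2, abs_zero, mul_zero, add_zero, ← hs, ← hw, abs_mul]
  have n1 : ‖(γ.linear w - w) + s • a + t • b‖ ≤ ‖L‖ * ‖π w‖ + |s| * ‖a‖ + |t| * ‖b‖ := by
    refine (norm_add₃_le).trans ?_
    rw [norm_smul, norm_smul, Real.norm_eq_abs, Real.norm_eq_abs]
    linarith [hK₁ w hw0]
  have n2 : ‖π ((γ.linear w - w) + s • a + t • b)‖ ≤
      1 / 16 * ‖π w‖ + |s| * ‖π a‖ + |t| * ‖π b‖ := by
    rw [map_add, map_add, map_smul, map_smul]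
    refine (norm_add₃_le).trans ?_
    rw [norm_smul, norm_smul, Real.norm_eq_abs, Real.norm_eq_abs]
    linarith [hsmall w hw0]
  have n2' := mul_le_mul_of_nonneg_left n2 (show 0 ≤ M by linarith)
  have key := weighted_sum_le hL0 ha0 ha1 hb0 hb1 hb2 (norm_nonneg (π w)) (abs_nonneg s)
    (abs_nonneg t) hM hM₀
  have hnn := norm_nonneg w
  linarith

/-- Two affine Lorentz transformations with small rotational parts have a trivial iterated
commutator, if they belong to a group with no small displacements at some point. -/
theorem exists_iterComm_eq_one [FiniteDimensional ℝ V] (hS : IsScreen ℓ ξ π σ) (hℓ : IsLorentzian ℓ)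
    (hξ : 0 ≤ ℓ ξ ξ) (hne : ξ ≠ 0) {Γ : Subgroup (V ≃ᵃ[ℝ] V)}
    {v : V} {ε : ℝ} (hε : 0 < ε) (hdisc : ∀ γ ∈ Γ, ‖γ v - v‖ < ε → γ = 1)
    {g h : V ≃ᵃ[ℝ] V} (hgΓ : g ∈ Γ) (hhΓ : h ∈ Γ)
    (hgO : g.linear ∈ orthogonalGroup ℓ) (hgfix : g.linear ξ = ξ)
    (hg : ∀ v, ℓ ξ v = 0 → ‖π (g.linear v - v)‖ ≤ 1 / 16 * ‖π v‖)
    (hhO : h.linear ∈ orthogonalGroup ℓ) (hhfix : h.linear ξ = ξ)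
    (hh : ∀ v, ℓ ξ v = 0 → ‖π (h.linear v - v)‖ ≤ 1 / 16 * ‖π v‖) :
    ∃ n, iterComm g h n = 1 := by
  obtain ⟨f, hf⟩ : ∃ f, ℓ ξ f = 1 := by
    obtain ⟨w, hw⟩ : ∃ w, ℓ ξ w ≠ 0 := by
      by_contra! hall
      exact hne (hℓ.eq_zero_of_forall hall)
    exact ⟨(ℓ ξ w)⁻¹ • w, by rw [map_smul, smul_eq_mul, inv_mul_cancel₀ hw]⟩
  obtain ⟨M₁, hM₁⟩ := exists_flagNorm_contraction hS hℓ hξ hne hf g hgO hgfix hg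
  obtain ⟨M₂, hM₂⟩ := exists_flagNorm_contraction hS hℓ hξ hne hf h hhO hhfix hh
  obtain ⟨M, hM, hM1, hM2⟩ : ∃ M : ℝ, 1 ≤ M ∧ M₁ ≤ M ∧ M₂ ≤ M :=
    ⟨max 1 (max M₁ M₂), le_max_left _ _, (le_max_left _ _).trans (le_max_right _ _),
      (le_max_right _ _).trans (le_max_right _ _)⟩
  have hmem := fun k => iterComm_mem hgΓ hhΓ k
  have hadd : ∀ x y, flagNorm ℓ ξ f π M (x + y) ≤
      flagNorm ℓ ξ f π M x + flagNorm ℓ ξ f π M y := flagNorm_add_le f (by linarith)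
  have hneg : ∀ x, flagNorm ℓ ξ f π M (-x) = flagNorm ℓ ξ f π M x := flagNorm_neg f M
  have hgM := hM₁ M hM1 hM
  have hhM := hM₂ M hM2 hM
  -- The iterated commutators approach the identity geometrically. Evaluated at `(v, 1)`, this makes
  -- their displacements of `v` tend to `0`, and discreteness ends the sequence at `1`.
  have hc := iterComm_contraction (Z := V × ℝ) (g := g) (h := h) affineHat
    (N := flagNorm ℓ ξ f π M) hadd hneg hgM hhM
  have hlim : Filter.Tendsto
      (fun k : ℕ => (1 + ‖f‖) * (1 / 8 * (1 / 2) ^ k * flagNorm ℓ ξ f π M (v, 1)))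
      Filter.atTop (𝓝 ((1 + ‖f‖) * (1 / 8 * 0 * flagNorm ℓ ξ f π M (v, 1)))) :=
    (((tendsto_pow_atTop_nhds_zero_of_lt_one (by norm_num) (by norm_num)).const_mul _).mul_const
      _).const_mul _
  rw [mul_zero, zero_mul, mul_zero] at hlim
  obtain ⟨k, hk⟩ := (hlim.eventually_lt_const hε).exists
  refine ⟨k, hdisc _ (hmem k) (lt_of_le_of_lt ?_ hk)⟩
  have h1 := norm_le_flagNorm (ℓ := ℓ) (ξ := ξ) (π := π) f hM
    (affineHat (iterComm g h k) (v, 1) - (v, 1))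
  have h2 := mul_le_mul_of_nonneg_left (hc k (v, 1)) (show 0 ≤ 1 + ‖f‖ by positivity)
  have h3 : ((affineHat (iterComm g h k) (v, 1) - (v, 1) : V × ℝ)).1 = iterComm g h k v - v := by
    rw [affineHat_apply_one, Prod.fst_sub]
  rw [h3] at h1
  exact h1.trans h2

end WeightedNorm
end FlatLorentz

namespace FlatLorentz
open scoped commutatorElement

/-! ### Fitting decomposition inside an invariant subspace. -/

section Fitting

/-- The kernels of `T` and `T²` coincide, so the range and the kernel of the restriction to `X` meet
trivially and, by dimensions, span `X`. -/
theorem exists_fitting {Z : Type*} [AddCommGroup Z] [Module ℝ Z] [FiniteDimensional ℝ Z]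
    (T : Module.End ℝ Z) (hT : ∀ z, T (T z) = 0 → T z = 0) {X : Submodule ℝ Z}
    (hX : ∀ z ∈ X, T z ∈ X) {x : Z} (hx : x ∈ X) :
    ∃ x₀ ∈ X, ∃ y ∈ X, T x₀ = 0 ∧ x = x₀ + T y := by
  let f : X →ₗ[ℝ] X := T.restrict hX
  have hf : ∀ z : X, ((f z : X) : Z) = T z := fun z => rfl
  have hdisj : Disjoint (LinearMap.range f) (LinearMap.ker f) := by
    rw [Submodule.disjoint_def]
    rintro _ ⟨z, rfl⟩ hz
    apply Subtype.ext
    rw [hf]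
    exact hT z (by simpa [hf] using congrArg Subtype.val (LinearMap.mem_ker.mp hz))
  have htop : LinearMap.range f ⊔ LinearMap.ker f = ⊤ :=
    Submodule.eq_top_of_disjoint _ _ (LinearMap.finrank_range_add_finrank_ker f).ge hdisj
  have hmem : (⟨x, hx⟩ : X) ∈ LinearMap.range f ⊔ LinearMap.ker f := htop ▸ Submodule.mem_top
  obtain ⟨a, ⟨y, rfl⟩, b, hb, hab⟩ := Submodule.mem_sup.mp hmem
  refine ⟨b, b.2, y, y.2, congrArg Subtype.val (LinearMap.mem_ker.mp hb), ?_⟩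
  have := congrArg Subtype.val hab
  rw [add_comm]
  exact this.symm

theorem symm_mem_of_forall_mem {Z : Type*} [AddCommGroup Z] [Module ℝ Z] [FiniteDimensional ℝ Z]
    {T T' : Module.End ℝ Z} (hT'T : ∀ z, T' (T z) = z)
    {X : Submodule ℝ Z} (hX : ∀ z ∈ X, T z ∈ X) : ∀ z ∈ X, T' z ∈ X := by
  have hinj : Function.Injective T := Function.LeftInverse.injective hT'T
  have hle : X.map T ≤ X := by
    rintro _ ⟨z, hz, rfl⟩; exact hX z hz
  have heq : X.map T = X := Submodule.eq_of_le_of_finrank_eq hle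
    (LinearEquiv.finrank_eq (Submodule.equivMapOfInjective T hinj X)).symm
  intro z hz
  rw [← heq] at hz
  obtain ⟨y, hy, rfl⟩ := hz
  rw [hT'T]
  exact hy

end Fitting

/-! ### Generalized fixed spaces of affine maps fixing `ξ`. -/

section Unipotent

variable {V : Type*} [AddCommGroup V] [Module ℝ V] {ℓ : LinearMap.BilinForm ℝ V} {ξ : V}

/-- The affine transformation `γ` is Lorentzian and its linear part fixes `ξ`. -/
def IsFixing (ℓ : LinearMap.BilinForm ℝ V) (ξ : V) (γ : V ≃ᵃ[ℝ] V) : Prop :=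
  γ.linear ∈ orthogonalGroup ℓ ∧ γ.linear ξ = ξ

theorem IsFixing.apply_orth {γ : V ≃ᵃ[ℝ] V} (h : IsFixing ℓ ξ γ) (v : V) :
    ℓ ξ (γ.linear v) = ℓ ξ v := orthogonalGroup_apply_orth h.1 h.2 v

theorem IsFixing.sub_orth {γ : V ≃ᵃ[ℝ] V} (h : IsFixing ℓ ξ γ) (v : V) :
    ℓ ξ (γ.linear v - v) = 0 := by rw [map_sub, h.apply_orth, sub_self]

theorem IsFixing.one : IsFixing ℓ ξ (1 : V ≃ᵃ[ℝ] V) := ⟨fun _ _ => rfl, rfl⟩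

theorem IsFixing.mul {γ δ : V ≃ᵃ[ℝ] V} (hγ : IsFixing ℓ ξ γ) (hδ : IsFixing ℓ ξ δ) :
    IsFixing ℓ ξ (γ * δ) :=
  ⟨fun x y => (hγ.1 (δ.linear x) (δ.linear y)).trans (hδ.1 x y),
    (congrArg γ.linear hδ.2).trans hγ.2⟩

theorem linear_inv_apply (γ : V ≃ᵃ[ℝ] V) (v : V) : (γ⁻¹).linear (γ.linear v) = v :=
  γ.linear.symm_apply_apply v

theorem linear_apply_inv (γ : V ≃ᵃ[ℝ] V) (v : V) : γ.linear ((γ⁻¹).linear v) = v :=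
  γ.linear.apply_symm_apply v

theorem linear_mul_apply (γ δ : V ≃ᵃ[ℝ] V) (v : V) :
    (γ * δ).linear v = γ.linear (δ.linear v) := rfl

theorem IsFixing.inv {γ : V ≃ᵃ[ℝ] V} (hγ : IsFixing ℓ ξ γ) : IsFixing ℓ ξ γ⁻¹ := by
  refine ⟨(orthogonalGroup ℓ).inv_mem hγ.1, ?_⟩
  nth_rewrite 1 [← hγ.2]
  exact linear_inv_apply γ ξ

/-- Lets timelike and null `ξ` be treated together: either `ξ` is isotropic or `a = 0`. -/
theorem IsFixing.smul_null {γ : V ≃ᵃ[ℝ] V} (h : IsFixing ℓ ξ γ) {w : V} {a : ℝ}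
    (hw : γ.linear w = w + a • ξ) : a * ℓ ξ ξ = 0 := by
  have := h.sub_orth w
  rwa [hw, add_sub_cancel_left, map_smul, smul_eq_mul] at this

/-- The powers of `γ - 1` on the space `V × {0}`. -/
theorem affineHat_sub_one_apply (γ : V ≃ᵃ[ℝ] V) (z : V × ℝ) :
    (affineHat γ - 1) z = (γ.linear z.1 - z.1 + z.2 • γ 0, 0) := affineHat_apply_sub γ z

theorem affineHat_sub_one_apply_zero (γ : V ≃ᵃ[ℝ] V) (w : V) :
    (affineHat γ - 1) (w, 0) = (γ.linear w - w, 0) := by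
  rw [affineHat_sub_one_apply]; simp

/-- A unipotent isometry of a semidefinite space is trivial modulo the isotropic vectors. By
induction `x = γ w - w` is fixed modulo `ξ`, so invariance of `ℓ w x` gives `ℓ x x = 0`, and `x` is
a multiple of `ξ`. -/
theorem IsFixing.exists_eq_add_smul_of_pow (hℓ : IsLorentzian ℓ) (hξ : 0 ≤ ℓ ξ ξ) (hne : ξ ≠ 0)
    {γ : V ≃ᵃ[ℝ] V} (h : IsFixing ℓ ξ γ) (n : ℕ) {w : V} (hw : ℓ ξ w = 0)
    (hn : ((affineHat γ - 1) ^ n) (w, 0) = 0) : ∃ a : ℝ, γ.linear w = w + a • ξ := by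
  induction n generalizing w with
  | zero =>
    rw [pow_zero, Module.End.one_apply] at hn
    have : w = 0 := congrArg Prod.fst hn
    exact ⟨0, by rw [this, map_zero, zero_smul, add_zero]⟩
  | succ n ih =>
    rw [pow_succ, Module.End.mul_apply, affineHat_sub_one_apply_zero] at hn
    obtain ⟨c, hc⟩ := ih (h.sub_orth w) hn
    have hx : ℓ (γ.linear w - w) (γ.linear w - w) = 0 := by
      set x := γ.linear w - w with hxdef
      have e1 : ℓ x x = ℓ (γ.linear w) x - ℓ w x := by
        rw [← LinearMap.sub_apply, ← map_sub]
      have e2 : ℓ (γ.linear w) x + c * ℓ (γ.linear w) ξ = ℓ w x := by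
        rw [← h.1 w x, hc, map_add, map_smul, smul_eq_mul]
      have e3 : ℓ (γ.linear w) ξ = 0 := by rw [hℓ.1, h.apply_orth, hw]
      rw [e1, ← e2, e3]; ring
    obtain ⟨a, ha⟩ := hℓ.exists_eq_smul hξ hne (h.sub_orth w) hx
    exact ⟨a, by rw [← ha]; abel⟩

/-- The four applications of `γ - 1` descend from `V × ℝ` to `V`, to `ξ^⊥`, to the line of `ξ`, and
to `0`. -/
theorem IsFixing.pow_four_eq_zero {γ : V ≃ᵃ[ℝ] V} (h : IsFixing ℓ ξ γ)
    {K : Submodule ℝ (V × ℝ)} (hK : ∀ z ∈ K, affineHat γ z ∈ K)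
    (htriv : ∀ w, (w, (0 : ℝ)) ∈ K → ℓ ξ w = 0 → ∃ a : ℝ, γ.linear w = w + a • ξ)
    {z : V × ℝ} (hz : z ∈ K) : ((affineHat γ - 1) ^ (4 : ℕ)) z = 0 := by
  have hT : ∀ z ∈ K, (affineHat γ - 1) z ∈ K := fun z hz => K.sub_mem (hK z hz) hz
  obtain ⟨x₁, hx₁⟩ : ∃ x, (affineHat γ - 1) z = (x, 0) := ⟨_, affineHat_sub_one_apply γ z⟩
  have h1 : (x₁, (0 : ℝ)) ∈ K := hx₁ ▸ hT z hz
  have h2 := hT _ h1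
  rw [affineHat_sub_one_apply_zero] at h2
  obtain ⟨a, ha⟩ := htriv _ h2 (h.sub_orth x₁)
  have e : (affineHat γ - 1) ^ (4 : ℕ) = (affineHat γ - 1) * ((affineHat γ - 1) *
      ((affineHat γ - 1) * (affineHat γ - 1))) := by noncomm_ring
  rw [e]
  simp only [Module.End.mul_apply]
  rw [hx₁, affineHat_sub_one_apply_zero, affineHat_sub_one_apply_zero,
    affineHat_sub_one_apply_zero, ha]
  simp [h.2]

/-- The generalized eigenspace of `γ`, acting in `V × ℝ`, with the eigenvalue `1`. -/
noncomputable def genFixed (γ : V ≃ᵃ[ℝ] V) : Submodule ℝ (V × ℝ) :=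
  LinearMap.ker ((affineHat γ - 1) ^ (4 : ℕ))

theorem mem_genFixed {γ : V ≃ᵃ[ℝ] V} {z : V × ℝ} :
    z ∈ genFixed γ ↔ ((affineHat γ - 1) ^ (4 : ℕ)) z = 0 := LinearMap.mem_ker

theorem affineHat_mem_ker_pow {γ : V ≃ᵃ[ℝ] V} {n : ℕ} {z : V × ℝ}
    (hz : ((affineHat γ - 1) ^ n) z = 0) : ((affineHat γ - 1) ^ n) (affineHat γ z) = 0 := by
  have hc : Commute ((affineHat γ - 1) ^ n) (affineHat γ) :=
    Commute.pow_left ((Commute.refl _).sub_left (Commute.one_left _)) n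
  have := congrArg (fun T : Module.End ℝ (V × ℝ) => T z) hc.eq
  simp only [Module.End.mul_apply] at this
  rw [this, hz, map_zero]

/-- Thus the exponent in `genFixed` is large enough for it to be the whole generalized eigenspace.
-/
theorem IsFixing.pow_four_eq_zero_of_pow (hℓ : IsLorentzian ℓ) (hξ : 0 ≤ ℓ ξ ξ) (hne : ξ ≠ 0)
    {γ : V ≃ᵃ[ℝ] V} (h : IsFixing ℓ ξ γ) {n : ℕ} {z : V × ℝ}
    (hz : ((affineHat γ - 1) ^ n) z = 0) : ((affineHat γ - 1) ^ (4 : ℕ)) z = 0 :=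
  h.pow_four_eq_zero (K := LinearMap.ker ((affineHat γ - 1) ^ n))
    (fun _ hz => affineHat_mem_ker_pow hz)
    (fun _ hw hw' => h.exists_eq_add_smul_of_pow hℓ hξ hne n hw' hw) hz

theorem affineHat_mul_inv_apply (γ : V ≃ᵃ[ℝ] V) (z : V × ℝ) :
    affineHat γ (affineHat γ⁻¹ z) = z := by
  rw [← Module.End.mul_apply, ← map_mul, mul_inv_cancel, map_one, Module.End.one_apply]

theorem affineHat_inv_mul_apply (γ : V ≃ᵃ[ℝ] V) (z : V × ℝ) :
    affineHat γ⁻¹ (affineHat γ z) = z := by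
  rw [← Module.End.mul_apply, ← map_mul, inv_mul_cancel, map_one, Module.End.one_apply]

theorem conj_mem_genFixed {g x : V ≃ᵃ[ℝ] V} {z : V × ℝ} (hz : z ∈ genFixed g) :
    affineHat x z ∈ genFixed (x * g * x⁻¹) := by
  have e : ∀ n : ℕ, (affineHat (x * g * x⁻¹) - 1) ^ n * affineHat x =
      affineHat x * (affineHat g - 1) ^ n := by
    intro n
    have hx : affineHat x⁻¹ * affineHat x = 1 := by rw [← map_mul, inv_mul_cancel, map_one]
    have h1 : (affineHat (x * g * x⁻¹) - 1) * affineHat x = affineHat x * (affineHat g - 1) := by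
      rw [map_mul, map_mul, sub_mul, mul_assoc, hx, mul_one, one_mul, mul_sub, mul_one]
    induction n with
    | zero => simp
    | succ n ih => rw [pow_succ, mul_assoc, h1, ← mul_assoc, ih, mul_assoc, pow_succ]
  have := congrArg (fun T : Module.End ℝ (V × ℝ) => T z) (e 4)
  simp only [Module.End.mul_apply] at this
  rw [mem_genFixed] at hz ⊢
  rw [this, hz, map_zero]

/-- If an iterated commutator `[g, [g, … [g, h]]]` is trivial and the intermediate commutators
act trivially in `ξ^⊥` modulo `ξ`, then `h` preserves the generalized eigenspace of `g`. -/
theorem affineHat_mem_genFixed [FiniteDimensional ℝ V] (hℓ : IsLorentzian ℓ) (hξ : 0 ≤ ℓ ξ ξ)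
    (hne : ξ ≠ 0) {g h : V ≃ᵃ[ℝ] V} (hg : IsFixing ℓ ξ g) (hh : IsFixing ℓ ξ h) {n : ℕ}
    (hn : iterComm g h n = 1)
    (hrot : ∀ k w, ℓ ξ w = 0 → ∃ a : ℝ, (iterComm g h (k + 1)).linear w = w + a • ξ) :
    ∀ z ∈ genFixed g, affineHat h z ∈ genFixed g := by
  have hfix : ∀ k, IsFixing ℓ ξ (iterComm g h k) := by
    intro k
    induction k with
    | zero => exact hh
    | succ k ih =>
      rw [iterComm, commutatorElement_def]
      exact ((hg.mul ih).mul hg.inv).mul ih.inv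
  have hstep : ∀ k, (∀ z ∈ genFixed g, affineHat (iterComm g h (k + 1)) z ∈ genFixed g) →
      ∀ z ∈ genFixed g, affineHat (iterComm g h k) z ∈ genFixed g := by
    intro k hk
    set x := iterComm g h k with hx
    set c := iterComm g h (k + 1) with hc
    -- Since `c` preserves `genFixed g` and is trivial on `ξ^⊥` modulo `ξ`, the product `c⁻¹ * g` is
    -- still unipotent on `genFixed g`. So `genFixed g` lies in the generalized eigenspace of the
    -- conjugate; dimensions make them equal, and `x` maps the first onto the second.
    have hconj : x * g * x⁻¹ = c⁻¹ * g := by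
      rw [hc, iterComm, ← hx, commutatorElement_def]; group
    have hcinv := symm_mem_of_forall_mem (affineHat_inv_mul_apply c) hk
    have hle : genFixed g ≤ genFixed (x * g * x⁻¹) := by
      intro z hz
      rw [hconj]
      refine ((hfix (k + 1)).inv.mul hg).pow_four_eq_zero (K := genFixed g) (fun z hz => ?_)
        (fun w hw hw0 => ?_) hz
      · rw [map_mul, Module.End.mul_apply]
        exact hcinv _ (affineHat_mem_ker_pow hz)
      · obtain ⟨a, ha⟩ := hg.exists_eq_add_smul_of_pow hℓ hξ hne 4 hw0 hw
        obtain ⟨b, hb⟩ := hrot k w hw0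
        have hb' : (c⁻¹).linear w = w - b • ξ := by
          have h1 := linear_inv_apply c w
          rw [hb, map_add, map_smul, (hfix (k + 1)).inv.2] at h1
          exact eq_sub_of_add_eq h1
        refine ⟨a - b, ?_⟩
        rw [linear_mul_apply, ha, map_add, map_smul, (hfix (k + 1)).inv.2, hb']
        module
    have heq : genFixed g = genFixed (x * g * x⁻¹) := by
      refine Submodule.eq_of_le_of_finrank_le hle ?_
      have hinj : Function.Injective (affineHat x⁻¹) :=
        Function.LeftInverse.injective (affineHat_mul_inv_apply x)
      rw [LinearEquiv.finrank_eq (Submodule.equivMapOfInjective _ hinj (genFixed (x * g * x⁻¹)))]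
      refine Submodule.finrank_mono ?_
      rintro _ ⟨z, hz, rfl⟩
      have := conj_mem_genFixed (x := x⁻¹) hz
      rwa [show x⁻¹ * (x * g * x⁻¹) * x⁻¹⁻¹ = g by group] at this
    intro z hz
    rw [heq]
    exact conj_mem_genFixed hz
  have hdown : ∀ m, (∀ z ∈ genFixed g, affineHat (iterComm g h m) z ∈ genFixed g) →
      ∀ z ∈ genFixed g, affineHat (iterComm g h 0) z ∈ genFixed g := by
    intro m
    induction m with
    | zero => exact id
    | succ m ih => exact fun H => ih (hstep m H)
  refine hdown n ?_
  rw [hn, map_one]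
  exact fun z hz => hz

end Unipotent

/-! ### Nondegenerate invariant flats. -/

section Splitting

variable {V : Type*} [AddCommGroup V] [Module ℝ V] {ℓ : LinearMap.BilinForm ℝ V} {ξ : V}

/-- A linear subspace of `V × ℝ` which defines an affine subspace of `V` whose direction contains
`ξ` and is nondegenerate. -/
structure IsNondegenerateFlat (ℓ : LinearMap.BilinForm ℝ V) (ξ : V) (X : Submodule ℝ (V × ℝ)) :
    Prop where
  exists_point : ∃ o, (o, (1 : ℝ)) ∈ X
  mem : (ξ, (0 : ℝ)) ∈ X
  nondegenerate : ∀ v, (v, (0 : ℝ)) ∈ X → (∀ w, (w, (0 : ℝ)) ∈ X → ℓ v w = 0) → v = 0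

theorem affineHat_sub_one_pow_four_zero (g : V ≃ᵃ[ℝ] V) (w : V) :
    ((affineHat g - 1) ^ (4 : ℕ)) (w, 0) =
      ((((g.linear : V →ₗ[ℝ] V) - 1 : Module.End ℝ V) ^ (4 : ℕ)) w, 0) := by
  have h : ∀ n : ℕ, ((affineHat g - 1) ^ n) (w, 0) =
      ((((g.linear : V →ₗ[ℝ] V) - 1 : Module.End ℝ V) ^ n) w, 0) := by
    intro n
    induction n with
    | zero => simp
    | succ n ih =>
      rw [pow_succ', Module.End.mul_apply, ih, affineHat_sub_one_apply_zero, pow_succ',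
        Module.End.mul_apply]
      rfl
  exact h 4

/-- For an isometry, the adjoint of `g - 1` is `g⁻¹ - 1 = -g⁻¹ (g - 1)`, so a power of `g - 1` can
be moved to the other argument, up to an invertible factor commuting with it. -/
theorem IsFixing.pairing_pow_eq_zero {g : V ≃ᵃ[ℝ] V}
    (hg : IsFixing ℓ ξ g) (n : ℕ) {v : V}
    (hv : (((g.linear : V →ₗ[ℝ] V) - 1 : Module.End ℝ V) ^ n) v = 0) (y : V) :
    ℓ v ((((g.linear : V →ₗ[ℝ] V) - 1 : Module.End ℝ V) ^ n) y) = 0 := by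
  set T : Module.End ℝ V := (g.linear : V →ₗ[ℝ] V) - 1 with hT
  have hTapp : ∀ v, T v = g.linear v - v := fun v => rfl
  have key : ∀ n v, (T ^ n) v = 0 → ∀ y, ℓ v ((T ^ n) y) = 0 := by
    intro n
    induction n with
    | zero =>
      intro v hv y
      rw [pow_zero, Module.End.one_apply] at hv
      rw [hv, map_zero, LinearMap.zero_apply]
    | succ n ih =>
      intro v hv y
      obtain ⟨v', rfl⟩ : ∃ v', v = g.linear v' := ⟨(g⁻¹).linear v, (linear_apply_inv g v).symm⟩
      have hcomm : (T ^ (n + 1)) (g.linear v') = g.linear ((T ^ (n + 1)) v') := by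
        have hc : Commute (T ^ (n + 1)) (g.linear : V →ₗ[ℝ] V) :=
          Commute.pow_left ((Commute.refl _).sub_left (Commute.one_left _)) _
        exact congrArg (fun S : Module.End ℝ V => S v') hc.eq
      rw [hcomm] at hv
      have hv' : (T ^ n) (T v') = 0 := by
        rw [← Module.End.mul_apply, ← pow_succ]
        exact g.linear.map_eq_zero_iff.mp hv
      have h1 := ih (T v') hv' y
      rw [pow_succ', Module.End.mul_apply, hTapp, map_sub, hg.1]
      rw [hTapp, map_sub, LinearMap.sub_apply] at h1
      linarith
  exact key n v hv y

/-- Split `X` into the kernel and the image of `(g - 1) ^ 4`. The image has last coordinate `0`, so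
a point of the flat survives in the kernel; the directions in the image are orthogonal to the
kernel, so the form stays nondegenerate there. -/
theorem IsNondegenerateFlat.inf_genFixed [FiniteDimensional ℝ V] (hℓ : IsLorentzian ℓ)
    (hξ : 0 ≤ ℓ ξ ξ) (hne : ξ ≠ 0) {X : Submodule ℝ (V × ℝ)} (hX : IsNondegenerateFlat ℓ ξ X)
    {g : V ≃ᵃ[ℝ] V} (hg : IsFixing ℓ ξ g) (hgX : ∀ z ∈ X, affineHat g z ∈ X) :
    IsNondegenerateFlat ℓ ξ (X ⊓ genFixed g) := by
  have hT : ∀ z, ((affineHat g - 1) ^ (4 : ℕ)) (((affineHat g - 1) ^ (4 : ℕ)) z) = 0 →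
      ((affineHat g - 1) ^ (4 : ℕ)) z = 0 := by
    intro z hz
    rw [← Module.End.mul_apply, ← pow_add] at hz
    exact hg.pow_four_eq_zero_of_pow hℓ hξ hne hz
  have hinv : ∀ {Y : Submodule ℝ (V × ℝ)}, (∀ z ∈ Y, affineHat g z ∈ Y) →
      ∀ n : ℕ, ∀ z ∈ Y, ((affineHat g - 1) ^ n) z ∈ Y := by
    intro Y hY n
    induction n with
    | zero => intro z hz; simpa using hz
    | succ n ih =>
      intro z hz
      rw [pow_succ, Module.End.mul_apply]
      exact ih _ (Y.sub_mem (hY z hz) hz)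
  refine ⟨?_, ⟨hX.mem, ?_⟩, ?_⟩
  · obtain ⟨o, ho⟩ := hX.exists_point
    obtain ⟨x₀, hx₀, y, hy, h0, he⟩ := exists_fitting _ hT (hinv hgX 4) ho
    have hsnd : (((affineHat g - 1) ^ (4 : ℕ)) y).2 = 0 := by
      rw [pow_succ', Module.End.mul_apply, affineHat_sub_one_apply]
    have hx2 : x₀.2 = 1 := by
      have := congrArg Prod.snd he
      rw [Prod.snd_add, hsnd, add_zero] at this
      exact this.symm
    refine ⟨x₀.1, ?_⟩
    have : (x₀.1, (1 : ℝ)) = x₀ := Prod.ext rfl hx2.symm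
    rw [this]
    exact ⟨hx₀, h0⟩
  · rw [SetLike.mem_coe, mem_genFixed, pow_succ, Module.End.mul_apply,
      affineHat_sub_one_apply_zero, hg.2, sub_self]
    exact map_zero _
  · intro v hv hvw
    refine hX.nondegenerate v hv.1 fun w hw => ?_
    let Y : Submodule ℝ (V × ℝ) := X ⊓ LinearMap.ker (LinearMap.snd ℝ V ℝ)
    have hY : ∀ z ∈ Y, affineHat g z ∈ Y := fun z hz => ⟨hgX z hz.1, hz.2⟩
    obtain ⟨x₀, hx₀, y, hy, h0, he⟩ := exists_fitting _ hT (hinv hY 4) (x := (w, 0)) ⟨hw, rfl⟩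
    obtain ⟨a, t⟩ := x₀
    obtain ⟨b, s⟩ := y
    have ht : t = 0 := hx₀.2
    have hs : s = 0 := hy.2
    subst ht; subst hs
    have hwe : w = a + ((((g.linear : V →ₗ[ℝ] V) - 1 : Module.End ℝ V) ^ (4 : ℕ)) b) := by
      rw [affineHat_sub_one_pow_four_zero] at he
      exact congrArg Prod.fst he
    have hv4 : ((((g.linear : V →ₗ[ℝ] V) - 1 : Module.End ℝ V) ^ (4 : ℕ)) v) = 0 := by
      have := mem_genFixed.mp hv.2
      rw [affineHat_sub_one_pow_four_zero] at this
      exact congrArg Prod.fst this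
    rw [hwe, map_add, hvw a ⟨hx₀.1, h0⟩, zero_add]
    exact hg.pairing_pow_eq_zero 4 hv4 b

/-- For a family of transformations that preserve the generalized eigenspaces of one another there
is an invariant nondegenerate affine subspace in which they act unipotently. -/
theorem exists_unipotent_flat [FiniteDimensional ℝ V] (hℓ : IsLorentzian ℓ)
    (hξ : 0 ≤ ℓ ξ ξ) (hne : ξ ≠ 0) {S : Set (V ≃ᵃ[ℝ] V)} (hS : ∀ γ ∈ S, IsFixing ℓ ξ γ)
    (hSS : ∀ g ∈ S, ∀ h ∈ S, ∀ z ∈ genFixed g, affineHat h z ∈ genFixed g) :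
    ∃ X : Submodule ℝ (V × ℝ), IsNondegenerateFlat ℓ ξ X ∧
      ∀ γ ∈ Subgroup.closure S, (∀ z ∈ X, affineHat γ z ∈ X) ∧
        ∀ w, (w, (0 : ℝ)) ∈ X → ℓ ξ w = 0 → ∃ a : ℝ, γ.linear w = w + a • ξ := by
  let P : ℕ → Prop := fun d => ∃ X : Submodule ℝ (V × ℝ), Module.finrank ℝ X = d ∧
    IsNondegenerateFlat ℓ ξ X ∧ ∀ γ ∈ S, ∀ z ∈ X, affineHat γ z ∈ X
  have hP : ∃ d, P d := ⟨_, ⊤, rfl, ⟨⟨0, trivial⟩, trivial, fun v _ h =>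
    hℓ.eq_zero_of_forall fun w => h w trivial⟩, fun _ _ _ _ => trivial⟩
  classical
  obtain ⟨X, hXd, hX, hXS⟩ := Nat.find_spec hP
  -- Cutting with `genFixed g` gives another `S`-invariant nondegenerate flat, so minimality of the
  -- dimension excludes a proper intersection.
  have hmin : ∀ g ∈ S, X ≤ genFixed g := by
    intro g hg
    have h1 : IsNondegenerateFlat ℓ ξ (X ⊓ genFixed g) :=
      hX.inf_genFixed hℓ hξ hne (hS g hg) (hXS g hg)
    have h2 : Nat.find hP ≤ Module.finrank ℝ (X ⊓ genFixed g : Submodule ℝ (V × ℝ)) :=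
      Nat.find_min' hP ⟨_, rfl, h1, fun γ hγ z hz => ⟨hXS γ hγ z hz.1, hSS g hg γ hγ z hz.2⟩⟩
    rw [← hXd] at h2
    exact inf_eq_left.mp (Submodule.eq_of_le_of_finrank_le inf_le_left h2)
  refine ⟨X, hX, fun γ hγ => ?_⟩
  have hfix : ∀ γ ∈ Subgroup.closure S, IsFixing ℓ ξ γ := fun γ hγ =>
    Subgroup.closure_induction (p := fun γ _ => IsFixing ℓ ξ γ) hS IsFixing.one
      (fun _ _ _ _ => IsFixing.mul) (fun _ _ => IsFixing.inv) hγ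
  induction hγ using Subgroup.closure_induction with
  | mem g hg =>
    exact ⟨hXS g hg, fun w hw hw0 =>
      (hS g hg).exists_eq_add_smul_of_pow hℓ hξ hne 4 hw0 (hmin g hg hw)⟩
  | one => exact ⟨by rw [map_one]; exact fun z hz => hz,
      fun w _ _ => ⟨0, by rw [zero_smul, add_zero]; rfl⟩⟩
  | mul g h hg hh ihg ihh =>
    refine ⟨fun z hz => ?_, fun w hw hw0 => ?_⟩
    · rw [map_mul]; exact ihg.1 _ (ihh.1 z hz)
    · obtain ⟨a, ha⟩ := ihg.2 w hw hw0
      obtain ⟨b, hb⟩ := ihh.2 w hw hw0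
      exact ⟨a + b, by rw [linear_mul_apply, hb, map_add, map_smul, ha, (hfix g hg).2]; module⟩
  | inv g hg ih =>
    refine ⟨symm_mem_of_forall_mem (affineHat_inv_mul_apply g) ih.1,
      fun w hw hw0 => ?_⟩
    obtain ⟨a, ha⟩ := ih.2 w hw hw0
    refine ⟨-a, ?_⟩
    have h1 := linear_inv_apply g w
    rw [ha, map_add, map_smul, (hfix g hg).inv.2] at h1
    rw [eq_sub_of_add_eq h1]; module

end Splitting
end FlatLorentz

namespace FlatLorentz
open scoped commutatorElement

/-! ### Commutativity of unipotent groups with spacelike displacements. -/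

section UnipotentCommute

variable {V : Type*} [AddCommGroup V] [Module ℝ V] {ℓ : LinearMap.BilinForm ℝ V} {ξ : V}

/-- All displacements of the transformations `γ ≠ 1` in `Γ` are spacelike. -/
def HasSpacelikeDisplacements (ℓ : LinearMap.BilinForm ℝ V) (Γ : Subgroup (V ≃ᵃ[ℝ] V)) : Prop :=
  ∀ γ ∈ Γ, γ ≠ 1 → ∀ v, ℓ (γ v - v) (γ v - v) < 0

/-- `Γ` preserves the affine subspace `o + V₀`, the causal vector `ξ`, and acts trivially in
`V₀ ∩ ξ^⊥` modulo `ξ`. -/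
structure IsUnipotentOn (ℓ : LinearMap.BilinForm ℝ V) (ξ : V) (Γ : Subgroup (V ≃ᵃ[ℝ] V)) (o : V)
    (V₀ : Submodule ℝ V) : Prop where
  fixing : ∀ γ ∈ Γ, IsFixing ℓ ξ γ
  base : ∀ γ ∈ Γ, γ o - o ∈ V₀
  linear_mem : ∀ γ ∈ Γ, ∀ w ∈ V₀, γ.linear w ∈ V₀
  trivial_mod : ∀ γ ∈ Γ, ∀ w ∈ V₀, ℓ ξ w = 0 → ∃ a : ℝ, γ.linear w = w + a • ξ

/-- The vector `d = γ v - v` lies in `V₀ ∩ ξ^⊥`, so it is fixed, hence isotropic and a multiple `c •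
ξ`. Preservation of `ℓ v v` then gives `c * ℓ ξ v = 0`. -/
theorem IsFixing.eq_self_of_trivial (hℓ : IsLorentzian ℓ) (hξ : 0 ≤ ℓ ξ ξ) (hne : ξ ≠ 0)
    {γ : V ≃ᵃ[ℝ] V} (h : IsFixing ℓ ξ γ) {V₀ : Submodule ℝ V}
    (hV₀ : ∀ w ∈ V₀, γ.linear w ∈ V₀)
    (htriv : ∀ w ∈ V₀, ℓ ξ w = 0 → γ.linear w = w) {v : V} (hv : v ∈ V₀) : γ.linear v = v := by
  set d := γ.linear v - v with hd
  have hd0 : d ∈ V₀ := V₀.sub_mem (hV₀ v hv) hv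
  have hdξ : ℓ ξ d = 0 := h.sub_orth v
  have hdd : ℓ d d = 0 := by
    have h1 : ℓ (γ.linear v) d = ℓ v d := by
      have := h.1 v d
      rwa [htriv d hd0 hdξ] at this
    have h2 : ℓ d d = ℓ (γ.linear v) d - ℓ v d := by rw [← LinearMap.sub_apply, ← map_sub]
    rw [h2, h1, sub_self]
  obtain ⟨c, hc⟩ := hℓ.exists_eq_smul hξ hne hdξ hdd
  by_cases hvξ : ℓ ξ v = 0
  · exact htriv v hv hvξ
  have h3 : γ.linear v = v + c • ξ := by rw [← hc, hd]; abel
  have hcξ := h.smul_null h3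
  have h4 := h.1 v v
  rw [h3] at h4
  simp only [map_add, map_smul, LinearMap.add_apply, LinearMap.smul_apply, smul_eq_mul,
    hℓ.1 v ξ, hcξ] at h4
  have hc0 : c * ℓ ξ v = 0 := by linarith
  rw [h3, (mul_eq_zero.mp hc0).resolve_right hvξ, zero_smul, add_zero]

variable {Γ : Subgroup (V ≃ᵃ[ℝ] V)} {o : V} {V₀ : Submodule ℝ V}

theorem affine_apply_sub (γ : V ≃ᵃ[ℝ] V) (o w : V) :
    γ (o + w) - (o + w) = (γ o - o) + (γ.linear w - w) := by
  rw [affine_apply]; abel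

/-- Moving the base point along `w ∈ V₀ ∩ ξ^⊥` changes the displacement by a multiple of `a • ξ`.
Its square is then affine in the parameter with slope proportional to `a * ℓ ξ (γ o - o)`; being
always negative, it has slope zero, so `a = 0`. -/
theorem IsUnipotentOn.linear_eq_of_ne (hU : IsUnipotentOn ℓ ξ Γ o V₀) (hℓ : IsLorentzian ℓ)
    (hξ : 0 ≤ ℓ ξ ξ) (hne : ξ ≠ 0) (hsp : HasSpacelikeDisplacements ℓ Γ) {γ : V ≃ᵃ[ℝ] V}
    (hγ : γ ∈ Γ) (hχ : ℓ ξ (γ o - o) ≠ 0) {v : V} (hv : v ∈ V₀) : γ.linear v = v := by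
  refine (hU.fixing γ hγ).eq_self_of_trivial hℓ hξ hne (hU.linear_mem γ hγ)
    (fun w hw hw0 => ?_) hv
  obtain ⟨a, ha⟩ := hU.trivial_mod γ hγ w hw hw0
  have hγ1 : γ ≠ 1 := by
    rintro rfl
    simp at hχ
  have haξ := (hU.fixing γ hγ).smul_null ha
  have ha0 : a * ℓ ξ (γ o - o) = 0 := by
    refine eq_zero_of_forall_add_mul_nonneg (a := -ℓ (γ o - o) (γ o - o)) fun s => ?_
    have h1 := hsp γ hγ hγ1 (o + (-s / 2) • w)
    have h2 : γ.linear ((-s / 2) • w) - (-s / 2) • w = (-s / 2 * a) • ξ := by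
      rw [map_smul, ha]; module
    rw [affine_apply_sub, h2] at h1
    simp only [map_add, map_smul, LinearMap.add_apply, LinearMap.smul_apply, smul_eq_mul,
      hℓ.1 (γ o - o) ξ] at h1
    have h3 : -s / 2 * a * (-s / 2 * a * ℓ ξ ξ) = 0 := by
      rw [mul_assoc (-s / 2) a (ℓ ξ ξ), haξ]; ring
    linarith
  rw [ha, (mul_eq_zero.mp ha0).resolve_right hχ, zero_smul, add_zero]

theorem IsUnipotentOn.pairing_mul (hU : IsUnipotentOn ℓ ξ Γ o V₀) {γ δ : V ≃ᵃ[ℝ] V}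
    (hγ : γ ∈ Γ) : ℓ ξ ((γ * δ) o - o) = ℓ ξ (γ o - o) + ℓ ξ (δ o - o) := by
  have e : (γ * δ) o - o = (γ o - o) + γ.linear (δ o - o) := by
    have h1 := affine_apply γ o (δ o - o)
    rw [add_sub_cancel] at h1
    rw [show (γ * δ) o = γ (δ o) from rfl, h1]; abel
  rw [e, map_add, (hU.fixing γ hγ).apply_orth]

/-- If some displacement is not orthogonal to `ξ`, then `Γ` acts by translations. -/
theorem IsUnipotentOn.linear_eq (hU : IsUnipotentOn ℓ ξ Γ o V₀) (hℓ : IsLorentzian ℓ)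
    (hξ : 0 ≤ ℓ ξ ξ) (hne : ξ ≠ 0) (hsp : HasSpacelikeDisplacements ℓ Γ) {γ₀ : V ≃ᵃ[ℝ] V}
    (hγ₀ : γ₀ ∈ Γ) (hχ : ℓ ξ (γ₀ o - o) ≠ 0) {γ : V ≃ᵃ[ℝ] V} (hγ : γ ∈ Γ) {v : V}
    (hv : v ∈ V₀) : γ.linear v = v := by
  by_cases h0 : ℓ ξ (γ o - o) = 0
  -- Pairing the displacement with `ξ` is additive, so `γ₀ * γ` falls under the nonzero case
  -- together with `γ₀`, and `γ₀` cancels.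
  · have h1 : ℓ ξ ((γ₀ * γ) o - o) ≠ 0 := by rwa [hU.pairing_mul hγ₀, h0, add_zero]
    have h2 := hU.linear_eq_of_ne hℓ hξ hne hsp (Γ.mul_mem hγ₀ hγ) h1 hv
    have h3 := hU.linear_eq_of_ne hℓ hξ hne hsp hγ₀ hχ hv
    rw [linear_mul_apply] at h2
    exact γ₀.linear.injective (h2.trans h3.symm)
  · exact hU.linear_eq_of_ne hℓ hξ hne hsp hγ h0 hv

/-- A group with spacelike displacements which is unipotent on an invariant affine subspace is
abelian. -/
theorem IsUnipotentOn.mul_comm (hU : IsUnipotentOn ℓ ξ Γ o V₀) (hℓ : IsLorentzian ℓ)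
    (hξ : 0 ≤ ℓ ξ ξ) (hne : ξ ≠ 0) (hsp : HasSpacelikeDisplacements ℓ Γ) {γ δ : V ≃ᵃ[ℝ] V}
    (hγ : γ ∈ Γ) (hδ : δ ∈ Γ) : γ * δ = δ * γ := by
  set a := γ o - o with ha
  set b := δ o - o with hb
  have haV : a ∈ V₀ := hU.base γ hγ
  have hbV : b ∈ V₀ := hU.base δ hδ
  have e1 : γ (δ o) = o + a + γ.linear b := by
    have h1 := affine_apply γ o b
    rw [hb, add_sub_cancel] at h1
    rw [h1, ha]; abel
  have e2 : δ (γ o) = o + b + δ.linear a := by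
    have h1 := affine_apply δ o a
    rw [ha, add_sub_cancel] at h1
    rw [h1, hb]; abel
  obtain ⟨c, d, hc, hd, hcξ, hdξ⟩ : ∃ c d : ℝ, γ.linear b = b + c • ξ ∧ δ.linear a = a + d • ξ ∧
      c * ℓ ξ ξ = 0 ∧ d * ℓ ξ ξ = 0 := by
    by_cases h0 : ∃ γ₀ ∈ Γ, ℓ ξ (γ₀ o - o) ≠ 0
    · obtain ⟨γ₀, hγ₀, hχ⟩ := h0
      refine ⟨0, 0, ?_, ?_, by ring, by ring⟩
      · rw [zero_smul, add_zero]; exact hU.linear_eq hℓ hξ hne hsp hγ₀ hχ hγ hbV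
      · rw [zero_smul, add_zero]; exact hU.linear_eq hℓ hξ hne hsp hγ₀ hχ hδ haV
    · push Not at h0
      obtain ⟨c, hc⟩ := hU.trivial_mod γ hγ b hbV (h0 δ hδ)
      obtain ⟨d, hd⟩ := hU.trivial_mod δ hδ a haV (h0 γ hγ)
      exact ⟨c, d, hc, hd, (hU.fixing γ hγ).smul_null hc, (hU.fixing δ hδ).smul_null hd⟩
  -- This is the displacement of `δ (γ o)` by the commutator. Its square is zero, so it is not
  -- spacelike and the commutator is `1`.
  have hdiff : γ (δ o) - δ (γ o) = (c - d) • ξ := by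
    rw [e1, e2, hc, hd]; module
  have hκ : γ * δ * γ⁻¹ * δ⁻¹ ∈ Γ :=
    Γ.mul_mem (Γ.mul_mem (Γ.mul_mem hγ hδ) (Γ.inv_mem hγ)) (Γ.inv_mem hδ)
  have hκv : (γ * δ * γ⁻¹ * δ⁻¹) (δ (γ o)) = γ (δ o) := by
    have : (γ * δ * γ⁻¹ * δ⁻¹) * (δ * γ) = γ * δ := by group
    exact congrArg (fun η : V ≃ᵃ[ℝ] V => η o) this
  have hone : γ * δ * γ⁻¹ * δ⁻¹ = 1 := by
    by_contra hne1
    have := hsp _ hκ hne1 (δ (γ o))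
    rw [hκv, hdiff] at this
    simp only [map_smul, LinearMap.smul_apply, smul_eq_mul] at this
    have h5 : (c - d) * ((c - d) * ℓ ξ ξ) = 0 := by
      rw [sub_mul c d (ℓ ξ ξ), hcξ, hdξ]; ring
    rw [h5] at this
    exact lt_irrefl _ this
  have : γ * δ = (γ * δ * γ⁻¹ * δ⁻¹) * (δ * γ) := by group
  rw [this, hone, one_mul]

end UnipotentCommute

/-! ### Covering a group by translates of its elements with small image. -/

section FiniteIndex

variable {Γ : Type*} [Group Γ] {R : Type*} [NormedRing R] [ProperSpace R]

/-- Finitely many translates of the set of elements with small image cover the group. -/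
theorem exists_finite_cover_of_norm_le_one (rot : Γ →* R) (hrot : ∀ γ, ‖rot γ‖ ≤ 1) {ε : ℝ}
    (hε : 0 < ε) : ∃ F : Set Γ, F.Finite ∧ ∀ γ, ∃ f ∈ F, ‖rot (f⁻¹ * γ) - 1‖ ≤ ε := by
  have htb : TotallyBounded (Set.range rot) :=
    (isCompact_closedBall (0 : R) 1).totallyBounded.subset (by
      rintro _ ⟨γ, rfl⟩
      simpa using hrot γ)
  obtain ⟨t, ht, htf, hcov⟩ := Metric.finite_approx_of_totallyBounded htb ε hε
  choose! s hs using fun y (hy : y ∈ t) => ht hy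
  refine ⟨s '' t, htf.image s, fun γ => ?_⟩
  obtain ⟨y, hy, hyγ⟩ := Set.mem_iUnion₂.mp (hcov ⟨γ, rfl⟩)
  refine ⟨s y, ⟨y, hy, rfl⟩, ?_⟩
  have e : rot ((s y)⁻¹ * γ) - 1 = rot (s y)⁻¹ * (rot γ - rot (s y)) := by
    rw [mul_sub, ← map_mul, ← map_mul, inv_mul_cancel, map_one]
  rw [e]
  rw [Metric.mem_ball, dist_eq_norm, ← hs y hy] at hyγ
  calc _ ≤ ‖rot (s y)⁻¹‖ * ‖rot γ - rot (s y)‖ := norm_mul_le _ _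
    _ ≤ 1 * ε := mul_le_mul (hrot _) hyγ.le (norm_nonneg _) zero_le_one
    _ = ε := one_mul _

end FiniteIndex

/-! ### The unipotent subgroup of finite index. -/

section VirtuallyUnipotent

variable {V : Type*} [NormedAddCommGroup V] [NormedSpace ℝ V] [FiniteDimensional ℝ V]
  {ℓ : LinearMap.BilinForm ℝ V} {ξ : V}

/-- A discrete group of affine Lorentz transformations which preserves a causal vector has a
subgroup of finite index acting unipotently on a nondegenerate affine subspace. -/
theorem exists_finiteIndex_unipotent (hℓ : IsLorentzian ℓ) (hξ : 0 ≤ ℓ ξ ξ) (hne : ξ ≠ 0)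
    {Δ : Subgroup (V ≃ᵃ[ℝ] V)} (hfix : ∀ γ ∈ Δ, IsFixing ℓ ξ γ) {v : V} {ε : ℝ} (hε : 0 < ε)
    (hdisc : ∀ γ ∈ Δ, ‖γ v - v‖ < ε → γ = 1) :
    ∃ Γ ≤ Δ, (∃ F : Set (V ≃ᵃ[ℝ] V), F.Finite ∧ F ⊆ Δ ∧ ∀ δ ∈ Δ, ∃ f ∈ F, f⁻¹ * δ ∈ Γ) ∧
      ∃ (o : V) (V₀ : Submodule ℝ V), IsUnipotentOn ℓ ξ Γ o V₀ ∧ ξ ∈ V₀ ∧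
        ∀ v ∈ V₀, (∀ w ∈ V₀, ℓ v w = 0) → v = 0 := by
  obtain ⟨m, π, σ, hS⟩ := exists_isScreen hℓ hξ hne
  obtain ⟨rot, hrot, hrotπ⟩ := hS.exists_rotation hℓ hξ hne
    (AffineEquiv.linearHom.comp Δ.subtype) (fun γ => (hfix γ γ.2).1) (fun γ => (hfix γ γ.2).2)
  have hrotπ' : ∀ (γ : Δ) v, ℓ ξ v = 0 → rot γ (π v) = π ((γ : V ≃ᵃ[ℝ] V).linear v) := hrotπ
  -- The bound `1 / 16` is the one required by the flag norm, and it is below the `1 / 2` needed for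
  -- the absence of small subgroups.
  set S : Set (V ≃ᵃ[ℝ] V) := {γ | ∃ h : γ ∈ Δ, ‖rot ⟨γ, h⟩ - 1‖ ≤ 1 / 16} with hSdef
  have hSΔ : S ⊆ Δ := fun γ hγ => hγ.1
  have hsmall : ∀ γ ∈ S, ∀ v, ℓ ξ v = 0 → ‖π (γ.linear v - v)‖ ≤ 1 / 16 * ‖π v‖ := by
    rintro γ ⟨hγ, hle⟩ v hv
    have h1 : π (γ.linear v - v) = (rot ⟨γ, hγ⟩ - 1) (π v) := by
      rw [map_sub, ← hrotπ' ⟨γ, hγ⟩ v hv]; rfl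
    rw [h1]
    exact (ContinuousLinearMap.le_opNorm _ _).trans
      (mul_le_mul_of_nonneg_right hle (norm_nonneg _))
  have hSS : ∀ g ∈ S, ∀ h ∈ S, ∀ z ∈ genFixed g, affineHat h z ∈ genFixed g := by
    intro g hg h hh
    obtain ⟨n, hn⟩ := exists_iterComm_eq_one hS hℓ hξ hne hε hdisc (hSΔ hg) (hSΔ hh)
      (hfix g (hSΔ hg)).1 (hfix g (hSΔ hg)).2 (hsmall g hg)
      (hfix h (hSΔ hh)).1 (hfix h (hSΔ hh)).2 (hsmall h hh)
    obtain ⟨hgΔ, hg16⟩ := hg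
    obtain ⟨hhΔ, hh16⟩ := hh
    have hcoe : ∀ k, ((iterComm (⟨g, hgΔ⟩ : Δ) ⟨h, hhΔ⟩ k : Δ) : V ≃ᵃ[ℝ] V) =
        iterComm g h k := by
      intro k
      induction k with
      | zero => rfl
      | succ k ih =>
        rw [iterComm, iterComm, commutatorElement_def, commutatorElement_def, ← ih]
        rfl
    have hn' : iterComm (⟨g, hgΔ⟩ : Δ) ⟨h, hhΔ⟩ n = 1 := Subtype.ext ((hcoe n).trans hn)
    refine affineHat_mem_genFixed hℓ hξ hne (hfix g hgΔ) (hfix h hhΔ) hn fun k w hw => ?_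
    have h1 := map_iterComm_succ_eq_one rot hrot (δ := 1 / 16) (by norm_num) hg16 hh16 hn' k
    have h2 := hrotπ' (iterComm (⟨g, hgΔ⟩ : Δ) ⟨h, hhΔ⟩ (k + 1)) w hw
    rw [h1, hcoe] at h2
    have hf := hfix _ (iterComm_mem hgΔ hhΔ (k + 1))
    have h3 : π ((iterComm g h (k + 1)).linear w - w) = 0 := by
      rw [map_sub, ← h2]; exact sub_self _
    obtain ⟨a, ha⟩ := hℓ.exists_eq_smul hξ hne (hf.sub_orth w)
      ((hS.apply_eq_zero_iff (hf.sub_orth w)).mp h3)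
    exact ⟨a, by rw [← ha]; abel⟩
  obtain ⟨X, hX, hXS⟩ := exists_unipotent_flat hℓ hξ hne (fun γ hγ => hfix γ (hSΔ hγ)) hSS
  have hle : Subgroup.closure S ≤ Δ := (Subgroup.closure_le Δ).mpr hSΔ
  obtain ⟨o, ho⟩ := hX.exists_point
  refine ⟨Subgroup.closure S, hle, ?_, o, X.comap (LinearMap.inl ℝ V ℝ),
    ⟨fun γ hγ => hfix γ (hle hγ), fun γ hγ => ?_, fun γ hγ w hw => ?_, fun γ hγ w hw hw0 =>
      (hXS γ hγ).2 w hw hw0⟩, hX.mem, fun v hv hvw => hX.nondegenerate v hv hvw⟩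
  · have : ProperSpace (EuclideanSpace ℝ (Fin m) →L[ℝ] EuclideanSpace ℝ (Fin m)) :=
      FiniteDimensional.proper ℝ _
    obtain ⟨F, hF, hcov⟩ := exists_finite_cover_of_norm_le_one rot hrot
      (show (0 : ℝ) < 1 / 16 by norm_num)
    refine ⟨Subtype.val '' F, hF.image _, by rintro _ ⟨f, -, rfl⟩; exact f.2, fun δ hδ => ?_⟩
    obtain ⟨f, hf, hle⟩ := hcov ⟨δ, hδ⟩
    exact ⟨f, ⟨f, hf, rfl⟩, Subgroup.subset_closure ⟨(f⁻¹ * ⟨δ, hδ⟩ : Δ).2, hle⟩⟩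
  · have h1 := X.sub_mem ((hXS γ hγ).1 _ ho) ho
    rw [affineHat_apply_one] at h1
    have e : (γ o, (1 : ℝ)) - (o, 1) = (γ o - o, 0) := by ext <;> simp
    rw [e] at h1
    exact h1
  · have h1 := (hXS γ hγ).1 _ hw
    rw [LinearMap.inl_apply, affineHat_apply_zero] at h1
    exact h1

end VirtuallyUnipotent
end FlatLorentz

namespace FlatLorentz

/-! ### Linear growth of additive relations and simultaneous approximation. -/

section Growth

/-- An additive relation which is bounded over bounded sets has linear growth. -/
theorem exists_linear_growth {W F : Type*} [NormedAddCommGroup W] [NormedSpace ℝ W]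
    [FiniteDimensional ℝ W] [NormedAddCommGroup F] [NormedSpace ℝ F] (P : AddSubgroup (W × F))
    (hP : ∀ R : ℝ, ∃ K : ℝ, ∀ p ∈ P, ‖p.1‖ ≤ R → ‖p.2‖ ≤ K) :
    ∃ K : ℝ, 0 ≤ K ∧ ∀ p ∈ P, ‖p.2‖ ≤ K * (1 + ‖p.1‖) := by
  classical
  set s : Set W := Prod.fst '' (P : Set (W × F)) with hs
  obtain ⟨t, hts, hspan⟩ := (Submodule.fg_span_iff_fg_span_finset_subset (R := ℝ) s).mp
    (IsNoetherian.noetherian _)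
  choose! q hqP hq using fun w (hw : w ∈ t) => hts hw
  let L : (t → ℝ) →ₗ[ℝ] W := Fintype.linearCombination ℝ (fun i : t => (i : W))
  have hL : ∀ x, L x = ∑ i : t, x i • (i : W) := fun x => rfl
  have hrange : LinearMap.range L = Submodule.span ℝ s := by
    rw [hspan, Fintype.range_linearCombination]
    congr 1
    exact Subtype.range_coe
  obtain ⟨S₀, hS₀⟩ := L.rangeRestrict.exists_rightInverse_of_surjective
    (LinearMap.range_rangeRestrict L)
  obtain ⟨S₁, hS₁⟩ := LinearMap.exists_extend S₀
  let S : W →L[ℝ] (t → ℝ) := LinearMap.toContinuousLinearMap S₁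
  have hLS : ∀ w ∈ s, L (S w) = w := by
    intro w hw
    have hw' : w ∈ LinearMap.range L := hrange ▸ Submodule.subset_span hw
    have h1 : S w = S₀ ⟨w, hw'⟩ := LinearMap.congr_fun hS₁ ⟨w, hw'⟩
    have h2 := LinearMap.congr_fun hS₀ ⟨w, hw'⟩
    rw [h1]
    exact congrArg Subtype.val h2
  set R : ℝ := ∑ i : t, ‖(i : W)‖ with hR
  set B : ℝ := ∑ i : t, ‖(q i).2‖ with hB
  have hB0 : 0 ≤ B := Finset.sum_nonneg fun i _ => norm_nonneg _
  obtain ⟨K, hK⟩ := hP R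
  refine ⟨|K| + (‖S‖ + 1) * B, by positivity, fun p hp => ?_⟩
  set x := S p.1 with hx
  have hxi : ∀ i, |x i| ≤ ‖S‖ * ‖p.1‖ := fun i =>
    (norm_le_pi_norm x i).trans (S.le_opNorm _)
  -- Subtracting integer parts brings the first component into a bounded region, where the
  -- hypothesis bounds the second; the integers subtracted grow linearly in `‖p.1‖`.
  set p' : W × F := p - ∑ i : t, ⌊x i⌋ • q i with hp'
  have hp'P : p' ∈ P := P.sub_mem hp (P.sum_mem fun i _ => P.zsmul_mem (hqP i i.2) _)
  have hfst : p'.1 = ∑ i : t, Int.fract (x i) • (i : W) := by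
    have h1 : p.1 = ∑ i : t, x i • (i : W) := by
      rw [← hL, hx, hLS p.1 ⟨p, hp, rfl⟩]
    rw [hp', Prod.fst_sub, Prod.fst_sum, h1, ← Finset.sum_sub_distrib]
    refine Finset.sum_congr rfl fun i _ => ?_
    rw [Prod.smul_fst, hq i i.2, Int.fract, sub_smul, Int.cast_smul_eq_zsmul]
  have hfstR : ‖p'.1‖ ≤ R := by
    rw [hfst]
    refine (norm_sum_le _ _).trans (Finset.sum_le_sum fun i _ => ?_)
    rw [norm_smul, Real.norm_of_nonneg (Int.fract_nonneg _)]
    exact mul_le_of_le_one_left (norm_nonneg _) (Int.fract_lt_one _).le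
  have h2 := hK p' hp'P hfstR
  have h3 : p.2 = p'.2 + ∑ i : t, ⌊x i⌋ • (q i).2 := by
    rw [hp', Prod.snd_sub, Prod.snd_sum]
    simp only [Prod.smul_snd]
    abel
  have h4 : ‖∑ i : t, ⌊x i⌋ • (q i).2‖ ≤ (‖S‖ * ‖p.1‖ + 1) * B := by
    refine (norm_sum_le _ _).trans ?_
    rw [hB, Finset.mul_sum]
    refine Finset.sum_le_sum fun i _ => ?_
    rw [← Int.cast_smul_eq_zsmul ℝ, norm_smul]
    refine mul_le_mul_of_nonneg_right ?_ (norm_nonneg _)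
    have h5 := hxi i
    have h6 := Int.floor_le (x i)
    have h7 := Int.lt_floor_add_one (x i)
    have h8 := abs_le.mp h5
    rw [Real.norm_eq_abs, abs_le]
    constructor <;> linarith
  have h5 : ‖p.2‖ ≤ |K| + (‖S‖ * ‖p.1‖ + 1) * B := by
    rw [h3]
    exact (norm_add_le _ _).trans (add_le_add (h2.trans (le_abs_self K)) h4)
  have h6 := norm_nonneg p.1
  have h7 := norm_nonneg S
  have h8 := abs_nonneg K
  nlinarith [mul_nonneg h8 h6, mul_nonneg (mul_nonneg h7 h6) hB0, mul_nonneg h7 hB0,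
    mul_nonneg h6 hB0]

/-- The real multiples of a vector in the span of a subgroup stay close to the subgroup. -/
theorem exists_norm_smul_sub_le {E : Type*} [NormedAddCommGroup E] [NormedSpace ℝ E]
    (Λ : AddSubgroup E) {c : E} (hc : c ∈ Submodule.span ℝ (Λ : Set E)) :
    ∃ K : ℝ, ∀ t : ℝ, ∃ x ∈ Λ, ‖t • c - x‖ ≤ K := by
  induction hc using Submodule.span_induction with
  | mem c hc =>
    refine ⟨‖c‖, fun t => ⟨⌊t⌋ • c, Λ.zsmul_mem hc _, ?_⟩⟩
    rw [← Int.cast_smul_eq_zsmul ℝ, ← sub_smul, norm_smul]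
    change ‖Int.fract t‖ * _ ≤ _
    rw [Real.norm_of_nonneg (Int.fract_nonneg _)]
    exact mul_le_of_le_one_left (norm_nonneg _) (Int.fract_lt_one _).le
  | zero => exact ⟨0, fun t => ⟨0, Λ.zero_mem, by simp⟩⟩
  | add a b _ _ iha ihb =>
    obtain ⟨K₁, h₁⟩ := iha
    obtain ⟨K₂, h₂⟩ := ihb
    refine ⟨K₁ + K₂, fun t => ?_⟩
    obtain ⟨x, hx, hx'⟩ := h₁ t
    obtain ⟨y, hy, hy'⟩ := h₂ t
    refine ⟨x + y, Λ.add_mem hx hy, ?_⟩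
    rw [smul_add, add_sub_add_comm]
    exact (norm_add_le _ _).trans (add_le_add hx' hy')
  | smul r a _ ih =>
    obtain ⟨K, h⟩ := ih
    refine ⟨K, fun t => ?_⟩
    obtain ⟨x, hx, hx'⟩ := h (t * r)
    exact ⟨x, hx, by rwa [smul_smul]⟩

/-- Arbitrarily large multiples of a vector in the span of a subgroup are arbitrarily close to
the subgroup. -/
theorem exists_norm_smul_sub_lt {E : Type*} [NormedAddCommGroup E] [NormedSpace ℝ E]
    [FiniteDimensional ℝ E] (Λ : AddSubgroup E) {c : E} (hc : c ∈ Submodule.span ℝ (Λ : Set E))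
    (T : ℝ) {ε : ℝ} (hε : 0 < ε) : ∃ s ≥ T, ∃ x ∈ Λ, ‖s • c - x‖ < ε := by
  obtain ⟨K, hK⟩ := exists_norm_smul_sub_le Λ hc
  choose x hx hxK using fun n : ℕ => hK n
  have hmem : ∀ n : ℕ, (n : ℝ) • c - x n ∈ Metric.closedBall (0 : E) K := fun n => by
    rw [mem_closedBall_zero_iff]; exact hxK n
  -- Pigeonhole: two bounded errors `n • c - x n` with far apart indices nearly coincide, and their
  -- difference is the required approximation.
  obtain ⟨a, -, φ, hφ, hlim⟩ := (isCompact_closedBall (0 : E) K).tendsto_subseq hmem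
  obtain ⟨N, hN⟩ := Metric.cauchySeq_iff'.mp hlim.cauchySeq ε hε
  set m := N + ⌈|T|⌉₊ with hm
  have hgap : φ N + ⌈|T|⌉₊ ≤ φ m := by
    rw [hm, add_comm, add_comm N]; exact hφ.add_le_nat _ _
  have h1 := hN m (by rw [hm]; exact Nat.le_add_right _ _)
  refine ⟨(φ m : ℝ) - φ N, ?_, x (φ m) - x (φ N), Λ.sub_mem (hx _) (hx _), ?_⟩
  · have h2 : ((φ N + ⌈|T|⌉₊ : ℕ) : ℝ) ≤ φ m := by exact_mod_cast hgap
    push_cast at h2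
    have h3 := Nat.le_ceil |T|
    have h4 := le_abs_self T
    linarith
  · rw [dist_eq_norm] at h1
    have e : ((φ m : ℝ) - φ N) • c - (x (φ m) - x (φ N)) =
        ((φ m : ℝ) • c - x (φ m)) - ((φ N : ℝ) • c - x (φ N)) := by module
    rw [e]
    exact h1

end Growth

/-! ### Heights bounded by the absence of returns. -/

section HeightBound

variable {E : Type*} [NormedAddCommGroup E] [NormedSpace ℝ E]
  {ℓ : LinearMap.BilinForm ℝ E} {C : Set E} {Γ : Subgroup (E ≃ᵃ[ℝ] E)}

/-- Points `v - t c` in the past of `v`, with small `t`, are not limits of points in the future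
of the orbit of `v`. -/
def NoReturn (C : Set E) (Γ : Subgroup (E ≃ᵃ[ℝ] E)) : Prop :=
  ∀ v, ∀ c ∈ C, c ≠ 0 → ∃ t : ℝ, 0 < t ∧ v - t • c ∉ closure {z | ∃ γ ∈ Γ, z - γ v ∈ C}

/-- The point `v - t • ξ + δ • f` is so close to the excluded point `v - t • ξ` that it lies in no
cone `γ v + C`. Its difference `y` from `γ v` pairs positively with `ξ`, so it is not in `-C`
either. Hence `ℓ y y < 0`, whose expansion bounds the height `-ℓ f (γ v - v)`. -/
theorem exists_height_bound (hℓ : IsLorentzian ℓ) (hC : IsTimeCone ℓ C) (hret : NoReturn C Γ)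
    {ξ f : E} (hξC : ξ ∈ C) (hne : ξ ≠ 0) (hnull : ℓ ξ ξ = 0) (hf : ℓ ξ f = 1) (v : E) (R : ℝ) :
    ∃ K : ℝ, ∀ γ ∈ Γ, ℓ ξ (γ v - v) = 0 → -R ≤ ℓ (γ v - v) (γ v - v) → -ℓ f (γ v - v) ≤ K := by
  obtain ⟨t, ht, hnot⟩ := hret v ξ hξC hne
  rw [Metric.mem_closure_iff] at hnot
  push Not at hnot
  obtain ⟨η, hη, hfar⟩ := hnot
  set δ : ℝ := η / (2 * (1 + ‖f‖)) with hδ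
  have hδ0 : 0 < δ := by positivity
  have hδf : ‖δ • f‖ < η := by
    rw [norm_smul, Real.norm_of_nonneg hδ0.le, hδ, div_mul_eq_mul_div, div_lt_iff₀ (by positivity)]
    nlinarith [norm_nonneg f]
  refine ⟨(R + 2 * t * δ + δ ^ 2 * |ℓ f f|) / (2 * δ), fun γ hγ hξa hR => ?_⟩
  set a := γ v - v with ha
  set y := -a - t • ξ + δ • f with hy
  have hyC : y ∉ C := by
    intro hyC
    have h1 := hfar (v - t • ξ + δ • f) ⟨γ, hγ, by
      have : v - t • ξ + δ • f - γ v = y := by rw [hy, ha]; abel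
      rwa [this]⟩
    rw [dist_eq_norm, sub_add_cancel_left, norm_neg] at h1
    linarith
  have hξy : ℓ ξ y = δ := by
    simp only [hy, map_add, map_sub, map_neg, map_smul, smul_eq_mul, hξa, hnull, hf]; ring
  have hyy : ℓ y y < 0 := by
    by_contra! h
    rcases hC.mem_or_neg_mem h with h1 | h1
    · exact hyC h1
    · have := hC.pairing_nonneg hℓ hξC h1
      rw [map_neg, hξy] at this
      linarith
  have e : ℓ y y = ℓ a a - 2 * δ * ℓ f a - 2 * t * δ + δ ^ 2 * ℓ f f := by
    simp only [hy, map_add, map_sub, map_neg, map_smul, LinearMap.add_apply, LinearMap.sub_apply,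
      LinearMap.neg_apply, LinearMap.smul_apply, smul_eq_mul, hξa, hnull, hf, hℓ.1 a ξ, hℓ.1 f ξ,
      hℓ.1 a f]
    ring
  rw [le_div_iff₀ (by positivity)]
  have h1 : -(δ ^ 2 * ℓ f f) ≤ δ ^ 2 * |ℓ f f| := by
    have := neg_le_abs (ℓ f f)
    nlinarith [sq_nonneg δ]
  linarith

end HeightBound

/-! ### Local finiteness of cones for unipotent groups. -/

section LocallyFinite

variable {E : Type*} [NormedAddCommGroup E] [NormedSpace ℝ E] [FiniteDimensional ℝ E]
  {ℓ : LinearMap.BilinForm ℝ E} {C : Set E} {Γ : Subgroup (E ≃ᵃ[ℝ] E)}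

/-- Only finitely many points of each orbit lie in a given ball. -/
def HasFiniteDisplacements (Γ : Subgroup (E ≃ᵃ[ℝ] E)) : Prop :=
  ∀ (v : E) (R : ℝ), {γ | γ ∈ Γ ∧ ‖γ v - v‖ ≤ R}.Finite

/-- Locally, only finitely many of the cones with the vertices in an orbit are met. -/
def LocallyFiniteCones (ℓ : LinearMap.BilinForm ℝ E) (Γ : Subgroup (E ≃ᵃ[ℝ] E)) : Prop :=
  ∀ v, ∃ N ∈ 𝓝 v, {γ | γ ∈ Γ ∧ ∃ z ∈ N, 0 ≤ ℓ (z - γ v) (z - γ v)}.Finite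

theorem exists_bilin_bound (ℓ : LinearMap.BilinForm ℝ E) :
    ∃ B : ℝ, 0 ≤ B ∧ ∀ x y, |ℓ x y| ≤ B * ‖x‖ * ‖y‖ := by
  let L : E →L[ℝ] E →L[ℝ] ℝ :=
    LinearMap.toContinuousLinearMap (LinearMap.toContinuousLinearMap.toLinearMap ∘ₗ ℓ)
  exact ⟨‖L‖, L.opNorm_nonneg, fun x y => L.le_opNorm₂ x y⟩

/-- Let `a = γ v - v` and `q = -ℓ a a`. If `v + x` is causally related to `γ v` and `x` is small,
the mixed term is at most `(1 + q) / 2` by the linear bound on `‖a‖`. This bounds `q`, then `‖a‖`,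
leaving finitely many `γ`. -/
theorem locallyFiniteCones_of_bound (hs : ∀ v w, ℓ v w = ℓ w v)
    (hfin : HasFiniteDisplacements Γ) (hsp : HasSpacelikeDisplacements ℓ Γ)
    (hb : ∀ v, ∃ K : ℝ, ∀ γ ∈ Γ, ‖γ v - v‖ ≤ K * (1 - ℓ (γ v - v) (γ v - v))) :
    LocallyFiniteCones ℓ Γ := by
  intro v
  obtain ⟨B, hB0, hB⟩ := exists_bilin_bound ℓ
  obtain ⟨K₀, hK₀⟩ := hb v
  set K := |K₀| with hKdef
  have hq0 : ∀ γ ∈ Γ, 0 ≤ -ℓ (γ v - v) (γ v - v) := by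
    intro γ hγ
    by_cases h1 : γ = 1
    · simp [h1]
    · linarith [hsp γ hγ h1 v]
  have hK : ∀ γ ∈ Γ, ‖γ v - v‖ ≤ K * (1 - ℓ (γ v - v) (γ v - v)) := fun γ hγ =>
    (hK₀ γ hγ).trans (mul_le_mul_of_nonneg_right (le_abs_self _) (by linarith [hq0 γ hγ]))
  have hKnn : 0 ≤ K := abs_nonneg _
  set r : ℝ := 1 / (4 * B * K + 1) with hr
  have hden : 0 < 4 * B * K + 1 := by positivity
  have hr0 : 0 < r := by positivity
  have hr1 : r ≤ 1 := by
    rw [hr, div_le_one hden]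
    have : 0 ≤ 4 * B * K := by positivity
    linarith
  have hrBK : 2 * B * r * K ≤ 1 / 2 := by
    have h1 : r * (4 * B * K + 1) = 1 := by rw [hr]; field_simp
    nlinarith
  refine ⟨Metric.ball v r, Metric.ball_mem_nhds v hr0,
    (hfin v (K * (2 * B + 2))).subset ?_⟩
  rintro γ ⟨hγ, z, hz, hzγ⟩
  refine ⟨hγ, ?_⟩
  set a := γ v - v with ha
  set q := -ℓ a a with hq
  set x := z - v with hx
  have hxr : ‖x‖ ≤ r := by
    rw [Metric.mem_ball, dist_eq_norm] at hz; exact hz.le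
  have e : z - γ v = x - a := by rw [hx, ha]; abel
  rw [e] at hzγ
  simp only [map_sub, LinearMap.sub_apply, hs a x] at hzγ
  have h1 := (le_abs_self _).trans (hB x x)
  have h2 := (neg_le_abs _).trans (hB x a)
  have h3 := hK γ hγ
  have h4 := hq0 γ hγ
  rw [← ha] at h3 h4
  have h5 : B * ‖x‖ * ‖x‖ ≤ B := by
    have : ‖x‖ * ‖x‖ ≤ 1 := by nlinarith [norm_nonneg x]
    nlinarith
  have h6 : B * ‖x‖ * ‖a‖ ≤ B * r * (K * (1 + q)) := by
    have h7 : B * ‖x‖ ≤ B * r := mul_le_mul_of_nonneg_left hxr hB0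
    have h8 : ‖a‖ ≤ K * (1 + q) := by rw [hq]; linarith
    exact mul_le_mul h7 h8 (norm_nonneg _) (by positivity)
  have h7 : 2 * (B * r * (K * (1 + q))) ≤ 1 / 2 * (1 + q) := by
    have := mul_le_mul_of_nonneg_right hrBK (show 0 ≤ 1 + q by linarith)
    linarith
  have h9 : q ≤ 2 * B + 1 := by linarith
  calc ‖a‖ ≤ K * (1 - ℓ a a) := h3
    _ ≤ K * (2 * B + 2) := mul_le_mul_of_nonneg_left (by linarith) hKnn

/-- The case where the group acts by translations. -/
theorem locallyFiniteCones_of_translations (hℓ : IsLorentzian ℓ) (hC : IsTimeCone ℓ C)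
    (hfin : HasFiniteDisplacements Γ) (hsp : HasSpacelikeDisplacements ℓ Γ)
    (hret : NoReturn C Γ) (htr : ∀ γ ∈ Γ, ∀ w, γ.linear w = w) : LocallyFiniteCones ℓ Γ := by
  have htr' : ∀ γ ∈ Γ, ∀ v, γ v = v + γ 0 := by
    intro γ hγ v
    have := affine_apply γ 0 v
    rw [zero_add, htr γ hγ] at this
    rw [this, add_comm]
  let Λ : AddSubgroup E :=
    { carrier := {x | ∃ γ ∈ Γ, x = γ 0}
      zero_mem' := ⟨1, Γ.one_mem, rfl⟩
      add_mem' := by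
        rintro _ _ ⟨γ, hγ, rfl⟩ ⟨δ, hδ, rfl⟩
        refine ⟨γ * δ, Γ.mul_mem hγ hδ, ?_⟩
        rw [show (γ * δ) 0 = γ (δ 0) from rfl, htr' γ hγ (δ 0), add_comm]
      neg_mem' := by
        rintro _ ⟨γ, hγ, rfl⟩
        refine ⟨γ⁻¹, Γ.inv_mem hγ, ?_⟩
        have h1 : γ⁻¹ (γ 0) = 0 := γ.symm_apply_apply 0
        rw [htr' _ (Γ.inv_mem hγ)] at h1
        exact (eq_neg_of_add_eq_zero_right h1).symm }
  -- If `x ∈ Λ` is close to `s • c` with `s ≥ t`, then `-x + (s - t) • c` lies in the future of the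
  -- orbit point `-x` and is close to `-(t • c)`: a return.
  have hTC : ∀ c ∈ Submodule.span ℝ (Λ : Set E), c ∈ C → c = 0 := by
    intro c hcΛ hcC
    by_contra hc0
    obtain ⟨t, ht, hnot⟩ := hret 0 c hcC hc0
    refine hnot (Metric.mem_closure_iff.mpr fun ε hε => ?_)
    obtain ⟨s, hs, x, hx, hxs⟩ := exists_norm_smul_sub_lt Λ hcΛ t hε
    obtain ⟨γ, hγ, hγx⟩ := Λ.neg_mem hx
    refine ⟨γ 0 + (s - t) • c, ⟨γ, hγ, ?_⟩, ?_⟩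
    · rw [add_sub_cancel_left]
      exact hC.smul_mem hcC (by linarith)
    · rw [← hγx, dist_eq_norm, ← norm_neg]
      have e : -(0 - t • c - (-x + (s - t) • c)) = s • c - x := by module
      rw [e]
      exact hxs
  have hneg : ∀ c ∈ Submodule.span ℝ (Λ : Set E), c ≠ 0 → ℓ c c < 0 := by
    intro c hc hc0
    by_contra! h
    rcases hC.mem_or_neg_mem h with h1 | h1
    · exact hc0 (hTC c hc h1)
    · exact hc0 (neg_eq_zero.mp (hTC _ (Submodule.neg_mem _ hc) h1))
  obtain ⟨κ, hκ, hκb⟩ : ∃ κ : ℝ, 0 < κ ∧ ∀ c ∈ Submodule.span ℝ (Λ : Set E),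
      κ * ‖c‖ ^ 2 ≤ -ℓ c c := by
    set T := Submodule.span ℝ (Λ : Set E)
    have hcomp : IsCompact ((T : Set E) ∩ Metric.sphere 0 1) :=
      (isCompact_sphere (0 : E) 1).inter_left T.closed_of_finiteDimensional
    rcases ((T : Set E) ∩ Metric.sphere 0 1).eq_empty_or_nonempty with hemp | hnon
    · refine ⟨1, one_pos, fun c hc => ?_⟩
      have hc0 : c = 0 := by
        by_contra hc0
        have : ‖c‖⁻¹ • c ∈ (T : Set E) ∩ Metric.sphere 0 1 := by
          refine ⟨T.smul_mem _ hc, ?_⟩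
          rw [mem_sphere_zero_iff_norm, norm_smul, norm_inv, norm_norm,
            inv_mul_cancel₀ (norm_ne_zero_iff.mpr hc0)]
        rw [hemp] at this
        exact this
      simp [hc0]
    · obtain ⟨x, ⟨hxT, hx1⟩, hmax⟩ := hcomp.exists_isMaxOn hnon
        (continuous_bilin ℓ continuous_id continuous_id).continuousOn
      have hx0 : x ≠ 0 := by
        rintro rfl
        simp at hx1
      refine ⟨-ℓ x x, by linarith [hneg x hxT hx0], fun c hc => ?_⟩
      by_cases hc0 : c = 0
      · simp [hc0]
      have hn : 0 < ‖c‖ := norm_pos_iff.mpr hc0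
      have hmem : ‖c‖⁻¹ • c ∈ (T : Set E) ∩ Metric.sphere 0 1 := by
        refine ⟨T.smul_mem _ hc, ?_⟩
        rw [mem_sphere_zero_iff_norm, norm_smul, norm_inv, norm_norm, inv_mul_cancel₀ hn.ne']
      have h1 : ℓ (‖c‖⁻¹ • c) (‖c‖⁻¹ • c) ≤ ℓ x x := hmax hmem
      simp only [map_smul, LinearMap.smul_apply, smul_eq_mul] at h1
      have h2 : ‖c‖⁻¹ * (‖c‖⁻¹ * ℓ c c) = ℓ c c / ‖c‖ ^ 2 := by field_simp
      rw [h2, div_le_iff₀ (by positivity)] at h1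
      linarith
  refine locallyFiniteCones_of_bound hℓ.1 hfin hsp fun v => ⟨1 + 1 / κ, fun γ hγ => ?_⟩
  have e : γ v - v = γ 0 := by rw [htr' γ hγ, add_sub_cancel_left]
  rw [e]
  have h1 := hκb (γ 0) (Submodule.subset_span ⟨γ, hγ, rfl⟩)
  set n := ‖γ 0‖
  have h2 : n ^ 2 ≤ 1 / κ * (-ℓ (γ 0) (γ 0)) := by
    rw [div_mul_eq_mul_div, one_mul, le_div_iff₀ hκ]; linarith
  have h3 : n ≤ 1 + n ^ 2 := by nlinarith [sq_nonneg (n - 1)]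
  have h4 : 0 ≤ 1 / κ := by positivity
  have h5 : 0 ≤ -ℓ (γ 0) (γ 0) := by nlinarith [sq_nonneg n]
  nlinarith

variable {ξ : E}

theorem IsScreen.inner_eq {E : Type*} [NormedAddCommGroup E] [NormedSpace ℝ E]
    {ℓ : LinearMap.BilinForm ℝ E} {ξ : E} {m : ℕ} {π : E →ₗ[ℝ] EuclideanSpace ℝ (Fin m)}
    {σ : EuclideanSpace ℝ (Fin m) →ₗ[ℝ] E} (hS : IsScreen ℓ ξ π σ) (hs : ∀ v w, ℓ v w = ℓ w v)
    {x y : E} (hx : ℓ ξ x = 0) (hy : ℓ ξ y = 0) : |ℓ x y| ≤ ‖π x‖ * ‖π y‖ := by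
  have h1 := hS.norm_sq (x + y) (by rw [map_add, hx, hy, add_zero])
  rw [map_add, norm_add_sq_real, hS.norm_sq x hx, hS.norm_sq y hy] at h1
  simp only [map_add, LinearMap.add_apply, hs y x] at h1
  have h2 : ℓ x y = -inner ℝ (π x) (π y) := by linarith
  rw [h2, abs_neg]
  exact abs_real_inner_le_norm _ _

theorem displacement_mul {E : Type*} [AddCommGroup E] [Module ℝ E] (γ δ : E ≃ᵃ[ℝ] E) (v : E) :
    (γ * δ) v - v = (γ v - v) + γ.linear (δ v - v) := by
  have h1 := affine_apply γ v (δ v - v)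
  rw [add_sub_cancel] at h1
  rw [show (γ * δ) v = γ (δ v) from rfl, h1]; abel

/-- The case where the group does not act by translations. -/
theorem locallyFiniteCones_of_not_translations (hℓ : IsLorentzian ℓ) (hC : IsTimeCone ℓ C)
    (hfin : HasFiniteDisplacements Γ) (hsp : HasSpacelikeDisplacements ℓ Γ)
    (hret : NoReturn C Γ) (hret' : NoReturn (-C) Γ) (hξC : ξ ∈ C) (hne : ξ ≠ 0)
    (hnull : ℓ ξ ξ = 0) (hU : IsUnipotentOn ℓ ξ Γ 0 ⊤)
    (hχ : ∀ γ ∈ Γ, ∀ v, ℓ ξ (γ v - v) = 0) : LocallyFiniteCones ℓ Γ := by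
  obtain ⟨f, hf⟩ : ∃ f, ℓ ξ f = 1 := by
    obtain ⟨w, hw⟩ : ∃ w, ℓ ξ w ≠ 0 := by
      by_contra! hall
      exact hne (hℓ.eq_zero_of_forall hall)
    exact ⟨(ℓ ξ w)⁻¹ • w, by rw [map_smul, smul_eq_mul, inv_mul_cancel₀ hw]⟩
  obtain ⟨m, π, σ, hS⟩ := exists_isScreen hℓ hnull.ge hne
  refine locallyFiniteCones_of_bound hℓ.1 hfin hsp fun v => ?_
  have hπfix : ∀ γ ∈ Γ, ∀ w, ℓ ξ w = 0 → π (γ.linear w) = π w := by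
    intro γ hγ w hw
    obtain ⟨a, ha⟩ := hU.trivial_mod γ hγ w trivial hw
    have hπξ : π ξ = 0 := (hS.apply_eq_zero_iff hnull).mpr hnull
    rw [ha, map_add, map_smul, hπξ, smul_zero, add_zero]
  have hA : ∀ γ ∈ Γ, ‖π (γ v - v)‖ ^ 2 = -ℓ (γ v - v) (γ v - v) := fun γ hγ =>
    hS.norm_sq _ (hχ γ hγ v)
  -- the displacement is controlled by its screen part and by its height
  obtain ⟨B, hB0, hB⟩ := exists_bilin_bound ℓ
  let σ' : EuclideanSpace ℝ (Fin m) →L[ℝ] E := LinearMap.toContinuousLinearMap σ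
  have hctrl : ∀ γ ∈ Γ, ‖γ v - v‖ ≤
      (‖σ'‖ + B * ‖f‖ * ‖σ'‖ * ‖ξ‖) * ‖π (γ v - v)‖ + ‖ξ‖ * |ℓ f (γ v - v)| := by
    intro γ hγ
    set a := γ v - v
    have ha : ℓ ξ a = 0 := hχ γ hγ v
    obtain ⟨c, hc⟩ := hℓ.exists_eq_smul hnull.ge hne (hS.sub_orth ha)
      ((hS.apply_eq_zero_iff (hS.sub_orth ha)).mp (hS.sub_apply a))
    have hcval : c = ℓ f a - ℓ f (σ (π a)) := by
      rw [← map_sub, hc, map_smul, hℓ.1 f ξ, hf, smul_eq_mul, mul_one]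
    have hσ : ‖σ (π a)‖ ≤ ‖σ'‖ * ‖π a‖ := σ'.le_opNorm _
    have h1 : a = σ (π a) + c • ξ := by rw [← hc]; abel
    have h2 : ‖a‖ ≤ ‖σ (π a)‖ + |c| * ‖ξ‖ := by
      nth_rewrite 1 [h1]
      refine (norm_add_le _ _).trans ?_
      rw [norm_smul, Real.norm_eq_abs]
    have h3 : |c| ≤ |ℓ f a| + B * ‖f‖ * (‖σ'‖ * ‖π a‖) := by
      rw [hcval]
      refine (abs_sub _ _).trans (add_le_add le_rfl ((hB _ _).trans ?_))
      exact mul_le_mul_of_nonneg_left hσ (by positivity)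
    have h4 := mul_le_mul_of_nonneg_right h3 (norm_nonneg ξ)
    linarith
  -- bounded screen parts give bounded heights
  have hheight : ∀ R : ℝ, ∃ K : ℝ, ∀ γ ∈ Γ, ‖π (γ v - v)‖ ≤ R → |ℓ f (γ v - v)| ≤ K := by
    intro R
    obtain ⟨K₁, hK₁⟩ := exists_height_bound hℓ hC hret hξC hne hnull hf v (R ^ 2)
    -- Time reversal supplies the bound on the height from the other side.
    obtain ⟨K₂, hK₂⟩ := exists_height_bound hℓ hC.neg hret' (ξ := -ξ) (f := -f)
      (by simpa using hξC) (neg_ne_zero.mpr hne) (by simpa using hnull) (by simpa using hf)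
      v (R ^ 2)
    refine ⟨max K₁ K₂, fun γ hγ hR => abs_le'.mpr ⟨?_, ?_⟩⟩
    · refine le_trans ?_ (le_max_right _ _)
      have h1 := hK₂ γ hγ (by rw [map_neg, LinearMap.neg_apply, hχ γ hγ, neg_zero]) (by
        have := hA γ hγ
        have := pow_le_pow_left₀ (norm_nonneg _) hR 2
        linarith)
      rwa [map_neg, LinearMap.neg_apply, neg_neg] at h1
    · refine le_trans ?_ (le_max_left _ _)
      exact hK₁ γ hγ (hχ γ hγ v) (by
        have := hA γ hγ
        have := pow_le_pow_left₀ (norm_nonneg _) hR 2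
        linarith)
  have hAmul : ∀ γ ∈ Γ, ∀ δ ∈ Γ, π ((γ * δ) v - v) = π (γ v - v) + π (δ v - v) := by
    intro γ hγ δ hδ
    rw [displacement_mul, map_add, hπfix γ hγ _ (hχ δ hδ v)]
  have hAone : π ((1 : E ≃ᵃ[ℝ] E) v - v) = 0 := by simp
  have hAinv : ∀ γ ∈ Γ, π (γ⁻¹ v - v) = -π (γ v - v) := by
    intro γ hγ
    have := hAmul γ hγ γ⁻¹ (Γ.inv_mem hγ)
    rw [mul_inv_cancel, hAone] at this
    exact (neg_eq_of_add_eq_zero_right this.symm).symm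
  -- the shear, a homomorphism
  set y : (E ≃ᵃ[ℝ] E) → E := fun γ => (γ⁻¹).linear f - f with hy
  have hyξ : ∀ γ ∈ Γ, ℓ ξ (y γ) = 0 := fun γ hγ => (hU.fixing _ (Γ.inv_mem hγ)).sub_orth f
  have hYmul : ∀ γ ∈ Γ, ∀ δ ∈ Γ, π (y (γ * δ)) = π (y γ) + π (y δ) := by
    intro γ hγ δ hδ
    have e : y (γ * δ) = (δ⁻¹).linear (y γ) + y δ := by
      simp only [hy]
      rw [mul_inv_rev, linear_mul_apply, map_sub]; abel
    rw [e, map_add, hπfix _ (Γ.inv_mem hδ) _ (hyξ γ hγ)]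
  have hY1 : y 1 = 0 := sub_self f
  have hYinv : ∀ γ ∈ Γ, π (y γ⁻¹) = -π (y γ) := by
    intro γ hγ
    have := hYmul γ hγ γ⁻¹ (Γ.inv_mem hγ)
    rw [mul_inv_cancel, hY1, map_zero] at this
    exact (neg_eq_of_add_eq_zero_right this.symm).symm
  have hfinR : ∀ R : ℝ, {γ | γ ∈ Γ ∧ ‖π (γ v - v)‖ ≤ R}.Finite := by
    intro R
    obtain ⟨K, hK⟩ := hheight R
    refine (hfin v ((‖σ'‖ + B * ‖f‖ * ‖σ'‖ * ‖ξ‖) * R + ‖ξ‖ * K)).subset ?_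
    rintro γ ⟨hγ, hR⟩
    refine ⟨hγ, (hctrl γ hγ).trans (add_le_add ?_ ?_)⟩
    · exact mul_le_mul_of_nonneg_left hR (by positivity)
    · exact mul_le_mul_of_nonneg_left (hK γ hγ hR) (norm_nonneg _)
  -- Only finitely many elements have a bounded screen part, so any additive function on `Γ` is
  -- bounded there and thus grows at most linearly with the screen part.
  have hgrowth : ∀ {F : Type} [NormedAddCommGroup F] [NormedSpace ℝ F] (φ : (E ≃ᵃ[ℝ] E) → F),
      (∀ γ ∈ Γ, ∀ δ ∈ Γ, φ (γ * δ) = φ γ + φ δ) → φ 1 = 0 → (∀ γ ∈ Γ, φ γ⁻¹ = -φ γ) →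
      ∃ K : ℝ, 0 ≤ K ∧ ∀ γ ∈ Γ, ‖φ γ‖ ≤ K * (1 + ‖π (γ v - v)‖) := by
    intro F _ _ φ hmul hone hinv
    let P : AddSubgroup (EuclideanSpace ℝ (Fin m) × F) :=
      { carrier := {p | ∃ γ ∈ Γ, p = (π (γ v - v), φ γ)}
        zero_mem' := ⟨1, Γ.one_mem, by rw [hAone, hone]; rfl⟩
        add_mem' := by
          rintro _ _ ⟨γ, hγ, rfl⟩ ⟨δ, hδ, rfl⟩
          exact ⟨γ * δ, Γ.mul_mem hγ hδ, by rw [hAmul γ hγ δ hδ, hmul γ hγ δ hδ]; rfl⟩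
        neg_mem' := by
          rintro _ ⟨γ, hγ, rfl⟩
          exact ⟨γ⁻¹, Γ.inv_mem hγ, by rw [hAinv γ hγ, hinv γ hγ]; rfl⟩ }
    obtain ⟨K, hK0, hK⟩ := exists_linear_growth P (fun R => by
      obtain ⟨K, hK⟩ := ((hfinR R).image fun γ => ‖φ γ‖).bddAbove
      exact ⟨K, by rintro _ ⟨γ, hγ, rfl⟩ hR; exact hK ⟨γ, ⟨hγ, hR⟩, rfl⟩⟩)
    exact ⟨K, hK0, fun γ hγ => hK _ ⟨γ, hγ, rfl⟩⟩
  obtain ⟨K₁, hK₁0, hK₁⟩ := hgrowth (fun γ => π (y γ)) hYmul (by rw [hY1, map_zero]) hYinv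
  -- the height is a quadratic function
  set θ : (E ≃ᵃ[ℝ] E) → ℝ := fun γ => ℓ f (γ v - v) with hθ
  set β : (E ≃ᵃ[ℝ] E) → (E ≃ᵃ[ℝ] E) → ℝ := fun γ δ => ℓ (y γ) (δ v - v) with hβ
  have hθmul : ∀ γ ∈ Γ, ∀ δ ∈ Γ, θ (γ * δ) = θ γ + θ δ + β γ δ := by
    intro γ hγ δ hδ
    have h1 : ℓ f (γ.linear (δ v - v)) = ℓ ((γ⁻¹).linear f) (δ v - v) := by
      have := (hU.fixing γ hγ).1 ((γ⁻¹).linear f) (δ v - v)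
      rwa [linear_apply_inv] at this
    have h2 : ℓ ((γ⁻¹).linear f - f) (δ v - v) =
        ℓ ((γ⁻¹).linear f) (δ v - v) - ℓ f (δ v - v) := by
      rw [map_sub ℓ, LinearMap.sub_apply]
    change ℓ f ((γ * δ) v - v) =
      ℓ f (γ v - v) + ℓ f (δ v - v) + ℓ ((γ⁻¹).linear f - f) (δ v - v)
    rw [displacement_mul, map_add, h1, h2]; ring
  have hcomm : ∀ γ ∈ Γ, ∀ δ ∈ Γ, γ * δ = δ * γ := fun γ hγ δ hδ =>
    hU.mul_comm hℓ hnull.ge hne hsp hγ hδ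
  -- The form `β` is the defect of additivity of the height `θ`; commutativity of `Γ` makes it
  -- symmetric. Being also biadditive, it is removed by half of its diagonal.
  have hβsymm : ∀ γ ∈ Γ, ∀ δ ∈ Γ, β γ δ = β δ γ := by
    intro γ hγ δ hδ
    have h1 := hθmul γ hγ δ hδ
    rw [hcomm γ hγ δ hδ, hθmul δ hδ γ hγ] at h1
    linarith
  have hℓπ : ∀ x x' z, ℓ ξ x = 0 → ℓ ξ x' = 0 → ℓ ξ z = 0 → π x = π x' → ℓ z x = ℓ z x' := by
    intro x x' z hx hx' hz hxx'
    have hd : ℓ ξ (x - x') = 0 := by rw [map_sub, hx, hx', sub_self]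
    have hd' : π (x - x') = 0 := by rw [map_sub, hxx', sub_self]
    have h1 := hS.inner_eq hℓ.1 hz hd
    rw [hd', norm_zero, mul_zero] at h1
    have h2 := abs_nonpos_iff.mp h1
    rwa [map_sub, sub_eq_zero] at h2
  have hβmul : ∀ γ ∈ Γ, ∀ δ ∈ Γ, ∀ η ∈ Γ, β γ (δ * η) = β γ δ + β γ η := by
    intro γ hγ δ hδ η hη
    simp only [hβ]
    rw [← map_add]
    refine hℓπ _ _ _ (hχ _ (Γ.mul_mem hδ hη) v) (by rw [map_add, hχ δ hδ, hχ η hη, add_zero])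
      (hyξ γ hγ) (by rw [hAmul δ hδ η hη, map_add])
  have hμmul : ∀ γ ∈ Γ, ∀ δ ∈ Γ, θ (γ * δ) - 1 / 2 * β (γ * δ) (γ * δ) =
      (θ γ - 1 / 2 * β γ γ) + (θ δ - 1 / 2 * β δ δ) := by
    intro γ hγ δ hδ
    have hγδ := Γ.mul_mem hγ hδ
    rw [hβmul _ hγδ γ hγ δ hδ, hβsymm _ hγδ γ hγ, hβsymm _ hγδ δ hδ, hβmul γ hγ γ hγ δ hδ,
      hβmul δ hδ γ hγ δ hδ, hβsymm δ hδ γ hγ, hθmul γ hγ δ hδ]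
    ring
  have hμone : θ 1 - 1 / 2 * β 1 1 = 0 := by simp [hθ, hβ]
  obtain ⟨K₂, hK₂0, hK₂⟩ := hgrowth (fun γ => θ γ - 1 / 2 * β γ γ) hμmul hμone (by
    intro γ hγ
    have := hμmul γ hγ γ⁻¹ (Γ.inv_mem hγ)
    rw [mul_inv_cancel, hμone] at this
    linarith)
  -- Both the shear and `θ - β / 2` grow linearly, so the height grows at most quadratically in the
  -- screen part, whose square is exactly minus the square of the displacement.
  have hθb : ∀ γ ∈ Γ, |θ γ| ≤ (2 * K₂ + 2 * K₁) * (1 + ‖π (γ v - v)‖ ^ 2) := by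
    intro γ hγ
    have h1 := hK₂ γ hγ
    have h2 := hK₁ γ hγ
    have h3 := hS.inner_eq hℓ.1 (hyξ γ hγ) (hχ γ hγ v)
    rw [Real.norm_eq_abs] at h1
    set A := ‖π (γ v - v)‖
    have hA0 : 0 ≤ A := norm_nonneg _
    have h4 : |β γ γ| ≤ K₁ * (1 + A) * A := h3.trans (mul_le_mul_of_nonneg_right h2 hA0)
    have h5 : |θ γ| ≤ |θ γ - 1 / 2 * β γ γ| + 1 / 2 * |β γ γ| := by
      have := abs_add_le (θ γ - 1 / 2 * β γ γ) (1 / 2 * β γ γ)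
      rw [sub_add_cancel, abs_mul (1 / 2) (β γ γ), abs_of_pos (show (0 : ℝ) < 1 / 2 by norm_num)]
        at this
      exact this
    have h6 : 1 + A ≤ 2 * (1 + A ^ 2) := by nlinarith [sq_nonneg (A - 1)]
    have h7 : (1 + A) * A ≤ 2 * (1 + A ^ 2) := by nlinarith [sq_nonneg (A - 1)]
    have h8 := mul_le_mul_of_nonneg_left h6 hK₂0
    have h9 := mul_le_mul_of_nonneg_left h7 hK₁0
    have h10 : 0 ≤ K₁ * (1 + A ^ 2) := by positivity
    linarith
  refine ⟨(‖σ'‖ + B * ‖f‖ * ‖σ'‖ * ‖ξ‖) + ‖ξ‖ * (2 * K₂ + 2 * K₁), fun γ hγ => ?_⟩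
  have h1 := hctrl γ hγ
  have h2 := mul_le_mul_of_nonneg_left (hθb γ hγ) (norm_nonneg ξ)
  have h3 : 1 - ℓ (γ v - v) (γ v - v) = 1 + ‖π (γ v - v)‖ ^ 2 := by rw [hA γ hγ]; ring
  rw [h3]
  set A := ‖π (γ v - v)‖
  have h4 : A ≤ 1 + A ^ 2 := by nlinarith [sq_nonneg (A - 1)]
  have h5 := mul_le_mul_of_nonneg_left h4
    (show 0 ≤ ‖σ'‖ + B * ‖f‖ * ‖σ'‖ * ‖ξ‖ by positivity)
  rw [add_mul, mul_assoc ‖ξ‖]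
  exact h1.trans (add_le_add h5 h2)

/-- A unipotent group without returns has locally finite cones. -/
theorem locallyFiniteCones_of_noReturn (hℓ : IsLorentzian ℓ) (hC : IsTimeCone ℓ C)
    (hfin : HasFiniteDisplacements Γ) (hsp : HasSpacelikeDisplacements ℓ Γ)
    (hret : NoReturn C Γ) (hret' : NoReturn (-C) Γ) (hξC : ξ ∈ C) (hne : ξ ≠ 0)
    (hU : IsUnipotentOn ℓ ξ Γ 0 ⊤) : LocallyFiniteCones ℓ Γ := by
  have hξ : 0 ≤ ℓ ξ ξ := hC.nonneg hξC
  have hU' : ∀ o, IsUnipotentOn ℓ ξ Γ o ⊤ := fun o =>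
    ⟨hU.fixing, fun _ _ => trivial, fun _ _ _ _ => trivial, hU.trivial_mod⟩
  -- The group consists of translations if some displacement is not orthogonal to `ξ` or if `ξ` is
  -- timelike. The remaining case has `ξ` null and all displacements in `ξ^⊥`.
  by_cases h1 : ∃ v, ∃ γ ∈ Γ, ℓ ξ (γ v - v) ≠ 0
  · obtain ⟨v, γ₀, hγ₀, hχ⟩ := h1
    exact locallyFiniteCones_of_translations hℓ hC hfin hsp hret fun γ hγ w =>
      (hU' v).linear_eq hℓ hξ hne hsp hγ₀ hχ hγ trivial
  push Not at h1
  rcases hξ.lt_or_eq with hpos | hnull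
  · refine locallyFiniteCones_of_translations hℓ hC hfin hsp hret fun γ hγ w =>
      (hU.fixing γ hγ).eq_self_of_trivial hℓ hξ hne (hU.linear_mem γ hγ) (fun w hw hw0 => ?_)
        trivial
    obtain ⟨a, ha⟩ := hU.trivial_mod γ hγ w hw hw0
    have ha0 := (mul_eq_zero.mp ((hU.fixing γ hγ).smul_null ha)).resolve_right hpos.ne'
    rw [ha, ha0, zero_smul, add_zero]
  · exact locallyFiniteCones_of_not_translations hℓ hC hfin hsp hret hret' hξC hne hnull.symm hU
      fun γ hγ v => h1 v γ hγ

end LocallyFinite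
end FlatLorentz

namespace FlatLorentz

/-! ### The quotient map, futures and discreteness. -/

section Quotient

variable {E : Type*} [NormedAddCommGroup E] [NormedSpace ℝ E]
  {ℓ : LinearMap.BilinForm ℝ E} {C : Set E} {Γ Δ : Subgroup (E ≃ᵃ[ℝ] E)}

theorem proj_eq_iff {v w : E} : proj Γ v = proj Γ w ↔ ∃ γ ∈ Γ, γ w = v := by
  unfold proj
  rw [Quotient.eq, MulAction.orbitRel_apply]
  exact ⟨fun ⟨γ, h⟩ => ⟨γ, γ.2, h⟩, fun ⟨γ, hγ, h⟩ => ⟨⟨γ, hγ⟩, h⟩⟩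

theorem proj_apply {γ : E ≃ᵃ[ℝ] E} (hγ : γ ∈ Γ) (v : E) : proj Γ (γ v) = proj Γ v :=
  proj_eq_iff.mpr ⟨γ, hγ, rfl⟩

theorem proj_surjective (p : QuotientSpace Γ) : ∃ v, proj Γ v = p := Quotient.exists_rep p

theorem continuous_proj : Continuous (proj Γ) := continuous_quotient_mk'

theorem past_eq_future_neg (C : Set E) (Γ : Subgroup (E ≃ᵃ[ℝ] E)) (p : QuotientSpace Γ) :
    past C Γ p = future (-C) Γ p := by
  ext q
  constructor
  · rintro ⟨v, hv, c, hc, rfl⟩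
    exact ⟨v, hv, -c, by simpa using hc, by rw [sub_eq_add_neg]⟩
  · rintro ⟨v, hv, c, hc, rfl⟩
    exact ⟨v, hv, -c, hc, by rw [sub_neg_eq_add]⟩

theorem proj_mem_future_iff (hcone : ∀ γ ∈ Γ, ∀ v ∈ C, γ.linear v ∈ C) {v z : E} :
    proj Γ z ∈ future C Γ (proj Γ v) ↔ ∃ γ ∈ Γ, z - γ v ∈ C := by
  constructor
  · rintro ⟨w, hw, c, hc, h⟩
    obtain ⟨γ, hγ, rfl⟩ := proj_eq_iff.mp hw
    obtain ⟨δ, hδ, rfl⟩ := proj_eq_iff.mp h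
    refine ⟨δ * γ, Γ.mul_mem hδ hγ, ?_⟩
    have : δ (γ v + c) - (δ * γ) v = δ.linear c := by
      rw [affine_apply]
      exact add_sub_cancel_left _ _
    rw [this]
    exact hcone δ hδ c hc
  · rintro ⟨γ, hγ, h⟩
    exact ⟨γ v, proj_apply hγ v, _, h, by rw [add_sub_cancel]⟩

theorem IsFlatSpacetime.linear_mem (h : IsFlatSpacetime ℓ C Γ) :
    ∀ γ ∈ Γ, ∀ v ∈ C, γ.linear v ∈ C :=
  fun γ hγ _ hv => h.cone γ hγ ▸ Set.mem_image_of_mem _ hv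

theorem IsFlatSpacetime.linear_mem_neg (h : IsFlatSpacetime ℓ C Γ) :
    ∀ γ ∈ Γ, ∀ v ∈ -C, γ.linear v ∈ -C := fun γ hγ _ hv => by
  rw [Set.mem_neg, ← map_neg]
  exact h.linear_mem γ hγ _ hv

theorem hasFiniteDisplacements_of_properlyDiscontinuous [FiniteDimensional ℝ E]
    (h : ProperlyDiscontinuousSMul Γ E) : HasFiniteDisplacements Γ := by
  intro v R
  have : ProperSpace E := FiniteDimensional.proper ℝ E
  have h1 := h.finite_disjoint_inter_image (isCompact_singleton (x := v))
    (isCompact_closedBall v R)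
  refine (h1.image Subtype.val).subset ?_
  rintro γ ⟨hγ, hR⟩
  refine ⟨⟨γ, hγ⟩, ⟨γ v, ⟨v, rfl, rfl⟩, ?_⟩, rfl⟩
  rwa [Metric.mem_closedBall, dist_eq_norm]

theorem HasFiniteDisplacements.exists_discrete (h : HasFiniteDisplacements Γ)
    (hfree : ∀ γ ∈ Γ, ∀ v, γ v = v → γ = 1) (v : E) :
    ∃ ε : ℝ, 0 < ε ∧ ∀ γ ∈ Γ, ‖γ v - v‖ < ε → γ = 1 := by
  have hfin := h v 1
  have hfin' := (hfin.subset (Set.sdiff_subset (t := {1}))).image (fun γ => ‖γ v - v‖)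
  rcases (((fun γ : E ≃ᵃ[ℝ] E => ‖γ v - v‖) ''
    ({γ | γ ∈ Γ ∧ ‖γ v - v‖ ≤ 1} \ {1}))).eq_empty_or_nonempty with he | hne
  · refine ⟨1, one_pos, fun γ hγ hlt => ?_⟩
    by_contra hγ1
    have := Set.image_eq_empty.mp he
    exact (Set.ext_iff.mp this γ).mp ⟨⟨hγ, hlt.le⟩, hγ1⟩
  · obtain ⟨_, ⟨δ, ⟨⟨hδ, -⟩, hδ1⟩, rfl⟩, hmin⟩ := hfin'.exists_minimal hne
    have hpos : 0 < ‖δ v - v‖ := norm_pos_iff.mpr fun h0 => hδ1 (hfree δ hδ v (sub_eq_zero.mp h0))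
    refine ⟨min 1 ‖δ v - v‖, lt_min one_pos hpos, fun γ hγ hlt => ?_⟩
    by_contra hγ1
    have h1 := hmin ⟨γ, ⟨⟨hγ, (hlt.trans_le (min_le_left _ _)).le⟩, hγ1⟩, rfl⟩
      (hlt.trans_le (min_le_right _ _)).le
    exact absurd (hlt.trans_le (min_le_right _ _)) (not_lt.mpr h1)

end Quotient

/-! ### Causality, strict causality and finite coverings in terms of the group. -/

section Causality

variable {E : Type*} [NormedAddCommGroup E] [NormedSpace ℝ E]
  {ℓ : LinearMap.BilinForm ℝ E} {C : Set E} {Γ Δ : Subgroup (E ≃ᵃ[ℝ] E)}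

/-- The segment from `v` to `γ v` would project to a closed timelike path. Causality makes it
constant, which puts infinitely many points of a bounded segment into one orbit. -/
theorem IsCausal.displacement_notMem (hc : IsCausal C Γ) (hfin : HasFiniteDisplacements Γ)
    (hfree : ∀ γ ∈ Γ, ∀ v, γ v = v → γ = 1) {γ : E ≃ᵃ[ℝ] E} (hγ : γ ∈ Γ) (hne : γ ≠ 1) (v : E) :
    γ v - v ∉ C := by
  intro hmem
  set d := γ v - v with hd
  have hd0 : d ≠ 0 := fun h => hne (hfree γ hγ v (sub_eq_zero.mp h))
  let η : Path (proj Γ v) (proj Γ v) :=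
    { toFun := fun s => proj Γ (v + (s : ℝ) • d)
      continuous_toFun := continuous_proj.comp (by fun_prop)
      source' := by simp
      target' := by simp [hd, proj_apply hγ] }
  have hη : IsTimelikePath C Γ η := by
    refine ⟨1, fun i => (i : ℝ), Nat.strictMono_cast, by simp, by simp, fun i hi t _ => ?_⟩
    obtain rfl : i = 0 := by omega
    refine ⟨fun s => v + s • d, by fun_prop, ?_⟩
    filter_upwards [self_mem_nhdsWithin] with s hs
    have hs' : s ∈ Set.Icc (0 : ℝ) 1 := by simpa using hs
    refine ⟨?_, ?_⟩
    · rw [Path.extend_apply _ hs']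
      rfl
    · have : HasDerivAt (fun s : ℝ => v + s • d) ((1 : ℝ) • d) s :=
        ((hasDerivAt_id s).smul_const d).const_add v
      rw [this.deriv, one_smul]
      exact hmem
  have h1 := hc _ η hη
  have h2 : ∀ s ∈ Set.Icc (0 : ℝ) 1, ∃ δ ∈ Γ, δ v = v + s • d := fun s hs =>
    proj_eq_iff.mp (h1 ⟨s, hs⟩)
  refine (Set.Icc_infinite (zero_lt_one' ℝ)) ?_
  have h3 : (fun s : ℝ => v + s • d) '' Set.Icc 0 1 ⊆
      (fun δ : E ≃ᵃ[ℝ] E => δ v) '' {δ | δ ∈ Γ ∧ ‖δ v - v‖ ≤ ‖d‖} := by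
    rintro _ ⟨s, hs, rfl⟩
    obtain ⟨δ, hδ, e⟩ := h2 s hs
    refine ⟨δ, ⟨hδ, ?_⟩, e⟩
    rw [e, add_sub_cancel_left, norm_smul, Real.norm_of_nonneg hs.1]
    exact mul_le_of_le_one_left (norm_nonneg _) hs.2
  refine Set.Finite.of_finite_image (((hfin v ‖d‖).image _).subset h3) ?_
  intro s _ s' _ h
  exact smul_left_injective ℝ hd0 (add_left_cancel h)

/-- A smooth curve whose velocity lies in the cone moves into the cone. -/
theorem IsTimeCone.sub_mem_of_deriv_mem [FiniteDimensional ℝ E]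
    (hC : IsTimeCone ℓ C) (hℓ : IsLorentzian ℓ) {c : ℝ → E}
    (hc : Differentiable ℝ c) {a b : ℝ} (hab : a ≤ b) (hd : ∀ s ∈ Set.Icc a b, deriv c s ∈ C) :
    c b - c a ∈ C := by
  by_contra hnot
  -- A functional separating a point from a closed convex cone is nonnegative on the cone, so it is
  -- monotone along the curve.
  obtain ⟨f, u, hfu, hu⟩ := geometric_hahn_banach_point_closed (hC.convex hℓ) hC.isClosed hnot
  have hu0 : u < 0 := by simpa using hu 0 hC.zero_mem
  have hf : ∀ x ∈ C, 0 ≤ f x := by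
    intro x hx
    by_contra! hneg
    have h1 := hu _ (hC.smul_mem hx (t := u / f x) (div_nonneg_of_nonpos hu0.le hneg.le))
    rw [map_smul, smul_eq_mul, div_mul_cancel₀ _ hneg.ne] at h1
    exact lt_irrefl _ h1
  have hfc : ∀ s, HasDerivAt (fun s => f (c s)) (f (deriv c s)) s := fun s =>
    f.hasFDerivAt.comp_hasDerivAt s (hc s).hasDerivAt
  have hmono : MonotoneOn (fun s => f (c s)) (Set.Icc a b) := by
    refine monotoneOn_of_deriv_nonneg (convex_Icc a b)
      (fun s _ => (hfc s).continuousAt.continuousWithinAt)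
      (fun s _ => (hfc s).differentiableAt.differentiableWithinAt) fun s hs => ?_
    rw [(hfc s).deriv]
    exact hf _ (hd s (interior_subset hs))
  have h2 := hmono (Set.left_mem_Icc.mpr hab) (Set.right_mem_Icc.mpr hab) hab
  simp only at h2
  rw [map_sub] at hfu
  linarith

/-- Along the path `η`, every lift of `η s` can be moved into the future to a lift of `η s'`. -/
def Reaches (C : Set E) (Γ : Subgroup (E ≃ᵃ[ℝ] E)) (η : ℝ → QuotientSpace Γ) (s s' : ℝ) : Prop :=
  ∀ v, proj Γ v = η s → ∃ v', proj Γ v' = η s' ∧ v' - v ∈ C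

theorem Reaches.refl (hC : IsTimeCone ℓ C) (η : ℝ → QuotientSpace Γ) (s : ℝ) :
    Reaches C Γ η s s := fun v hv => ⟨v, hv, by rw [sub_self]; exact hC.zero_mem⟩

theorem Reaches.trans (hC : IsTimeCone ℓ C) (hℓ : IsLorentzian ℓ) {η : ℝ → QuotientSpace Γ}
    {s s' s'' : ℝ} (h : Reaches C Γ η s s') (h' : Reaches C Γ η s' s'') :
    Reaches C Γ η s s'' := by
  intro v hv
  obtain ⟨v', hv', hm⟩ := h v hv
  obtain ⟨v'', hv'', hm'⟩ := h' v' hv'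
  refine ⟨v'', hv'', ?_⟩
  rw [← sub_add_sub_cancel v'' v' v]
  exact hC.add_mem hℓ hm' hm

/-- Local lifts need not match at their ends, but `Γ` preserves the cone, so each can be moved to
start at a prescribed lift. A finite subdivision then chains the local steps. -/
theorem IsTimelikeArc.reaches [FiniteDimensional ℝ E] (hC : IsTimeCone ℓ C) (hℓ : IsLorentzian ℓ)
    (hcone : ∀ γ ∈ Γ, ∀ v ∈ C, γ.linear v ∈ C) {η : ℝ → QuotientSpace Γ} {a b : ℝ}
    (h : IsTimelikeArc C Γ η a b) {s s' : ℝ} (hs : a ≤ s) (hss' : s ≤ s') (hs' : s' ≤ b) :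
    Reaches C Γ η s s' := by
  have hlocal : ∀ t ∈ Set.Icc s s', ∃ ε : ℝ, 0 < ε ∧ ∀ x ∈ Set.Icc s s' ∩ Metric.ball t ε,
      ∀ y ∈ Set.Icc s s' ∩ Metric.ball t ε, x ≤ y → Reaches C Γ η x y := by
    intro t ht
    obtain ⟨c, hc, hev⟩ := h t ⟨hs.trans ht.1, ht.2.trans hs'⟩
    obtain ⟨ε, hε, hball⟩ := Metric.mem_nhdsWithin_iff.mp hev
    refine ⟨ε, hε, fun x hx y hy hxy v hv => ?_⟩
    have hsub : Set.Icc x y ⊆ Metric.ball t ε ∩ Set.Icc a b := fun z hz =>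
      ⟨(convex_ball t ε).ordConnected.out hx.2 hy.2 hz,
        hs.trans (hx.1.1.trans hz.1), hz.2.trans (hy.1.2.trans hs')⟩
    have hx' := hball (hsub (Set.left_mem_Icc.mpr hxy))
    have hy' := hball (hsub (Set.right_mem_Icc.mpr hxy))
    obtain ⟨γ, hγ, rfl⟩ := proj_eq_iff.mp (hv.trans hx'.1.symm)
    refine ⟨γ (c y), (proj_apply hγ _).trans hy'.1, ?_⟩
    have e : γ (c y) - γ (c x) = γ.linear (c y - c x) := by
      have := affine_apply γ (c x) (c y - c x)
      rw [add_sub_cancel] at this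
      rw [this, add_sub_cancel_left]
    rw [e]
    exact hcone γ hγ _ (hC.sub_mem_of_deriv_mem hℓ (hc.differentiable (by simp)) hxy
      fun z hz => (hball (hsub hz)).2)
  choose! ε hε hreach using hlocal
  obtain ⟨t, ht0, htm, ⟨m, hm⟩, hsub⟩ := exists_monotone_Icc_subset_open_cover_Icc hss'
    (c := fun i : Set.Icc s s' => Subtype.val ⁻¹' Metric.ball (i : ℝ) (ε i))
    (fun i => Metric.isOpen_ball.preimage continuous_subtype_val)
    (fun x _ => Set.mem_iUnion.mpr ⟨x, Metric.mem_ball_self (hε x x.2)⟩)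
  have hind : ∀ n, Reaches C Γ η s (t n) := by
    intro n
    induction n with
    | zero => rw [ht0]; exact Reaches.refl hC η s
    | succ n ih =>
      obtain ⟨i, hi⟩ := hsub n
      have hle : t n ≤ t (n + 1) := htm n.le_succ
      exact ih.trans hC hℓ (hreach i i.2 _ ⟨(t n).2, hi (Set.left_mem_Icc.mpr hle)⟩ _
        ⟨(t (n + 1)).2, hi (Set.right_mem_Icc.mpr hle)⟩ hle)
  have := hind m
  rwa [hm m le_rfl] at this

/-- Following lifts round a closed path gives `γ v - v ∈ C`, so `γ = 1`. Then an intermediate lift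
is both in the future and in the past of `v`, hence equal to `v`. -/
theorem isCausal_of_displacement_notMem [FiniteDimensional ℝ E]
    (hC : IsTimeCone ℓ C) (hℓ : IsLorentzian ℓ)
    (hcone : ∀ γ ∈ Γ, ∀ v ∈ C, γ.linear v ∈ C)
    (hdis : ∀ γ ∈ Γ, γ ≠ 1 → ∀ v, γ v - v ∉ C) : IsCausal C Γ := by
  intro p η ⟨n, t, htm, ht0, htn, harc⟩ s
  have hreach : ∀ i ≤ n, ∀ x y, 0 ≤ x → x ≤ y → y ≤ t i → Reaches C Γ η.extend x y := by
    intro i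
    induction i with
    | zero =>
      intro _ x y hx hxy hy
      rw [ht0] at hy
      obtain rfl : x = y := by linarith
      exact Reaches.refl hC _ _
    | succ i ih =>
      intro hi x y hx hxy hy
      have hi' : i < n := hi
      rcases le_total y (t i) with h | h
      · exact ih hi'.le x y hx hxy h
      · rcases le_total (t i) x with h' | h'
        · exact (harc i hi').reaches hC hℓ hcone h' hxy hy
        · exact (ih hi'.le x (t i) hx h' le_rfl).trans hC hℓ
            ((harc i hi').reaches hC hℓ hcone le_rfl h hy)
  obtain ⟨v, hv⟩ := proj_surjective p
  obtain ⟨v', hv', h1⟩ := hreach n le_rfl 0 s le_rfl s.2.1 (htn ▸ s.2.2) v (by simp [hv])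
  obtain ⟨v'', hv'', h2⟩ := hreach n le_rfl s 1 s.2.1 s.2.2 htn.ge v' hv'
  rw [Path.extend_one, ← hv] at hv''
  obtain ⟨γ, hγ, rfl⟩ := proj_eq_iff.mp hv''
  have h3 : γ = 1 := by
    by_contra hne
    refine hdis γ hγ hne v ?_
    rw [← sub_add_sub_cancel _ v' v]
    exact hC.add_mem hℓ h2 h1
  subst h3
  have h4 : v' - v = 0 := hC.eq_zero hℓ h1 (by rw [neg_sub]; exact h2)
  rw [sub_eq_zero.mp h4, hv] at hv'
  have := Path.extend_apply η s.2
  exact this.symm.trans hv'.symm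

theorem displacement_notMem_neg
    (hdis : ∀ γ ∈ Γ, γ ≠ 1 → ∀ v, γ v - v ∉ C) : ∀ γ ∈ Γ, γ ≠ 1 → ∀ v, γ v - v ∉ -C := by
  intro γ hγ hne v hmem
  refine hdis γ⁻¹ (Γ.inv_mem hγ) (inv_ne_one.mpr hne) (γ v) ?_
  have : (γ⁻¹) (γ v) = v := γ.symm_apply_apply v
  rw [this, ← neg_sub]
  exact hmem

theorem hasSpacelikeDisplacements_of_notMem (hC : IsTimeCone ℓ C)
    (hdis : ∀ γ ∈ Γ, γ ≠ 1 → ∀ v, γ v - v ∉ C) : HasSpacelikeDisplacements ℓ Γ := by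
  intro γ hγ hne v
  by_contra! h
  rcases hC.mem_or_neg_mem h with h | h
  · exact hdis γ hγ hne v h
  · exact displacement_notMem_neg hdis γ hγ hne v h

/-- In the absence of causal displacements the linear parts move no vector into the interior of
the cone. -/
theorem HasSpacelikeDisplacements.linear_nonpos (hsp : HasSpacelikeDisplacements ℓ Γ)
    (hs : ∀ v w, ℓ v w = ℓ w v) {γ : E ≃ᵃ[ℝ] E} (hγ : γ ∈ Γ) (v : E) :
    ℓ (γ.linear v - v) (γ.linear v - v) ≤ 0 := by
  by_contra! hpos
  have hne : γ ≠ 1 := by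
    rintro rfl
    have : (1 : E ≃ᵃ[ℝ] E).linear v = v := rfl
    simp [this] at hpos
  -- Far along the direction `v` the displacement is dominated by `s • (γ.linear v - v)` and would
  -- become timelike.
  obtain ⟨s, -, h⟩ := exists_nonneg_smul_add hs hpos (γ 0 - 0)
  have h1 := affine_apply_sub γ 0 (s • v)
  rw [map_smul, ← smul_sub, zero_add, add_comm] at h1
  have h2 := hsp γ hγ hne (s • v)
  rw [h1] at h2
  exact absurd h2 h.le.not_gt

theorem IsStrictlyCausal.displacement_notMem [FiniteDimensional ℝ E] (h : IsStrictlyCausal ℓ C Γ) :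
    ∀ γ ∈ Γ, γ ≠ 1 → ∀ v, γ v - v ∉ C := fun _ hγ hne v =>
  h.causal.displacement_notMem (hasFiniteDisplacements_of_properlyDiscontinuous h.proper)
    h.free hγ hne v

theorem IsStrictlyCausal.hasSpacelikeDisplacements [FiniteDimensional ℝ E]
    (h : IsStrictlyCausal ℓ C Γ)
    (hC : IsTimeCone ℓ C) : HasSpacelikeDisplacements ℓ Γ :=
  hasSpacelikeDisplacements_of_notMem hC h.displacement_notMem

/-- For small `t` the image of `v - t • c` lies in the neighbourhood where the future is closed, so
a limit of future points is a future point. Then `v - γ v ∈ C`, which is excluded for `γ ≠ 1`; and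
`γ = 1` would give `-(t • c) ∈ C`. -/
theorem noReturn_of_isClosed (hC : IsTimeCone ℓ C) (hℓ : IsLorentzian ℓ)
    (hcone : ∀ γ ∈ Γ, ∀ v ∈ C, γ.linear v ∈ C) (hdis : ∀ γ ∈ Γ, γ ≠ 1 → ∀ v, γ v - v ∉ -C)
    (hclosed : ∀ p : QuotientSpace Γ, ∃ U ∈ 𝓝 p, IsClosed ((↑) ⁻¹' future C Γ p : Set U)) :
    NoReturn C Γ := by
  intro v c hc hc0
  obtain ⟨U, hU, hclU⟩ := hclosed (proj Γ v)
  have hcont : Filter.Tendsto (fun t : ℝ => proj Γ (v - t • c)) (𝓝[>] 0) (𝓝 (proj Γ v)) := by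
    have : Continuous fun t : ℝ => proj Γ (v - t • c) := continuous_proj.comp (by fun_prop)
    have h := this.tendsto 0
    rw [zero_smul, sub_zero] at h
    exact h.mono_left nhdsWithin_le_nhds
  obtain ⟨t, htU, ht⟩ := ((hcont.eventually (interior_mem_nhds.mpr hU)).and
    self_mem_nhdsWithin).exists
  refine ⟨t, ht, fun hmem => ?_⟩
  have hset : {z | ∃ γ ∈ Γ, z - γ v ∈ C} = proj Γ ⁻¹' future C Γ (proj Γ v) := by
    ext z
    exact (proj_mem_future_iff hcone).symm
  rw [hset] at hmem
  have h1 : proj Γ (v - t • c) ∈ closure (future C Γ (proj Γ v)) :=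
    closure_mono (Set.image_preimage_subset _ _)
      (mem_closure_image continuous_proj.continuousAt hmem)
  have h2 : proj Γ (v - t • c) ∈ closure (U ∩ future C Γ (proj Γ v)) := by
    rw [mem_closure_iff_nhds] at h1 ⊢
    intro W hW
    obtain ⟨x, hx⟩ := h1 _ (Filter.inter_mem hW (mem_interior_iff_mem_nhds.mp htU))
    exact ⟨x, hx.1.1, hx.1.2, hx.2⟩
  have h3 : proj Γ (v - t • c) ∈ future C Γ (proj Γ v) := by
    have h4 : (⟨_, interior_subset htU⟩ : U) ∈ closure ((↑) ⁻¹' future C Γ (proj Γ v) : Set U) := by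
      rw [closure_subtype, Subtype.image_preimage_coe]
      exact h2
    rwa [hclU.closure_eq] at h4
  obtain ⟨γ, hγ, h5⟩ := (proj_mem_future_iff hcone).mp h3
  have htc : t • c ∈ C := hC.smul_mem hc (le_of_lt ht)
  by_cases h6 : γ = 1
  · subst h6
    have h7 : v - t • c - v = -(t • c) := by abel
    have h8 : -(t • c) ∈ C := h7 ▸ h5
    exact hc0 ((smul_eq_zero.mp (hC.eq_zero hℓ htc h8)).resolve_left (ne_of_gt ht))
  · refine hdis γ hγ h6 v ?_
    rw [Set.mem_neg, neg_sub]
    have h7 := hC.add_mem hℓ h5 htc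
    rwa [sub_right_comm, sub_add_cancel] at h7

theorem IsStrictlyCausal.noReturn [FiniteDimensional ℝ E]
    (h : IsStrictlyCausal ℓ C Γ) (hC : IsTimeCone ℓ C)
    (hℓ : IsLorentzian ℓ) : NoReturn C Γ ∧ NoReturn (-C) Γ := by
  constructor
  · refine noReturn_of_isClosed hC hℓ h.linear_mem
      (displacement_notMem_neg h.displacement_notMem) fun p => ?_
    obtain ⟨U, hU, h1, -⟩ := h.locallyClosed p
    exact ⟨U, hU, h1⟩
  · refine noReturn_of_isClosed hC.neg hℓ h.linear_mem_neg ?_ fun p => ?_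
    · rw [neg_neg]
      exact h.displacement_notMem
    · obtain ⟨U, hU, -, h1⟩ := h.locallyClosed p
      rw [past_eq_future_neg] at h1
      exact ⟨U, hU, h1⟩

theorem continuousConstSMul_subgroup [FiniteDimensional ℝ E]
    (Γ : Subgroup (E ≃ᵃ[ℝ] E)) : ContinuousConstSMul Γ E :=
  ⟨fun γ => γ.1.continuous_of_finiteDimensional⟩

theorem isOpenMap_proj [FiniteDimensional ℝ E] : IsOpenMap (proj Γ) :=
  have := continuousConstSMul_subgroup Γ
  (MulAction.isOpenQuotientMap_quotientMk (Γ := Γ) (T := E)).isOpenMap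

/-- Near `v` only finitely many cones with vertices in the orbit matter, and a finite union of
closed cones is closed. -/
theorem LocallyFiniteCones.exists_isClosed_future [FiniteDimensional ℝ E]
    (hlf : LocallyFiniteCones ℓ Γ)
    (hC : IsTimeCone ℓ C) (hcone : ∀ γ ∈ Γ, ∀ v ∈ C, γ.linear v ∈ C) (v : E) :
    ∃ N ∈ 𝓝 v, proj Γ '' N ∩ closure (future C Γ (proj Γ v)) ⊆ future C Γ (proj Γ v) := by
  obtain ⟨N, hN, hfin⟩ := hlf v
  refine ⟨interior N, interior_mem_nhds.mpr hN, ?_⟩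
  rintro _ ⟨⟨z, hz, rfl⟩, hcl⟩
  set S : Set (E ≃ᵃ[ℝ] E) := {γ | γ ∈ Γ ∧ ∃ z ∈ N, 0 ≤ ℓ (z - γ v) (z - γ v)} with hS
  have h1 : z ∈ closure (proj Γ ⁻¹' future C Γ (proj Γ v)) := by
    rw [← isOpenMap_proj.preimage_closure_eq_closure_preimage continuous_proj]
    exact hcl
  have h2 : z ∈ closure (⋃ γ ∈ S, {z | z - γ v ∈ C}) := by
    rw [mem_closure_iff_nhds] at h1 ⊢
    intro W hW
    obtain ⟨x, hxW, hx⟩ := h1 _ (Filter.inter_mem hW (mem_interior_iff_mem_nhds.mp hz))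
    obtain ⟨γ, hγ, hxγ⟩ := (proj_mem_future_iff hcone).mp hx
    exact ⟨x, hxW.1, Set.mem_biUnion (⟨hγ, x, hxW.2, hC.nonneg hxγ⟩ : γ ∈ S) hxγ⟩
  have hclosed : IsClosed (⋃ γ ∈ S, {z | z - γ v ∈ C}) :=
    hfin.isClosed_biUnion fun γ _ => hC.isClosed.preimage (by fun_prop)
  rw [hclosed.closure_eq] at h2
  obtain ⟨γ, hγ, hzγ⟩ := Set.mem_iUnion₂.mp h2
  exact (proj_mem_future_iff hcone).mpr ⟨γ, hγ.1, hzγ⟩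

theorem isStrictlyCausal_of_locallyFiniteCones [FiniteDimensional ℝ E]
    (hC : IsTimeCone ℓ C) (hℓ : IsLorentzian ℓ)
    (h : IsFlatSpacetime ℓ C Γ) (hsp : HasSpacelikeDisplacements ℓ Γ)
    (hlf : LocallyFiniteCones ℓ Γ) : IsStrictlyCausal ℓ C Γ := by
  refine ⟨h, isCausal_of_displacement_notMem hC hℓ h.linear_mem fun γ hγ hne v hmem =>
    absurd (hsp γ hγ hne v) (not_lt.mpr (hC.nonneg hmem)), fun p => ?_⟩
  obtain ⟨v, rfl⟩ := proj_surjective p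
  obtain ⟨N, hN, hcl⟩ := hlf.exists_isClosed_future hC h.linear_mem v
  obtain ⟨N', hN', hcl'⟩ := hlf.exists_isClosed_future hC.neg h.linear_mem_neg v
  have key : ∀ F : Set (QuotientSpace Γ), proj Γ '' (N ∩ N') ∩ closure F ⊆ F →
      IsClosed ((↑) ⁻¹' F : Set (proj Γ '' (N ∩ N'))) := by
    intro F hF
    have : ((↑) ⁻¹' F : Set (proj Γ '' (N ∩ N'))) = (↑) ⁻¹' closure F := by
      ext x
      exact ⟨fun hx => subset_closure hx, fun hx => hF ⟨x.2, hx⟩⟩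
    rw [this]
    exact isClosed_closure.preimage continuous_subtype_val
  refine ⟨proj Γ '' (N ∩ N'), isOpenMap_proj.image_mem_nhds (Filter.inter_mem hN hN'), ?_, ?_⟩
  · exact key _ ((Set.inter_subset_inter_left _ (Set.image_mono Set.inter_subset_left)).trans hcl)
  · rw [past_eq_future_neg]
    exact key _ ((Set.inter_subset_inter_left _ (Set.image_mono Set.inter_subset_right)).trans hcl')

/-- The projection is a local homeomorphism, because composing it with the covering `proj Γ` gives
the covering `proj Δ`. The finite set `F` makes it closed with finite fibres, hence a covering. -/
theorem isFiniteCover_of_finite [FiniteDimensional ℝ E] (h : IsFlatSpacetime ℓ C Δ) (hle : Γ ≤ Δ)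
    {F : Set (E ≃ᵃ[ℝ] E)} (hF : F.Finite) (hFΔ : F ⊆ Δ)
    (hcov : ∀ δ ∈ Δ, ∃ f ∈ F, f⁻¹ * δ ∈ Γ) : IsFiniteCover Γ Δ := by
  have : ProperSpace E := FiniteDimensional.proper ℝ E
  have : ContinuousConstSMul Γ E := continuousConstSMul_subgroup Γ
  have : ContinuousConstSMul Δ E := continuousConstSMul_subgroup Δ
  have hpΔ : ProperlyDiscontinuousSMul Δ E := h.proper
  have hpΓ : ProperlyDiscontinuousSMul Γ E := Subgroup.properlyDiscontinuousSMul_of_le hpΔ hle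
  have hfree : ∀ Γ' : Subgroup (E ≃ᵃ[ℝ] E), Γ' ≤ Δ → IsCancelSMul Γ' E := by
    intro Γ' hΓ'
    refine ⟨fun g g' e he => ?_⟩
    have h1 : (g'.1⁻¹ * g.1) e = e := by
      have h2 : g.1 e = g'.1 e := he
      change g'.1.symm (g.1 e) = e
      rw [h2]
      exact g'.1.symm_apply_apply e
    have h3 := h.free _ (Δ.mul_mem (Δ.inv_mem (hΓ' g'.2)) (hΓ' g.2)) e h1
    exact Subtype.ext (inv_mul_eq_one.mp h3).symm
  have := hfree Γ hle
  have := hfree Δ le_rfl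
  have hcΓ : IsCoveringMap (proj Γ) :=
    (isQuotientCoveringMap_quotientMk_of_properlyDiscontinuousSMul (E := E) (G := Γ)).isCoveringMap
  have hcΔ : IsCoveringMap (proj Δ) :=
    (isQuotientCoveringMap_quotientMk_of_properlyDiscontinuousSMul (E := E) (G := Δ)).isCoveringMap
  let π : QuotientSpace Γ → QuotientSpace Δ := Quotient.lift (proj Δ) (by
    intro v w hvw
    obtain ⟨γ, hγ, e⟩ := proj_eq_iff.mp (Quotient.sound hvw : proj Γ v = proj Γ w)
    exact proj_eq_iff.mpr ⟨γ, hle hγ, e⟩)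
  have hπ : ∀ v, π (proj Γ v) = proj Δ v := fun v => rfl
  have hfib : ∀ q, (π ⁻¹' {q}).Finite := by
    intro q
    obtain ⟨v, rfl⟩ := proj_surjective q
    refine (hF.image fun f => proj Γ (f⁻¹ v)).subset ?_
    intro p hp
    obtain ⟨w, rfl⟩ := proj_surjective p
    obtain ⟨δ, hδ, rfl⟩ := proj_eq_iff.mp (hp : proj Δ w = proj Δ v)
    obtain ⟨f, hf, hfδ⟩ := hcov δ⁻¹ (Δ.inv_mem hδ)
    rw [← mul_inv_rev] at hfδ
    refine ⟨f, hf, ?_⟩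
    change proj Γ (f⁻¹ v) = _
    rw [← proj_apply ((Γ.inv_mem_iff).mp hfδ) (f⁻¹ v)]
    exact congrArg (fun x => proj Γ (δ x)) (f.apply_symm_apply v)
  refine ⟨hle, π, hπ, ?_, hfib⟩
  have hclosed : IsClosedMap π := by
    intro Z hZ
    have hq : IsOpenQuotientMap (proj Δ) :=
      MulAction.isOpenQuotientMap_quotientMk (Γ := Δ) (T := E)
    rw [← hq.isQuotientMap.isClosed_preimage]
    have hpre : proj Δ ⁻¹' (π '' Z) = ⋃ f ∈ F, f.symm ⁻¹' (proj Γ ⁻¹' Z) := by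
      ext w
      rw [Set.mem_iUnion₂]
      constructor
      · rintro ⟨p, hp, hpw⟩
        obtain ⟨z, rfl⟩ := proj_surjective p
        obtain ⟨δ, hδ, rfl⟩ := proj_eq_iff.mp (hpw.symm : proj Δ w = proj Δ z)
        obtain ⟨f, hf, hfδ⟩ := hcov δ hδ
        refine ⟨f, hf, ?_⟩
        change proj Γ ((f⁻¹ * δ) z) ∈ Z
        rwa [proj_apply hfδ]
      · rintro ⟨f, hf, hw⟩
        exact ⟨_, hw, proj_apply (Δ.inv_mem (hFΔ hf)) w⟩
    rw [hpre]
    exact hF.isClosed_biUnion fun f _ =>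
      (hZ.preimage continuous_proj).preimage f.symm.continuous_of_finiteDimensional
  have hlh : IsLocalHomeomorph π := by
    have h1 : IsLocalHomeomorphOn (π ∘ proj Γ) Set.univ :=
      (isLocalHomeomorph_iff_isLocalHomeomorphOn_univ.mp hcΔ.isLocalHomeomorph)
    have h2 := h1.of_comp_right
      (isLocalHomeomorph_iff_isLocalHomeomorphOn_univ.mp hcΓ.isLocalHomeomorph)
    rw [Set.image_univ, Set.range_eq_univ.mpr proj_surjective] at h2
    exact isLocalHomeomorph_iff_isLocalHomeomorphOn_univ.mpr h2
  rw [isCoveringMap_iff_isCoveringMapOn_univ]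
  exact hclosed.isCoveringMapOn_of_isLocalHomeomorphOn (fun q _ => hfib q)
    (isLocalHomeomorph_iff_isLocalHomeomorphOn_univ.mp hlh)

end Causality

end FlatLorentz

namespace FlatLorentz

/-! ### Restriction of the form and the cone to a subspace. -/

section Restriction

variable {E : Type*} [AddCommGroup E] [Module ℝ E] {ℓ : LinearMap.BilinForm ℝ E} {C : Set E}

theorem IsTimeCone.restrict (hC : IsTimeCone ℓ C) (hℓ : IsLorentzian ℓ) {V₀ : Submodule ℝ E}
    (h₀ : IsLorentzian (ℓ.restrict V₀)) :
    IsTimeCone (ℓ.restrict V₀) ((↑) ⁻¹' C : Set V₀) := by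
  have key : ∀ u : V₀, 0 < ℓ u u → (u : E) ∈ C →
      IsTimeCone (ℓ.restrict V₀) ((↑) ⁻¹' C : Set V₀) := by
    intro u hu huC
    refine ⟨u, hu, ?_⟩
    ext v
    refine ⟨fun hv => ⟨hC.nonneg hv, hC.pairing_nonneg hℓ huC hv⟩, fun ⟨h1, h2⟩ => ?_⟩
    change 0 ≤ ℓ v v at h1
    change 0 ≤ ℓ u v at h2
    rcases hC.mem_or_neg_mem h1 with h | h
    · exact h
    · have h3 := hC.pairing_nonneg hℓ huC h
      rw [map_neg] at h3
      have h4 : (v : E) = 0 := by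
        by_contra hne
        exact absurd (hℓ.neg_of_orthogonal hu (by linarith) hne) (not_lt.mpr h1)
      change (v : E) ∈ C
      rw [h4]
      exact hC.zero_mem
  obtain ⟨-, u, hu, -⟩ := h₀
  rcases hC.mem_or_neg_mem (le_of_lt hu : 0 ≤ ℓ u u) with h | h
  · exact key u hu h
  · exact key (-u) (by simpa using hu) h

/-- A nondegenerate subspace with a nonzero causal vector is Lorentzian. -/
theorem IsLorentzian.restrict (hℓ : IsLorentzian ℓ) {V₀ : Submodule ℝ E} {ξ : E} (hξ : 0 ≤ ℓ ξ ξ)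
    (hne : ξ ≠ 0) (hmem : ξ ∈ V₀) (hnd : ∀ v ∈ V₀, (∀ w ∈ V₀, ℓ v w = 0) → v = 0) :
    IsLorentzian (ℓ.restrict V₀) := by
  have key : ∀ u ∈ V₀, 0 < ℓ u u → IsLorentzian (ℓ.restrict V₀) := fun u hu hpos =>
    ⟨fun v w => hℓ.1 v w, ⟨u, hu⟩, hpos, fun v hv hv0 =>
      hℓ.neg_of_orthogonal hpos hv fun h => hv0 (Subtype.ext h)⟩
  rcases hξ.lt_or_eq with hpos | hnull
  · exact key ξ hmem hpos
  · obtain ⟨w, hw, hw0⟩ : ∃ w ∈ V₀, ℓ ξ w ≠ 0 := by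
      by_contra! h
      exact hne (hnd ξ hmem h)
    -- Chosen so that `w + s • ξ` has square `1`.
    set s : ℝ := (1 - ℓ w w) / (2 * ℓ ξ w) with hs
    refine key (w + s • ξ) (V₀.add_mem hw (V₀.smul_mem s hmem)) ?_
    have h1 : s * (2 * ℓ ξ w) = 1 - ℓ w w := div_mul_cancel₀ _ (mul_ne_zero two_ne_zero hw0)
    simp only [map_add, LinearMap.add_apply, map_smul, LinearMap.smul_apply, smul_eq_mul,
      ← hnull, hℓ.1 w ξ]
    linarith

/-- The orthogonal complement of a Lorentzian subspace is negative definite. -/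
theorem IsLorentzian.neg_of_forall_orthogonal (hℓ : IsLorentzian ℓ) {V₀ : Submodule ℝ E}
    (h₀ : IsLorentzian (ℓ.restrict V₀)) {y : E} (hy : ∀ x ∈ V₀, ℓ x y = 0) (hne : y ≠ 0) :
    ℓ y y < 0 := by
  obtain ⟨-, u, hu, -⟩ := h₀
  exact hℓ.neg_of_orthogonal (hu : 0 < ℓ u u) (hy u u.2) hne

theorem IsLorentzian.isCompl_orthogonal [FiniteDimensional ℝ E] (hℓ : IsLorentzian ℓ)
    {V₀ : Submodule ℝ E} (h₀ : IsLorentzian (ℓ.restrict V₀)) :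
    IsCompl V₀ (ℓ.orthogonal V₀) := by
  have hsymm : ∀ v w, ℓ v w = 0 → ℓ w v = 0 := fun v w h => by rw [hℓ.1, h]
  refine LinearMap.BilinForm.isCompl_orthogonal_of_restrict_nondegenerate hsymm ?_
  refine ⟨fun v hv => h₀.eq_zero_of_forall hv, fun v hv => h₀.eq_zero_of_forall fun w => ?_⟩
  rw [h₀.1]
  exact hv w

end Restriction

/-! ### Constructing homomorphisms into affine and orthogonal groups. -/

section Homomorphisms

variable {E : Type*} [AddCommGroup E] [Module ℝ E]

theorem exists_affineHom {G : Type*} [Group G] (f : G → E → E) (g : G → E →ₗ[ℝ] E)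
    (hf : ∀ γ x w, f γ (w + x) = g γ w + f γ x) (hone : ∀ x, f 1 x = x)
    (hmul : ∀ γ δ x, f (γ * δ) x = f γ (f δ x)) :
    ∃ ρ : G →* (E ≃ᵃ[ℝ] E), ∀ γ x, ρ γ x = f γ x := by
  let F : G →* (E →ᵃ[ℝ] E) :=
    { toFun := fun γ => ⟨f γ, g γ, fun x w => hf γ x w⟩
      map_one' := AffineMap.ext hone
      map_mul' := fun γ δ => AffineMap.ext (hmul γ δ) }
  exact ⟨(AffineEquiv.equivUnitsAffineMap (k := ℝ) (P₁ := E)).symm.toMonoidHom.comp F.toHomUnits,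
    fun γ x => rfl⟩

theorem exists_orthogonalHom {G : Type*} [Group G] {B : LinearMap.BilinForm ℝ E}
    (g : G → E →ₗ[ℝ] E) (hone : ∀ x, g 1 x = x) (hmul : ∀ γ δ x, g (γ * δ) x = g γ (g δ x))
    (hB : ∀ γ x y, B (g γ x) (g γ y) = B x y) :
    ∃ α : G →* orthogonalGroup B, ∀ γ x, (α γ : E ≃ₗ[ℝ] E) x = g γ x := by
  let F : G →* Module.End ℝ E :=
    { toFun := g
      map_one' := LinearMap.ext hone
      map_mul' := fun γ δ => LinearMap.ext (hmul γ δ) }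
  exact ⟨((LinearMap.GeneralLinearGroup.generalLinearEquiv ℝ E).toMonoidHom.comp
    F.toHomUnits).codRestrict (orthogonalGroup B) fun γ x y => hB γ x y, fun γ x => rfl⟩

end Homomorphisms

/-! ### Local finiteness from strict causality for unipotent groups. -/

section UnipotentGroups

variable {E : Type*} [NormedAddCommGroup E] [NormedSpace ℝ E]
  {ℓ : LinearMap.BilinForm ℝ E} {C : Set E} {Γ Δ : Subgroup (E ≃ᵃ[ℝ] E)}

theorem NoReturn.mono (h : NoReturn C Δ) (hle : Γ ≤ Δ) : NoReturn C Γ := by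
  intro v c hc hc0
  obtain ⟨t, ht, hnot⟩ := h v c hc hc0
  refine ⟨t, ht, fun hmem => hnot (closure_mono ?_ hmem)⟩
  rintro z ⟨γ, hγ, hz⟩
  exact ⟨γ, hle hγ, hz⟩

theorem HasSpacelikeDisplacements.mono (h : HasSpacelikeDisplacements ℓ Δ) (hle : Γ ≤ Δ) :
    HasSpacelikeDisplacements ℓ Γ := fun γ hγ => h γ (hle hγ)

theorem IsStrictlyCausal.exists_isFixing [FiniteDimensional ℝ E]
    (h : IsStrictlyCausal ℓ C Γ) (hℓ : IsLorentzian ℓ)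
    (hC : IsTimeCone ℓ C) : ∃ ξ ∈ C, ξ ≠ 0 ∧ ∀ γ ∈ Γ, IsFixing ℓ ξ γ := by
  obtain ⟨ξ, hξ, hne, hfix⟩ := exists_fixed_mem_timeCone hℓ hC
    (G := Γ.map AffineEquiv.linearHom)
    (by rintro _ ⟨γ, hγ, rfl⟩; exact h.form γ hγ)
    (by rintro _ ⟨γ, hγ, rfl⟩; exact h.linear_mem γ hγ)
    (by rintro _ ⟨γ, hγ, rfl⟩; exact (h.hasSpacelikeDisplacements hC).linear_nonpos hℓ.1 hγ)
  exact ⟨ξ, hξ, hne, fun γ hγ => ⟨h.form γ hγ, hfix _ ⟨γ, hγ, rfl⟩⟩⟩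

theorem IsFixing.exists_eq_add_smul_of_isNilpotent (hℓ : IsLorentzian ℓ) {ξ : E} (hξ : 0 ≤ ℓ ξ ξ)
    (hne : ξ ≠ 0) {γ : E ≃ᵃ[ℝ] E} (h : IsFixing ℓ ξ γ)
    (hnil : IsNilpotent ((γ.linear : E →ₗ[ℝ] E) - LinearMap.id : Module.End ℝ E)) {w : E}
    (hw : ℓ ξ w = 0) : ∃ a : ℝ, γ.linear w = w + a • ξ := by
  obtain ⟨n, hn⟩ := hnil
  refine h.exists_eq_add_smul_of_pow hℓ hξ hne n hw ?_
  have key : ∀ (k : ℕ) (x : E), ((affineHat γ - 1) ^ k) (x, 0) =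
      ((((γ.linear : E →ₗ[ℝ] E) - LinearMap.id : Module.End ℝ E) ^ k) x, 0) := by
    intro k
    induction k with
    | zero => intro x; rfl
    | succ k ih =>
      intro x
      rw [pow_succ, Module.End.mul_apply, affineHat_sub_one_apply_zero, ih, pow_succ,
        Module.End.mul_apply]
      rfl
  rw [key, hn]
  rfl

/-- Needed for (II), where only an abstract splitting is given, so the fixed causal vector must be
found anew inside `V₀`. -/
theorem IsStrictlyCausal.locallyFiniteCones [FiniteDimensional ℝ E]
    (h : IsStrictlyCausal ℓ C Γ) (hℓ : IsLorentzian ℓ)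
    (hC : IsTimeCone ℓ C)
    (hnil : ∀ γ ∈ Γ, IsNilpotent ((γ.linear : E →ₗ[ℝ] E) - LinearMap.id : Module.End ℝ E)) :
    LocallyFiniteCones ℓ Γ := by
  obtain ⟨ξ, hξ, hne, hfix⟩ := h.exists_isFixing hℓ hC
  obtain ⟨hret, hret'⟩ := h.noReturn hC hℓ
  exact locallyFiniteCones_of_noReturn hℓ hC
    (hasFiniteDisplacements_of_properlyDiscontinuous h.proper)
    (h.hasSpacelikeDisplacements hC) hret hret' hξ hne
    ⟨hfix, fun _ _ => Submodule.mem_top, fun _ _ _ _ => Submodule.mem_top, fun γ hγ w _ hw =>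
      (hfix γ hγ).exists_eq_add_smul_of_isNilpotent hℓ (hC.nonneg hξ) hne (hnil γ hγ) hw⟩

end UnipotentGroups

/-! ### Actions fibred over an invariant flat. -/

section Products

variable {E : Type*} [NormedAddCommGroup E] [NormedSpace ℝ E]
  {ℓ : LinearMap.BilinForm ℝ E} {C : Set E} {o : E} {V₀ V₁ : Submodule ℝ E}

theorem linear_apply_add {Γ : Type*} [Group Γ] {ρ : Γ →* (E ≃ᵃ[ℝ] E)} {ρ₀ : Γ →* (V₀ ≃ᵃ[ℝ] V₀)}
    {α : Γ →* orthogonalGroup (ℓ.restrict V₁)}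
    (hfib : ∀ γ (x : V₀) (y : V₁), ρ γ (o + x + y) = o + ρ₀ γ x + (α γ : V₁ ≃ₗ[ℝ] V₁) y)
    (γ : Γ) (x : V₀) (y : V₁) :
    (ρ γ).linear (x + y) = ((ρ₀ γ).linear x : E) + (α γ : V₁ ≃ₗ[ℝ] V₁) y := by
  have h1 := hfib γ 0 0
  have h2 := hfib γ x y
  have h3 := affine_apply (ρ₀ γ) 0 x
  have h0 : (α γ : V₁ ≃ₗ[ℝ] V₁) 0 = 0 := map_zero _
  simp only [h0, ZeroMemClass.coe_zero, add_zero] at h1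
  rw [add_assoc, affine_apply, h1] at h2
  rw [zero_add] at h3
  rw [h3, Submodule.coe_add] at h2
  have h4 : (o + ((ρ₀ γ 0 : V₀) : E)) + (ρ γ).linear (x + y) =
    (o + ((ρ₀ γ 0 : V₀) : E)) + (((ρ₀ γ).linear x : E) + (α γ : V₁ ≃ₗ[ℝ] V₁) y) := by
    rw [h2]; abel
  exact add_left_cancel h4

theorem bilin_add_add (hs : ∀ v w, ℓ v w = ℓ w v) (horth : ∀ x ∈ V₀, ∀ y ∈ V₁, ℓ x y = 0)
    (x x' : V₀) (y y' : V₁) : ℓ (x + y) (x' + y') = ℓ x x' + ℓ y y' := by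
  simp only [map_add, LinearMap.add_apply]
  rw [horth x x.2 y' y'.2, hs y x', horth x' x'.2 y y.2]
  ring

/-- Strict causality of `E/Γ` follows from the local finiteness on an invariant subspace whose
orthogonal complement is negative definite. -/
theorem isStrictlyCausal_of_fibre [FiniteDimensional ℝ E]
    (hℓ : IsLorentzian ℓ) (hC : IsTimeCone ℓ C)
    (hcompl : IsCompl V₀ V₁) (horth : ∀ x ∈ V₀, ∀ y ∈ V₁, ℓ x y = 0)
    (hneg : ∀ y ∈ V₁, y ≠ 0 → ℓ y y < 0)
    {Γ : Type*} [Group Γ] {ρ : Γ →* (E ≃ᵃ[ℝ] E)} {ρ₀ : Γ →* (V₀ ≃ᵃ[ℝ] V₀)}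
    {α : Γ →* orthogonalGroup (ℓ.restrict V₁)}
    (hfib : ∀ γ (x : V₀) (y : V₁), ρ γ (o + x + y) = o + ρ₀ γ x + (α γ : V₁ ≃ₗ[ℝ] V₁) y)
    (hinj : Function.Injective ρ₀)
    (hflat : IsFlatSpacetime (ℓ.restrict V₀) ((↑) ⁻¹' C : Set V₀) ρ₀.range)
    (hsp : HasSpacelikeDisplacements (ℓ.restrict V₀) ρ₀.range)
    (hlf : LocallyFiniteCones (ℓ.restrict V₀) ρ₀.range) : IsStrictlyCausal ℓ C ρ.range := by
  have hlin := linear_apply_add hfib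
  have hbil := bilin_add_add hℓ.1 horth
  have hneg' : ∀ y : V₁, ℓ y y ≤ 0 := by
    intro y
    by_cases hy : (y : E) = 0
    · rw [hy, map_zero]
    · exact (hneg y y.2 hy).le
  let φ := Submodule.prodEquivOfIsCompl V₀ V₁ hcompl
  have hφ : ∀ x y, φ (x, y) = x + y := fun x y => Submodule.coe_prodEquivOfIsCompl' V₀ V₁ hcompl _
  have hdec : ∀ v : E, v = ((φ.symm v).1 : E) + (φ.symm v).2 := fun v => by
    rw [← hφ]
    exact (φ.apply_symm_apply v).symm
  let P : E → V₀ := fun v => (φ.symm (v - o)).1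
  have hP : Continuous P := by
    have : Continuous φ.symm :=
      φ.symm.toLinearMap.continuous_of_finiteDimensional
    exact continuous_fst.comp (this.comp (continuous_id.sub continuous_const))
  have hPadd : ∀ (x : V₀) (y : V₁), P (o + x + y) = x := by
    intro x y
    have h1 : o + x + y - o = φ (x, y) := by rw [hφ]; abel
    simp only [P, h1, LinearEquiv.symm_apply_apply]
  have hdec' : ∀ v : E, ∃ y : V₁, v = o + P v + y := fun v =>
    ⟨(φ.symm (v - o)).2, by
      have := hdec (v - o)
      rw [add_assoc, ← this]; abel⟩
  have hPρ : ∀ γ v, P (ρ γ v) = ρ₀ γ (P v) := by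
    intro γ v
    obtain ⟨y, hy⟩ := hdec' v
    conv_lhs => rw [hy, hfib]
    exact hPadd _ _
  -- Dropping the negative definite `V₁` component only increases the square. Spacelike
  -- displacements and local finiteness are therefore inherited from `V₀`.
  have hPsub : ∀ v w, ℓ (v - w) (v - w) ≤ ℓ (P v - P w : V₀) (P v - P w : V₀) := by
    intro v w
    obtain ⟨y, hy⟩ := hdec' v
    obtain ⟨y', hy'⟩ := hdec' w
    have h1 : v - w = ((P v - P w : V₀) : E) + (y - y' : V₁) := by
      conv_lhs => rw [hy, hy']
      push_cast; abel
    rw [h1, hbil]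
    linarith [hneg' (y - y')]
  have hone : ∀ γ, ρ γ ≠ 1 → ρ₀ γ ≠ 1 := fun γ hγ h =>
    hγ (by rw [hinj (h.trans (map_one ρ₀).symm), map_one])
  have hform : ∀ γ v w, ℓ ((ρ γ).linear v) ((ρ γ).linear w) = ℓ v w := by
    intro γ v w
    rw [hdec v, hdec w, hlin, hlin, hbil, hbil]
    exact congrArg₂ (· + ·) (hflat.form (ρ₀ γ) ⟨γ, rfl⟩ _ _) ((α γ).2 _ _)
  have hfst : ∀ (x : V₀) (y : V₁), (x + y : E) ∈ C → (x : E) ∈ C := by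
    intro x y hxy
    have h1 := hC.nonneg hxy
    rw [hbil] at h1
    have h2 := hneg' y
    rcases hC.mem_or_neg_mem (by linarith : 0 ≤ ℓ x x) with h | h
    · exact h
    · have h3 := hC.pairing_nonneg hℓ h hxy
      have h4 : ℓ (-(x : E)) (x + y) = -ℓ x x := by
        rw [map_neg, LinearMap.neg_apply, map_add, horth x x.2 y y.2, add_zero]
      have h5 : (y : E) = 0 := by
        by_contra hne
        have := hneg y y.2 hne
        linarith
      rwa [h5, add_zero] at hxy
  -- Isometry leaves only the sign to decide. It is read off from the `V₀` component, which stays in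
  -- `C` and vanishes only for `v = 0`.
  have hcone : ∀ γ, ∀ v ∈ C, (ρ γ).linear v ∈ C := by
    intro γ v hv
    have hv0 : 0 ≤ ℓ ((ρ γ).linear v) ((ρ γ).linear v) := by
      rw [hform]
      exact hC.nonneg hv
    rcases hC.mem_or_neg_mem hv0 with h | h
    · exact h
    · have hx := hfst _ _ (hdec v ▸ hv : ((φ.symm v).1 : E) + (φ.symm v).2 ∈ C)
      have hx' : ((ρ₀ γ).linear (φ.symm v).1 : E) ∈ C :=
        hflat.linear_mem (ρ₀ γ) ⟨γ, rfl⟩ _ hx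
      rw [hdec v, hlin] at h
      have hx'' : -((ρ₀ γ).linear (φ.symm v).1 : E) ∈ C := by
        have := hfst (-(ρ₀ γ).linear (φ.symm v).1) (-(α γ : V₁ ≃ₗ[ℝ] V₁) (φ.symm v).2)
          (by push_cast; rwa [← neg_add])
        simpa using this
      have h1 : (ρ₀ γ).linear (φ.symm v).1 = 0 := Subtype.ext (hC.eq_zero hℓ hx' hx'')
      have h2 : (φ.symm v).1 = 0 := (LinearEquiv.map_eq_zero_iff _).mp h1
      have h3 : v = (φ.symm v).2 := by
        have := hdec v
        rwa [h2, ZeroMemClass.coe_zero, zero_add] at this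
      have h4 : v = 0 := by
        by_contra hne
        have h5 := hC.nonneg hv
        exact absurd (hneg v (h3 ▸ (φ.symm v).2.2) hne) (not_lt.mpr h5)
      rw [h4, map_zero]
      exact hC.zero_mem
  have hspace : HasSpacelikeDisplacements ℓ ρ.range := by
    rintro _ ⟨γ, rfl⟩ hne v
    refine (hPsub _ _).trans_lt ?_
    rw [hPρ]
    exact hsp _ ⟨γ, rfl⟩ (hone γ hne) (P v)
  refine isStrictlyCausal_of_locallyFiniteCones hC hℓ ⟨?_, ?_, ?_, ?_⟩ hspace ?_
  · rintro _ ⟨γ, rfl⟩ v w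
    exact hform γ v w
  · rintro _ ⟨γ, rfl⟩
    refine Set.Subset.antisymm (Set.image_subset_iff.mpr (hcone γ)) fun v hv =>
      ⟨(ρ γ⁻¹).linear v, hcone γ⁻¹ v hv, ?_⟩
    rw [map_inv]
    exact linear_apply_inv _ _
  · rintro g ⟨γ, rfl⟩ v hv
    by_contra hne
    have := hspace _ ⟨γ, rfl⟩ hne v
    rw [hv, sub_self, map_zero] at this
    exact lt_irrefl _ this
  · refine ⟨fun {K L} hK hL => ?_⟩
    have h1 := hflat.proper.finite_disjoint_inter_image (hK.image hP) (hL.image hP)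
    have h2 := (h1.preimage (f := ρ₀.rangeRestrict)
      (Function.Injective.injOn fun a b h => hinj (congrArg Subtype.val h))).image ρ.rangeRestrict
    refine h2.subset ?_
    rintro ⟨_, γ, rfl⟩ ⟨_, ⟨v, hv, rfl⟩, hL'⟩
    refine ⟨γ, ⟨ρ₀ γ (P v), ⟨P v, ⟨v, hv, rfl⟩, rfl⟩, ?_⟩, rfl⟩
    rw [← hPρ]
    exact ⟨_, hL', rfl⟩
  · intro v
    obtain ⟨N, hN, hfin⟩ := hlf (P v)
    refine ⟨P ⁻¹' N, hP.continuousAt.preimage_mem_nhds hN, ?_⟩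
    refine ((hfin.preimage hinj.injOn).image ρ).subset ?_
    rintro _ ⟨⟨γ, rfl⟩, z, hz, h⟩
    refine ⟨γ, ⟨⟨γ, rfl⟩, P z, hz, ?_⟩, rfl⟩
    have := hPsub z (ρ γ v)
    rw [hPρ] at this
    exact h.trans this

theorem exists_action_of_fibre {Γ : Type*} [Group Γ] (hcompl : IsCompl V₀ V₁) (o : E)
    (ρ₀ : Γ →* (V₀ ≃ᵃ[ℝ] V₀)) (β : Γ →* orthogonalGroup (ℓ.restrict V₁)) :
    ∃ ρ : Γ →* (E ≃ᵃ[ℝ] E),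
      ∀ γ (x : V₀) (y : V₁), ρ γ (o + x + y) = o + ρ₀ γ x + (β γ : V₁ ≃ₗ[ℝ] V₁) y := by
  let φ := Submodule.prodEquivOfIsCompl V₀ V₁ hcompl
  have hφ : ∀ x y, φ (x, y) = x + y := fun x y => Submodule.coe_prodEquivOfIsCompl' V₀ V₁ hcompl _
  suffices ∃ ρ : Γ →* (E ≃ᵃ[ℝ] E), ∀ γ v, ρ γ v =
      o + φ (ρ₀ γ (φ.symm (v - o)).1, (β γ : V₁ ≃ₗ[ℝ] V₁) (φ.symm (v - o)).2) by
    obtain ⟨ρ, hρ⟩ := this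
    refine ⟨ρ, fun γ x y => ?_⟩
    have h1 : o + x + y - o = φ (x, y) := by rw [hφ]; abel
    rw [hρ, h1, LinearEquiv.symm_apply_apply, hφ, add_assoc]
  refine exists_affineHom _ (fun γ => φ.toLinearMap ∘ₗ ((ρ₀ γ).linear.toLinearMap.prodMap
      (β γ : V₁ ≃ₗ[ℝ] V₁).toLinearMap) ∘ₗ φ.symm.toLinearMap) ?_ ?_ ?_
  · intro γ v w
    have h1 : φ.symm (w + v - o) = φ.symm (v - o) + φ.symm w := by
      rw [← map_add]; congr 1; abel
    rw [h1]
    simp only [Prod.fst_add, Prod.snd_add, affine_apply, map_add, LinearMap.comp_apply,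
      LinearEquiv.coe_coe, LinearMap.prodMap_apply]
    rw [← Prod.mk_add_mk, map_add]
    abel
  · intro v
    rw [map_one, map_one]
    change o + φ ((φ.symm (v - o)).1, (φ.symm (v - o)).2) = v
    rw [Prod.mk.eta, LinearEquiv.apply_symm_apply, add_sub_cancel]
  · intro γ δ v
    simp only [add_sub_cancel_left, LinearEquiv.symm_apply_apply, map_mul]
    rfl

/-- Everything needed for strict causality is a property of `ρ₀`; the action on `V₁` matters only
through its being linear and isometric. -/
theorem IsSplitting.exists_change_fibre [FiniteDimensional ℝ E]
    (hℓ : IsLorentzian ℓ) (hC : IsTimeCone ℓ C)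
    {Γ : Type*} [Group Γ] {ρ : Γ →* (E ≃ᵃ[ℝ] E)} {ρ₀ : Γ →* (V₀ ≃ᵃ[ℝ] V₀)}
    {α : Γ →* orthogonalGroup (ℓ.restrict V₁)} (h : IsSplitting ℓ C o V₀ V₁ ρ ρ₀ α)
    (β : Γ →* orthogonalGroup (ℓ.restrict V₁)) :
    ∃ ρ' : Γ →* (E ≃ᵃ[ℝ] E), Function.Injective ρ' ∧ IsStrictlyCausal ℓ C ρ'.range ∧
      IsSplitting ℓ C o V₀ V₁ ρ' ρ₀ β := by
  obtain ⟨ρ', hfib⟩ := exists_action_of_fibre h.isCompl o ρ₀ β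
  have hC₀ := hC.restrict hℓ h.lorentzian₀
  have hlin := linear_apply_add hfib
  have hbase : ∀ γ (x : V₀), ρ' γ (o + x) = o + ρ₀ γ x := by
    intro γ x
    have h1 := hfib γ x 0
    rwa [map_zero, ZeroMemClass.coe_zero, add_zero, add_zero] at h1
  refine ⟨ρ', ?_, isStrictlyCausal_of_fibre hℓ hC h.isCompl h.orthogonal h.negDef₁ hfib h.faithful
    h.strictlyCausal.toIsFlatSpacetime (h.strictlyCausal.hasSpacelikeDisplacements hC₀)
    (h.strictlyCausal.locallyFiniteCones h.lorentzian₀ hC₀ (by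
      rintro _ ⟨γ, rfl⟩; exact h.unipotent γ)),
    ⟨h.isCompl, h.orthogonal, fun γ x hx => ?_, fun γ y hy => ?_, h.lorentzian₀, h.negDef₁, hbase,
      h.unipotent, h.faithful, h.strictlyCausal, hfib⟩⟩
  · intro γ δ hγδ
    refine h.faithful (AffineEquiv.ext fun x => Subtype.ext ?_)
    have h1 := hbase γ x
    rw [hγδ, hbase δ x] at h1
    exact (add_left_cancel h1).symm
  · have h1 := hlin γ ⟨x, hx⟩ 0
    rw [map_zero, ZeroMemClass.coe_zero, add_zero, add_zero] at h1
    rw [h1]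
    exact Subtype.property _
  · have h1 := hlin γ 0 ⟨y, hy⟩
    rw [map_zero, ZeroMemClass.coe_zero, zero_add, zero_add] at h1
    rw [h1]
    exact Subtype.property _

end Products

end FlatLorentz

namespace FlatLorentz

/-! ### Restriction to the invariant flat and the splitting theorem. -/

section Flat

variable {E : Type*} [NormedAddCommGroup E] [NormedSpace ℝ E]
  {ℓ : LinearMap.BilinForm ℝ E} {C : Set E} {o ξ : E} {V₀ V₁ : Submodule ℝ E}
  {Γ Δ : Subgroup (E ≃ᵃ[ℝ] E)}

theorem IsUnipotentOn.apply_mem (hU : IsUnipotentOn ℓ ξ Γ o V₀) {γ : E ≃ᵃ[ℝ] E} (hγ : γ ∈ Γ)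
    {x : E} (hx : x ∈ V₀) : γ (o + x) - o ∈ V₀ := by
  rw [affine_apply, add_sub_right_comm]
  exact V₀.add_mem (hU.base γ hγ) (hU.linear_mem γ hγ x hx)

/-- The restriction of the action of `Γ` to an invariant affine subspace. -/
theorem IsUnipotentOn.exists_restrict (hU : IsUnipotentOn ℓ ξ Γ o V₀) :
    ∃ ρ₀ : Γ →* (V₀ ≃ᵃ[ℝ] V₀), ∀ (γ : Γ) (x : V₀), (γ : E ≃ᵃ[ℝ] E) (o + x) = o + ρ₀ γ x := by
  obtain ⟨ρ₀, hρ₀⟩ := exists_affineHom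
    (fun (γ : Γ) (x : V₀) => (⟨γ.1 (o + x) - o, hU.apply_mem γ.2 x.2⟩ : V₀))
    (fun γ => γ.1.linear.toLinearMap.restrict (hU.linear_mem γ.1 γ.2))
    (fun γ x w => Subtype.ext (by
      change γ.1 (o + (w + x : V₀)) - o = γ.1.linear w + (γ.1 (o + x) - o)
      rw [Submodule.coe_add, add_comm (w : E), ← add_assoc, affine_apply]
      abel))
    (fun x => Subtype.ext (add_sub_cancel_left o (x : E)))
    (fun γ δ x => Subtype.ext (by
      change γ.1 (δ.1 (o + x)) - o = γ.1 (o + (δ.1 (o + x) - o)) - o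
      rw [add_sub_cancel]))
  exact ⟨ρ₀, fun γ x => by rw [hρ₀, add_sub_cancel]⟩

theorem exists_fibre_action (hU : IsUnipotentOn ℓ ξ Γ o V₀) :
    (∀ γ ∈ Γ, ∀ y ∈ ℓ.orthogonal V₀, γ.linear y ∈ ℓ.orthogonal V₀) ∧
    ∃ α : Γ →* orthogonalGroup (ℓ.restrict (ℓ.orthogonal V₀)),
      ∀ (γ : Γ) (y : ℓ.orthogonal V₀),
        (((α γ : ℓ.orthogonal V₀ ≃ₗ[ℝ] ℓ.orthogonal V₀) y : ℓ.orthogonal V₀) : E) =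
          (γ : E ≃ᵃ[ℝ] E).linear y := by
  have hinv : ∀ γ ∈ Γ, ∀ y ∈ ℓ.orthogonal V₀, γ.linear y ∈ ℓ.orthogonal V₀ := by
    intro γ hγ y hy x hx
    have h1 := (hU.fixing γ hγ).1 ((γ⁻¹).linear x) y
    rw [linear_apply_inv] at h1
    exact h1.trans (hy _ (hU.linear_mem γ⁻¹ (Γ.inv_mem hγ) x hx))
  refine ⟨hinv, ?_⟩
  obtain ⟨α, hα⟩ := exists_orthogonalHom (B := ℓ.restrict (ℓ.orthogonal V₀))
    (fun γ : Γ => γ.1.linear.toLinearMap.restrict (hinv γ.1 γ.2))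
    (fun x => rfl) (fun γ δ x => rfl) (fun γ x y => (hU.fixing γ.1 γ.2).1 x y)
  exact ⟨α, fun γ y => by rw [hα]; rfl⟩

variable {ρ₀ : Γ →* (V₀ ≃ᵃ[ℝ] V₀)}

theorem coe_linear_restrict
    (hρ₀ : ∀ (γ : Γ) (x : V₀), (γ : E ≃ᵃ[ℝ] E) (o + x) = o + ρ₀ γ x) (γ : Γ) (x : V₀) :
    (((ρ₀ γ).linear x : V₀) : E) = (γ : E ≃ᵃ[ℝ] E).linear x := by
  have h1 := hρ₀ γ x
  have h2 := hρ₀ γ 0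
  have h3 := affine_apply (ρ₀ γ) 0 x
  rw [ZeroMemClass.coe_zero, add_zero] at h2
  rw [zero_add] at h3
  rw [affine_apply, h2, h3, Submodule.coe_add, add_assoc] at h1
  exact (add_left_cancel (add_left_cancel h1)).symm

theorem coe_restrict_sub
    (hρ₀ : ∀ (γ : Γ) (x : V₀), (γ : E ≃ᵃ[ℝ] E) (o + x) = o + ρ₀ γ x) (γ : Γ) (x z : V₀) :
    ((z - ρ₀ γ x : V₀) : E) = o + z - (γ : E ≃ᵃ[ℝ] E) (o + x) := by
  rw [hρ₀, add_sub_add_left_eq_sub, Submodule.coe_sub]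

theorem restrict_injective (hfree : ∀ γ ∈ Γ, ∀ v, γ v = v → γ = 1)
    (hρ₀ : ∀ (γ : Γ) (x : V₀), (γ : E ≃ᵃ[ℝ] E) (o + x) = o + ρ₀ γ x) :
    Function.Injective ρ₀ := by
  refine (injective_iff_map_eq_one ρ₀).mpr fun γ hγ => Subtype.ext (hfree γ γ.2 (o + (0 : V₀)) ?_)
  rw [hρ₀, hγ]
  rfl

theorem IsFlatSpacetime.restrict [FiniteDimensional ℝ E] (h : IsFlatSpacetime ℓ C Γ)
    (hρ₀ : ∀ (γ : Γ) (x : V₀), (γ : E ≃ᵃ[ℝ] E) (o + x) = o + ρ₀ γ x) :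
    IsFlatSpacetime (ℓ.restrict V₀) ((↑) ⁻¹' C : Set V₀) ρ₀.range := by
  have hlin := coe_linear_restrict hρ₀
  have hcone : ∀ γ, ∀ x : V₀, (x : E) ∈ C → (((ρ₀ γ).linear x : V₀) : E) ∈ C := by
    intro γ x hx
    rw [hlin]
    exact h.linear_mem γ γ.2 _ hx
  refine ⟨?_, ?_, ?_, ⟨fun {K L} hK hL => ?_⟩⟩
  · rintro _ ⟨γ, rfl⟩ v w
    change ℓ ((ρ₀ γ).linear v : V₀) ((ρ₀ γ).linear w : V₀) = ℓ v w
    rw [hlin, hlin]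
    exact h.form γ γ.2 v w
  · rintro _ ⟨γ, rfl⟩
    refine Set.Subset.antisymm (Set.image_subset_iff.mpr (hcone γ)) fun v hv =>
      ⟨(ρ₀ γ⁻¹).linear v, hcone γ⁻¹ v hv, ?_⟩
    rw [map_inv]
    exact linear_apply_inv _ _
  · rintro _ ⟨γ, rfl⟩ x hx
    have h1 := hρ₀ γ x
    rw [hx] at h1
    have h2 : γ = 1 := Subtype.ext (h.free γ γ.2 _ h1)
    rw [h2, map_one]
  · have hcont : Continuous fun x : V₀ => o + (x : E) := by fun_prop
    have h1 := h.proper.finite_disjoint_inter_image (hK.image hcont) (hL.image hcont)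
    refine (h1.image ρ₀.rangeRestrict).subset ?_
    rintro ⟨_, γ, rfl⟩ ⟨_, ⟨x, hx, rfl⟩, hL'⟩
    exact ⟨γ, ⟨γ.1 (o + x), ⟨o + x, ⟨x, hx, rfl⟩, rfl⟩, _, hL', (hρ₀ γ x).symm⟩, rfl⟩

theorem HasSpacelikeDisplacements.restrict (h : HasSpacelikeDisplacements ℓ Γ)
    (hρ₀ : ∀ (γ : Γ) (x : V₀), (γ : E ≃ᵃ[ℝ] E) (o + x) = o + ρ₀ γ x) :
    HasSpacelikeDisplacements (ℓ.restrict V₀) ρ₀.range := by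
  rintro _ ⟨γ, rfl⟩ hne x
  have hγ : (γ : E ≃ᵃ[ℝ] E) ≠ 1 := by
    intro h1
    have h2 : γ = 1 := Subtype.ext h1
    exact hne (by rw [h2, map_one])
  have h1 := h γ γ.2 hγ (o + x)
  rwa [hρ₀, add_sub_add_left_eq_sub, ← Submodule.coe_sub] at h1

theorem NoReturn.restrict (h : NoReturn C Γ)
    (hρ₀ : ∀ (γ : Γ) (x : V₀), (γ : E ≃ᵃ[ℝ] E) (o + x) = o + ρ₀ γ x) :
    NoReturn ((↑) ⁻¹' C : Set V₀) ρ₀.range := by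
  intro v c hc hc0
  obtain ⟨t, ht, hnot⟩ := h (o + v) c hc fun h0 => hc0 (Subtype.ext h0)
  refine ⟨t, ht, fun hmem => hnot ?_⟩
  have hcont : Continuous fun x : V₀ => o + (x : E) := by fun_prop
  have h1 := map_mem_closure hcont hmem (t := {z | ∃ γ ∈ Γ, z - γ (o + v) ∈ C}) (by
    rintro z ⟨_, ⟨γ, rfl⟩, hz⟩
    refine ⟨γ, γ.2, ?_⟩
    rw [← coe_restrict_sub hρ₀]
    exact hz)
  rwa [Submodule.coe_sub, Submodule.coe_smul, ← add_sub_assoc] at h1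

theorem IsUnipotentOn.restrict (hU : IsUnipotentOn ℓ ξ Γ o V₀) (hξ : ξ ∈ V₀)
    (hρ₀ : ∀ (γ : Γ) (x : V₀), (γ : E ≃ᵃ[ℝ] E) (o + x) = o + ρ₀ γ x) :
    IsUnipotentOn (ℓ.restrict V₀) ⟨ξ, hξ⟩ ρ₀.range 0 ⊤ := by
  have hlin := coe_linear_restrict hρ₀
  refine ⟨?_, fun _ _ => Submodule.mem_top, fun _ _ _ _ => Submodule.mem_top, ?_⟩
  · rintro _ ⟨γ, rfl⟩
    refine ⟨fun x y => ?_, Subtype.ext ?_⟩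
    · change ℓ ((ρ₀ γ).linear x : V₀) ((ρ₀ γ).linear y : V₀) = ℓ x y
      rw [hlin, hlin]
      exact (hU.fixing γ γ.2).1 x y
    · rw [hlin]
      exact (hU.fixing γ γ.2).2
  · rintro _ ⟨γ, rfl⟩ w - hw
    obtain ⟨a, ha⟩ := hU.trivial_mod γ γ.2 w w.2 hw
    exact ⟨a, Subtype.ext ((hlin γ w).trans ha)⟩

/-- The exponent `3` counts the descent from `E` to `ξ^⊥`, to the line of `ξ`, and to `0`. -/
theorem IsUnipotentOn.isNilpotent (hU : IsUnipotentOn ℓ ξ Γ 0 ⊤) {γ : E ≃ᵃ[ℝ] E} (hγ : γ ∈ Γ) :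
    IsNilpotent ((γ.linear : E →ₗ[ℝ] E) - LinearMap.id : Module.End ℝ E) := by
  refine ⟨3, LinearMap.ext fun w => ?_⟩
  have hN : ∀ x, ((γ.linear : E →ₗ[ℝ] E) - LinearMap.id : Module.End ℝ E) x = γ.linear x - x :=
    fun x => rfl
  have hf := hU.fixing γ hγ
  obtain ⟨a, ha⟩ := hU.trivial_mod γ hγ (γ.linear w - w) Submodule.mem_top (hf.sub_orth w)
  rw [pow_succ, pow_two, Module.End.mul_apply, Module.End.mul_apply, hN w, hN (γ.linear w - w), ha,
    add_sub_cancel_left, hN, map_smul, hf.2, sub_self]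
  rfl

/-- A strictly causal flat complete manifold is finitely covered by one whose group is abelian and
splits into a unipotent and a linear part. -/
theorem IsStrictlyCausal.exists_splitting [FiniteDimensional ℝ E]
    (h : IsStrictlyCausal ℓ C Δ) (hℓ : IsLorentzian ℓ)
    (hC : IsTimeCone ℓ C) :
    ∃ Γ : Subgroup (E ≃ᵃ[ℝ] E), IsFiniteCover Γ Δ ∧ IsStrictlyCausal ℓ C Γ ∧
      (∀ γ ∈ Γ, ∀ γ' ∈ Γ, γ * γ' = γ' * γ) ∧
      ∃ (o : E) (V₀ V₁ : Submodule ℝ E) (ρ₀ : Γ →* (V₀ ≃ᵃ[ℝ] V₀))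
        (α : Γ →* orthogonalGroup (ℓ.restrict V₁)),
        IsSplitting ℓ C o V₀ V₁ Γ.subtype ρ₀ α := by
  obtain ⟨ξ, hξC, hne, hfix⟩ := h.exists_isFixing hℓ hC
  have hξ := hC.nonneg hξC
  obtain ⟨ε, hε, hdisc⟩ := (hasFiniteDisplacements_of_properlyDiscontinuous
    h.proper).exists_discrete h.free 0
  obtain ⟨Γ, hle, ⟨F, hF, hFΔ, hcov⟩, o, V₀, hU, hξV, hnd⟩ :=
    exists_finiteIndex_unipotent hℓ hξ hne hfix hε hdisc
  have hflat : IsFlatSpacetime ℓ C Γ := ⟨fun γ hγ => h.form γ (hle hγ),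
    fun γ hγ => h.cone γ (hle hγ), fun γ hγ => h.free γ (hle hγ),
    Subgroup.properlyDiscontinuousSMul_of_le h.proper hle⟩
  have hsp := (h.hasSpacelikeDisplacements hC).mono hle
  have h₀ := hℓ.restrict hξ hne hξV hnd
  have hC₀ := hC.restrict hℓ h₀
  obtain ⟨ρ₀, hρ₀⟩ := hU.exists_restrict
  obtain ⟨hinv, α, hα⟩ := exists_fibre_action hU
  have hflat₀ := hflat.restrict hρ₀
  have hsp₀ := hsp.restrict hρ₀
  have hU₀ := hU.restrict hξV hρ₀
  have hinj := restrict_injective hflat.free hρ₀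
  obtain ⟨hret, hret'⟩ := h.noReturn hC hℓ
  -- The absence of returns is inherited from `Δ` by `Γ` and then by the flat, where unipotence
  -- turns it into local finiteness; from there strict causality is lifted back to the whole space.
  have hlf₀ : LocallyFiniteCones (ℓ.restrict V₀) ρ₀.range :=
    locallyFiniteCones_of_noReturn h₀ hC₀
      (hasFiniteDisplacements_of_properlyDiscontinuous hflat₀.proper) hsp₀
      ((hret.mono hle).restrict hρ₀) ((hret'.mono hle).restrict hρ₀) hξC
      (fun h0 => hne (congrArg Subtype.val h0)) hU₀
  have hcompl := hℓ.isCompl_orthogonal h₀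
  have horth : ∀ x ∈ V₀, ∀ y ∈ ℓ.orthogonal V₀, ℓ x y = 0 := fun x hx y hy => hy x hx
  have hneg : ∀ y ∈ ℓ.orthogonal V₀, y ≠ 0 → ℓ y y < 0 := fun y hy hy0 =>
    hℓ.neg_of_forall_orthogonal h₀ (fun x hx => hy x hx) hy0
  have hfib : ∀ (γ : Γ) (x : V₀) (y : ℓ.orthogonal V₀), Γ.subtype γ (o + x + y) =
      o + ρ₀ γ x + (α γ : ℓ.orthogonal V₀ ≃ₗ[ℝ] ℓ.orthogonal V₀) y := by
    intro γ x y
    rw [hα, Subgroup.subtype_apply, affine_apply, hρ₀]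
  have hsc := isStrictlyCausal_of_fibre hℓ hC hcompl horth hneg hfib hinj hflat₀ hsp₀ hlf₀
  rw [Subgroup.range_subtype] at hsc
  exact ⟨Γ, isFiniteCover_of_finite h.toIsFlatSpacetime hle hF hFΔ hcov, hsc,
    fun γ hγ γ' hγ' => hU.mul_comm hℓ hξ hne hsp hγ hγ', o, V₀, ℓ.orthogonal V₀, ρ₀, α,
    hcompl, horth, fun γ => hU.linear_mem γ γ.2, fun γ => hinv γ γ.2, h₀, hneg, hρ₀,
    fun γ => hU₀.isNilpotent ⟨γ, rfl⟩, hinj,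
    isStrictlyCausal_of_locallyFiniteCones hC₀ h₀ hflat₀ hsp₀ hlf₀, hfib⟩

end Flat

end FlatLorentz

theorem mainTheorem2 {V : Type*} [NormedAddCommGroup V] [NormedSpace ℝ V] [FiniteDimensional ℝ V]
    (ℓ : LinearMap.BilinForm ℝ V) (hℓ : IsLorentzian ℓ) (C : Set V) (hC : IsTimeCone ℓ C) :
    (∀ Δ : Subgroup (V ≃ᵃ[ℝ] V), IsStrictlyCausal ℓ C Δ →
      ∃ Γ : Subgroup (V ≃ᵃ[ℝ] V), IsFiniteCover Γ Δ ∧ IsStrictlyCausal ℓ C Γ ∧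
        (∀ γ ∈ Γ, ∀ γ' ∈ Γ, γ * γ' = γ' * γ) ∧
        ∃ (o : V) (V₀ V₁ : Submodule ℝ V) (ρ₀ : Γ →* (V₀ ≃ᵃ[ℝ] V₀))
          (α : Γ →* orthogonalGroup (ℓ.restrict V₁)),
          IsSplitting ℓ C o V₀ V₁ Γ.subtype ρ₀ α) ∧
    (∀ Γ : Subgroup (V ≃ᵃ[ℝ] V), (∀ γ ∈ Γ, ∀ γ' ∈ Γ, γ * γ' = γ' * γ) →
      ∀ (o : V) (V₀ V₁ : Submodule ℝ V) (ρ₀ : Γ →* (V₀ ≃ᵃ[ℝ] V₀))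
        (α : Γ →* orthogonalGroup (ℓ.restrict V₁)),
        IsSplitting ℓ C o V₀ V₁ Γ.subtype ρ₀ α →
        ∀ β : Γ →* orthogonalGroup (ℓ.restrict V₁), ∃ ρ : Γ →* (V ≃ᵃ[ℝ] V),
          Function.Injective ρ ∧ IsStrictlyCausal ℓ C ρ.range ∧
          IsSplitting ℓ C o V₀ V₁ ρ ρ₀ β) :=
  ⟨fun _ h => h.exists_splitting hℓ hC, fun _ _ _ _ _ _ _ h β => h.exists_change_fibre hℓ hC β⟩
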